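/- Theorem (Bessel function of the second kind case). Let $k\ge -\tfrac14$ (in particular any $k>0$), $n=\sqrt{4k+1}$, $\nu=n/2$, and let $q_0>0$, $r_0>0$, $x_1\in\mathbb R$ and $\tau_0>0$ be constants. For $m>0$ consider the generalized second Paine problem $$-v''+\frac{k}{(t+m)^2}\,v=\lambda v\quad(0<t<\pi),\qquad v(0)=0=v(\pi).$$ Put $\tau=t+m$, $\bar\tau=\sqrt{|q_0/r_0|}\,\tau$, $\bar\omega(\bar\tau)=\sqrt{\bar\tau}\,Y_\nu(\bar\tau)$, $w=1/\bar\omega$ and $p=\bar\omega^4/r_0$, and define the canonical variable by $x(\tau)=-x_1+\int_{\tau_0}^{\tau}\sqrt{p/r_0}\,d\tau$ for $\tau>0$. Then: 1. For $\bar\tau>0$, $\bar\tau^2\bar\omega''+(\bar\tau^2-k)\bar\omega=0$; hence $\frac{q_0}{r_0}+w\frac{d^2}{d\tau^2}\left(\frac1w\right)=\frac{k}{\tau^2}$ wherever $\bar\omega\ne0$. 2. On $(0,\infty)$, $x(\tau)$ is strictly increasing with $dx/d\tau=\sqrt{p/r_0}$. As $s,\tau\to\infty$, $$\int_{\tau_0}^{s}\sigma\,Y_\nu(\sigma)^2\,d\sigma=\frac{s}{\pi}+O(1),\qquad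 x(\tau)+x_1=\frac{\tau}{\pi r_0}+O(1),$$ and the inverse function satisfies $\tau(x)=\pi r_0(x+x_1)+O(1)$, hence $\tau(x)\sim\pi r_0(x+x_1)$, as $x\to\infty$. 3. Suppose that $\sqrt{|q_0/r_0|}\,m$ and $\sqrt{|q_0/r_0|}\,(\pi+m)$ are not zeros of $Y_{n/2}$. Under $u(x)=w\,v(t)$ (where $\bar\omega\neq0$), with $v$ twice differentiable at the interior zeros of $\bar\omega$, if there are any, $v$ solves the Paine problem if and only if $u$ solves the exact canonical form $$-\frac{d}{dx}\Big(p(\tau(x))\frac{du}{dx}\Big)+q_0u=\lambda r_0u,\qquad x(m)<x<x(\pi+m),$$ with boundary conditions $\bar\omega^2u=0$ at both endpoints (the equation being imposed where $p\ne0$). 4. Replacing $\tau(x)$ by its leading-order expansion $\pi r_0(x+x_1)$ turns this exact form into $$-\frac{d}{dx}\Big\{\pi^2q_0(x+x_1)^2\,Y_{n/2}^4\big[\pi\sqrt{|q_0r_0|}\,(x+x_1)\big]\frac{du}{dx}\Big\}+q_0u=\lambda r_0u,\qquad a<x<b,$$ $$a=-x_1+\frac{m}{\pi r_0},\qquad b=-x_1+\frac{\pi+m}{\pi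 r_0},$$ $$\delta_0=\sqrt{\Big|\frac{q_0}{r_0}\Big|}\,m\,Y_{n/2}^2\Big(\sqrt{\Big|\frac{q_0}{r_0}\Big|}\,m\Big),\qquad \gamma_0=\sqrt{\Big|\frac{q_0}{r_0}\Big|}\,(\pi+m)\,Y_{n/2}^2\Big(\sqrt{\Big|\frac{q_0}{r_0}\Big|}\,(\pi+m)\Big),$$ and it is in this sense that the Paine problem asymptotically has this canonical form. Precisely, the coefficient $p$ of this form at $x>-x_1$ is $\bar\omega^4/r_0$ evaluated at $\tau=\pi r_0(x+x_1)$. With $\varphi(x)=-x_1+\tau(x)/(\pi r_0)$ (so $\varphi(x)=x+O(1)$ as $x\to\infty$), $\varphi$ maps the exact interval continuously and strictly increasingly onto $[a,b]$, with endpoints corresponding, and on that interval the exact coefficients at $x$ equal the coefficients of this form at $\varphi(x)$. The boundary constants of the two problems coincide. 5. $\delta_0\neq0\neq\gamma_0$, so the boundary conditions $\delta_0u(a)=0=\gamma_0u(b)$ are the Dirichlet conditions $u(a)=0=u(b)$. -/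

import Mathlib

open Real Set Filter Topology Asymptotics

noncomputable section

/-! ### Bessel functions of real order on the positive half-line -/

/-- Bessel function of the first kind `J_ν(x)`, `x > 0`, by its power series.
(`Real.Gamma` vanishes at its poles, so the terms with `1 / Γ = 0` are indeed `0`.) -/
def besselJ (ν x : ℝ) : ℝ :=
  ∑' j : ℕ, (-1 : ℝ) ^ j / ((Nat.factorial j : ℝ) * Real.Gamma ((j : ℝ) + ν + 1)) *
    (x / 2) ^ (2 * (j : ℝ) + ν)

/-- `(J_ν(x) cos νπ - J_{-ν}(x)) / sin νπ`, meaningful for `ν ∉ ℤ`. -/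
def besselYQuotient (ν x : ℝ) : ℝ :=
  (besselJ ν x * cos (ν * π) - besselJ (-ν) x) / sin (ν * π)

open Classical in
/-- Bessel function of the second kind `Y_ν(x)`, `x > 0`: the quotient above for `ν ∉ ℤ`, and
its limit as the order tends to `ν` when `ν ∈ ℤ`. -/
def besselY (ν x : ℝ) : ℝ :=
  if ∃ j : ℤ, ν = j then limUnder (𝓝[≠] ν) (fun μ => besselYQuotient μ x)
  else besselYQuotient ν x

/-! ### Sturm-Liouville problems -/

/-- Data of the problem `-(p u')' + q u = λ r u` on `a < x < b` with boundary conditions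
`δ₀ u(a) - δ₁ p(a) u'(a) = 0` and `γ₀ u(b) - γ₁ p(b) u'(b) = 0`. -/
structure SturmLiouville where
  p : ℝ → ℝ
  q : ℝ → ℝ
  r : ℝ → ℝ
  a : ℝ
  b : ℝ
  δ₀ : ℝ
  δ₁ : ℝ
  γ₀ : ℝ
  γ₁ : ℝ

namespace SturmLiouville

/-- The boundary conditions of `S`. -/
def BoundaryConditions (S : SturmLiouville) (u : ℝ → ℝ) : Prop :=
  S.δ₀ * u S.a - S.δ₁ * (S.p S.a * derivWithin u (Icc S.a S.b) S.a) = 0 ∧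
  S.γ₀ * u S.b - S.γ₁ * (S.p S.b * derivWithin u (Icc S.a S.b) S.b) = 0

/-- The differential equation of `S` with spectral parameter `lam` holds for `u` at `x`. -/
def EquationAt (S : SturmLiouville) (lam : ℝ) (u : ℝ → ℝ) (x : ℝ) : Prop :=
  DifferentiableAt ℝ u x ∧ DifferentiableAt ℝ (fun y => S.p y * deriv u y) x ∧
  -deriv (fun y => S.p y * deriv u y) x + S.q x * u x = lam * (S.r x * u x)

/-- `u` solves `S` with spectral parameter `lam`. Where the leading coefficient `p` vanishes
inside the interval the equation is singular, and it is imposed off the zeros of `p` only. -/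
def IsSolution (S : SturmLiouville) (lam : ℝ) (u : ℝ → ℝ) : Prop :=
  (∀ x ∈ Ioo S.a S.b, S.p x ≠ 0 → S.EquationAt lam u x) ∧
  ContinuousWithinAt u (Icc S.a S.b) S.a ∧ ContinuousWithinAt u (Icc S.a S.b) S.b ∧
  S.BoundaryConditions u

/-- `E` is `S` with the independent variable `x` replaced by `φ x`: same endpoints, coefficient
functions and boundary constants up to this replacement (the form `-(p u')' + q u = λ r u` itself
is kept, with `'` the derivative in the variable of the respective problem). -/
def IsReplacementOf (E S : SturmLiouville) (φ : ℝ → ℝ) : Prop :=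
  ContinuousOn φ (Icc E.a E.b) ∧ StrictMonoOn φ (Icc E.a E.b) ∧ φ E.a = S.a ∧ φ E.b = S.b ∧
  (∀ x ∈ Icc E.a E.b,
    E.p x = S.p (φ x) ∧ E.q x = S.q (φ x) ∧ E.r x = S.r (φ x)) ∧
  E.δ₀ = S.δ₀ ∧ E.δ₁ = S.δ₁ ∧ E.γ₀ = S.γ₀ ∧ E.γ₁ = S.γ₁

end SturmLiouville

/-- The generalized second Paine problem, in Liouville normal form:
`-v'' + k / (t + m)² v = λ v`, `v(0) = 0 = v(π)`. -/
def paineProblem (k m : ℝ) : SturmLiouville where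
  p := fun _ => 1
  q := fun t => k / (t + m) ^ 2
  r := fun _ => 1
  a := 0
  b := π
  δ₀ := 1
  δ₁ := 0
  γ₀ := 1
  γ₁ := 0

/-! ### Inverse Liouville transformation with constant potential and density

Throughout `τ = t + m` and `τ̄ = √(|q₀| / |r₀|) τ`. -/

/-- `ω̄(τ̄) = √τ̄ Y_ν(τ̄)`. -/
def omegaBar (ν s : ℝ) : ℝ := √s * besselY ν s

/-- `1 / w` as a function of `τ`. -/
def omegaOf (ν q₀ r₀ τ : ℝ) : ℝ := omegaBar ν (√(|q₀| / |r₀|) * τ)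

/-- The coefficient `p = ω̄⁴ / r₀` as a function of `τ`; thus `w = (p r₀)^(-1/4)`
up to sign. -/
def pOfTau (ν q₀ r₀ τ : ℝ) : ℝ := omegaOf ν q₀ r₀ τ ^ 4 / r₀

/-- The canonical variable `x = -x₁ + ∫ √(p / r) dτ`; the constant of integration `x₁` and the
base point `τ₀ > 0` are arbitrary. -/
def canonicalVar (ν q₀ r₀ x₁ τ₀ τ : ℝ) : ℝ :=
  -x₁ + ∫ s in τ₀..τ, √(pOfTau ν q₀ r₀ s / r₀)

/-- The inverse relation: `τ > 0` as a function of the canonical variable `x`. -/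
def schrodingerVar (ν q₀ r₀ x₁ τ₀ x : ℝ) : ℝ :=
  Function.invFunOn (canonicalVar ν q₀ r₀ x₁ τ₀) (Ioi 0) x

/-- The exact canonical form of the Paine problem produced by the inverse Liouville
transformation. -/
def exactCanonicalForm (ν q₀ r₀ x₁ τ₀ m : ℝ) : SturmLiouville where
  p := fun x => pOfTau ν q₀ r₀ (schrodingerVar ν q₀ r₀ x₁ τ₀ x)
  q := fun _ => q₀
  r := fun _ => r₀
  a := canonicalVar ν q₀ r₀ x₁ τ₀ m
  b := canonicalVar ν q₀ r₀ x₁ τ₀ (π + m)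
  δ₀ := omegaOf ν q₀ r₀ m ^ 2
  δ₁ := 0
  γ₀ := omegaOf ν q₀ r₀ (π + m) ^ 2
  γ₁ := 0

/-- The asymptotic canonical form with `Y_{n/2}` in closed form. -/
def besselYCanonicalForm (n q₀ r₀ x₁ m : ℝ) : SturmLiouville where
  p := fun x => π ^ 2 * q₀ * (x + x₁) ^ 2 * besselY (n / 2) (π * √|q₀ * r₀| * (x + x₁)) ^ 4
  q := fun _ => q₀
  r := fun _ => r₀
  a := -x₁ + m / (π * r₀)
  b := -x₁ + (π + m) / (π * r₀)
  δ₀ := √|q₀ / r₀| * m * besselY (n / 2) (√|q₀ / r₀| * m) ^ 2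
  δ₁ := 0
  γ₀ := √|q₀ / r₀| * (π + m) * besselY (n / 2) (√|q₀ / r₀| * (π + m)) ^ 2
  γ₁ := 0

end

noncomputable section

/-! ### The entire factor of `J_μ` -/

/-! With `ν² − 1/4 = k`, the function `ω̄ = √s Y_ν` solves `a'' = (k/s² − 1) a`, so after scaling `ω
= 1/w` solves the Paine equation with spectral parameter `q₀/r₀`. If `v` solves it with parameter
`λ` and `u = v/ω`, then `p u' = v'ω − vω'` is a Wronskian: its `t`-derivative is `(q₀/r₀ − λ) v ω`,
which becomes `(q₀ − λ r₀) u` after division by `dx/dt = ω²/r₀`. This is the exchange of equations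
in `exactCanonicalForm_equationAt`; `paineProblem_equationAt` is the converse. Zeros of `ω` are
simple, hence isolated, and there the Paine equation is recovered by continuity
(`paineProblem_equationAt_of_zero`).

The analytic content is `∫ σ Y_ν² = s/π + O(1)`. For every solution `a` the energy `a² + a'²` has
derivative `O(1/s²)`, hence a limit `H` approached at rate `1/s`, and an explicit primitive of `a²`
gives `∫ a² = (H/2) s + O(1)` (`integral_sq_isBigO`). What remains is `H = 2/π` for `√s Y_ν`
(`hasBesselAmplitude`).

That constant comes from `J_μ`, `μ > −1/2`. The Laplace transform of `x^μ J_μ` satisfies a first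
order equation and is a constant times `(P² + 1)^(−μ−1/2)`. Along the line `Im P = 1`, the behaviour
at infinity fixes the constant, while the behaviour at the singularity `P = i` reads off the
amplitude of `√s J_μ` (`tendsto_amplitude_besselJ`). Combining the orders `ν` and `−ν` settles `0 <
|ν| < 1/2`; the recurrences carry the result through integer shifts, and a limit in the order
reaches the integers and half-integers. Since `Y` at integers is itself a limit of quotients, its
recurrences come from a limit theorem for differential equations
(`hasDerivAt_of_tendsto_of_norm_le`).

Finally `x = −x₁ + τ/(π r₀) + O(1)` is inverted, and the comparison of the two canonical forms is
algebra: `φ(x(τ)) = −x₁ + τ/(π r₀)`, so substituting `φ` for `x` in the closed form evaluates `p` at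
exactly `τ`. -/

lemma exists_bound_inv_Gamma (R : ℝ) :
    ∃ C : ℝ, ∀ (j : ℕ) (z : ℂ), ‖z‖ ≤ R → ‖(Complex.Gamma (j + z + 1))⁻¹‖ ≤ C := by
  -- For a single `j`, `1/Γ` is entire and the ball is compact; only uniformity in `j` needs an
  -- argument.
  have hb : ∀ j : ℕ, ∃ c : ℝ, ∀ z ∈ Metric.closedBall (0 : ℂ) R,
      ‖(Complex.Gamma (j + z + 1))⁻¹‖ ≤ c := fun j =>
    (isCompact_closedBall (0 : ℂ) R).exists_bound_of_continuousOn
      (Complex.differentiable_one_div_Gamma.comp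
        (f := fun z : ℂ => (j : ℂ) + z + 1) (by fun_prop)).continuous.continuousOn
  choose c hc using hb
  -- For `i ≥ M` the factor `i + z + 1` has modulus at least 1, so passing from `i` to `i + 1`
  -- cannot increase `1/|Γ|`. The bounds up to `M` therefore suffice.
  obtain ⟨M, hM⟩ := exists_nat_ge (R + 1)
  refine ⟨∑ i ∈ Finset.range (M + 1), |c i|, fun j => ?_⟩
  induction j with
  | zero =>
    intro z hz
    refine (hc 0 z (by simpa using hz)).trans ((le_abs_self _).trans ?_)
    exact Finset.single_le_sum (f := fun i => |c i|) (fun i _ => abs_nonneg _) (by simp)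
  | succ i ih =>
    intro z hz
    by_cases hi : i + 1 ≤ M
    · refine (hc (i + 1) z (by simpa using hz)).trans ((le_abs_self _).trans ?_)
      exact Finset.single_le_sum (f := fun i => |c i|) (fun i _ => abs_nonneg _)
        (by simp; omega)
    · have hiM : (M : ℝ) ≤ i := by exact_mod_cast (by omega : M ≤ i)
      have h1 : 1 ≤ ‖(i : ℂ) + z + 1‖ := by
        have h2 : ‖((i : ℂ) + 1)‖ ≤ ‖(i : ℂ) + z + 1‖ + ‖z‖ := by
          simpa using norm_sub_le ((i : ℂ) + z + 1) z |>.trans' (by ring_nf; rfl)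
        have h3 : ‖((i : ℂ) + 1)‖ = (i : ℝ) + 1 := by
          rw [show ((i : ℂ) + 1) = ((i + 1 : ℕ) : ℂ) by push_cast; ring, Complex.norm_natCast]
          push_cast; ring
        linarith
      have h0 : (i : ℂ) + z + 1 ≠ 0 := by
        intro h; rw [h] at h1; norm_num at h1
      have : Complex.Gamma (((i + 1 : ℕ) : ℂ) + z + 1)
          = ((i : ℂ) + z + 1) * Complex.Gamma ((i : ℂ) + z + 1) := by
        rw [← Complex.Gamma_add_one _ h0]; push_cast; ring_nf
      rw [this, mul_inv, norm_mul, norm_inv ((i : ℂ) + z + 1)]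
      exact (mul_le_of_le_one_left (norm_nonneg _) (inv_le_one_of_one_le₀ h1)).trans (ih z hz)

/-- The Taylor coefficients of the entire function `(x / 2)^(-μ) J_μ(x)` in `(x / 2)²`. -/
def besselCoeff (μ : ℝ) (j : ℕ) : ℝ :=
  (-1 : ℝ) ^ j / ((Nat.factorial j : ℝ) * Real.Gamma ((j : ℝ) + μ + 1))

/-- `(x / 2)^(-μ) J_μ(x)` as an entire function of `z = (x / 2)²`. -/
def besselEntire (μ z : ℝ) : ℝ := ∑' j : ℕ, besselCoeff μ j * z ^ j

/-- The factors `1/Γ` are uniformly bounded, so the exponential series dominates. -/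
lemma summable_norm_besselCoeff (μ r : ℝ) : Summable fun j => ‖besselCoeff μ j * r ^ j‖ := by
  obtain ⟨C, hC⟩ := exists_bound_inv_Gamma |μ|
  refine Summable.of_nonneg_of_le (fun _ => norm_nonneg _) (fun j => ?_)
    ((Real.summable_pow_div_factorial |r|).mul_left C)
  have h := hC j μ (by simp)
  have h2 : ‖(Complex.Gamma (j + (μ : ℂ) + 1))⁻¹‖ = |(Real.Gamma (j + μ + 1))⁻¹| := by
    rw [← Real.norm_eq_abs, ← Complex.norm_real, Complex.ofReal_inv, ← Complex.Gamma_ofReal]; push_cast; rfl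
  rw [h2] at h
  have h3 : ‖besselCoeff μ j * r ^ j‖
      = |(Real.Gamma (j + μ + 1))⁻¹| * (|r| ^ j / (Nat.factorial j : ℝ)) := by
    rw [besselCoeff, Real.norm_eq_abs, abs_mul, abs_div, abs_pow, abs_pow, abs_mul, abs_inv]
    simp [div_eq_mul_inv]; ring
  rw [h3]
  gcongr

lemma summable_besselCoeff (μ r : ℝ) : Summable fun j => besselCoeff μ j * r ^ j :=
  (summable_norm_besselCoeff μ r).of_norm

lemma besselCoeff_succ (μ : ℝ) (j : ℕ) :
    besselCoeff μ (j + 1) * (j + 1) = -besselCoeff (μ + 1) j := by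
  rw [besselCoeff, besselCoeff, Nat.factorial_succ]
  have h : (j : ℝ) + (μ + 1) + 1 = ((j + 1 : ℕ) : ℝ) + μ + 1 := by push_cast; ring
  have hj : (j : ℝ) + 1 ≠ 0 := by positivity
  rw [h]
  push_cast
  field_simp
  ring

/-- This is the functional equation of `Γ`. It survives at the poles because `Γ` has the value 0
there and `1/0 = 0`, so `μ` is unrestricted. -/
lemma besselCoeff_sub_one (μ : ℝ) (j : ℕ) :
    besselCoeff (μ - 1) j = (μ + j) * besselCoeff μ j := by
  rw [besselCoeff, besselCoeff, show (j : ℝ) + (μ - 1) + 1 = j + μ by ring]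
  rcases eq_or_ne ((j : ℝ) + μ) 0 with h | h
  · rw [h, show μ + j = 0 by linarith]; simp
  · rw [Real.Gamma_add_one h]
    rcases eq_or_ne (Real.Gamma (j + μ)) 0 with h' | h'
    · rw [h']; simp
    · have : μ + j ≠ 0 := by rwa [add_comm]
      field_simp
      ring

lemma hasDerivAt_besselEntire (μ z : ℝ) :
    HasDerivAt (besselEntire μ) (-besselEntire (μ + 1) z) z := by
  set r : ℝ := |z| + 1
  have hr : 0 < r := by positivity
  -- After an index shift, the derived series is up to sign the series of order `μ + 1`, which
  -- converges for every radius.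
  have hu : Summable fun n : ℕ => ‖besselCoeff μ n * (n * r ^ (n - 1))‖ := by
    rw [← summable_nat_add_iff 1]
    refine (summable_norm_besselCoeff (μ + 1) r).congr fun n => ?_
    rw [Nat.add_sub_cancel, ← mul_assoc]
    push_cast
    rw [besselCoeff_succ, neg_mul, norm_neg]
  have key := hasDerivAt_tsum_of_isPreconnected (𝕜 := ℝ) (t := Metric.ball (0 : ℝ) r)
    (g := fun n y => besselCoeff μ n * y ^ n)
    (g' := fun n y => besselCoeff μ n * (n * y ^ (n - 1))) (y₀ := 0) (y := z) hu Metric.isOpen_ball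
    (convex_ball _ _).isPreconnected (fun n y _ => (hasDerivAt_pow n y).const_mul _) ?_
    (by simpa using hr) (summable_besselCoeff μ 0) (by simp [r])
  · refine key.congr_deriv ?_
    rw [besselEntire, ← tsum_neg, tsum_eq_zero_add']
    · simp only [Nat.cast_zero, zero_mul, mul_zero, zero_add, Nat.add_sub_cancel]
      refine tsum_congr fun n => ?_
      push_cast
      rw [← mul_assoc, besselCoeff_succ, neg_mul]
    · refine (summable_besselCoeff (μ + 1) z).neg.congr fun n => ?_
      rw [Nat.add_sub_cancel, ← mul_assoc]
      push_cast
      rw [besselCoeff_succ, neg_mul]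
  · intro n y hy
    simp only [norm_mul, norm_pow, Real.norm_eq_abs]
    have : |y| ≤ |r| := by
      rw [abs_of_pos hr]; simpa using (Metric.mem_ball.1 hy).le
    gcongr

/-- Split the coefficient `(μ + j) c_j` of the left side: the part `j c_j` shifts to the series of
order `μ + 1`. -/
lemma besselEntire_sub_one (μ z : ℝ) :
    besselEntire (μ - 1) z = μ * besselEntire μ z - z * besselEntire (μ + 1) z := by
  have h2 : z * besselEntire (μ + 1) z = -∑' j : ℕ, (j : ℝ) * (besselCoeff μ j * z ^ j) := by
    rw [tsum_eq_zero_add']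
    · simp only [Nat.cast_zero, zero_mul, zero_add]
      rw [besselEntire, ← tsum_mul_left, ← tsum_neg]
      refine tsum_congr fun n => ?_
      have := besselCoeff_succ μ n
      push_cast
      rw [pow_succ]
      linear_combination (z ^ n * z) * this
    · refine ((summable_besselCoeff (μ + 1) z).mul_left (-z)).congr fun n => ?_
      have := besselCoeff_succ μ n
      push_cast
      rw [pow_succ]
      linear_combination (-z ^ n * z) * this
  have hs : Summable fun j : ℕ => (j : ℝ) * (besselCoeff μ j * z ^ j) := by
    refine ((summable_besselCoeff (μ - 1) z).sub ((summable_besselCoeff μ z).mul_left μ)).congr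
      fun n => ?_
    rw [besselCoeff_sub_one]; ring
  rw [h2, sub_neg_eq_add, besselEntire, besselEntire, ← tsum_mul_left,
    ← Summable.tsum_add ((summable_besselCoeff μ z).mul_left μ) hs]
  refine tsum_congr fun n => ?_
  rw [besselCoeff_sub_one]; ring

lemma besselEntire_zero_right (μ : ℝ) : besselEntire μ 0 = (Real.Gamma (μ + 1))⁻¹ := by
  rw [besselEntire, tsum_eq_single 0]
  · simp [besselCoeff]
  · intro j hj; simp [hj]

lemma besselJ_eq (μ : ℝ) {x : ℝ} (hx : 0 < x) :
    besselJ μ x = (x / 2) ^ μ * besselEntire μ ((x / 2) ^ 2) := by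
  rw [besselJ, besselEntire, ← tsum_mul_left]
  refine tsum_congr fun j => ?_
  rw [besselCoeff, rpow_add (by positivity), show (2 * (j : ℝ)) = ((2 * j : ℕ) : ℝ) by push_cast; rfl,
    rpow_natCast, pow_mul]
  ring

lemma hasDerivAt_besselJ_add_one (μ : ℝ) {x : ℝ} (hx : 0 < x) :
    HasDerivAt (besselJ μ) (μ / x * besselJ μ x - besselJ (μ + 1) x) x := by
  have h1 : HasDerivAt (fun x : ℝ => (x / 2) ^ μ * besselEntire μ ((x / 2) ^ 2))
      (μ / x * besselJ μ x - besselJ (μ + 1) x) x := by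
    have ha : HasDerivAt (fun x : ℝ => x / 2) (1 / 2) x := (hasDerivAt_id x).div_const 2
    have hb := (ha.rpow_const (p := μ) (Or.inl (by positivity))).mul
      ((hasDerivAt_besselEntire μ ((x / 2) ^ 2)).comp x (ha.pow 2))
    refine hb.congr_deriv ?_
    rw [besselJ_eq μ hx, besselJ_eq (μ + 1) hx, rpow_add_one (by positivity),
      rpow_sub_one (by positivity)]
    push_cast
    simp only [Function.comp, Pi.pow_apply]
    field_simp
    ring
  refine h1.congr_of_eventuallyEq ?_
  filter_upwards [lt_mem_nhds hx] with y hy using besselJ_eq μ hy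

lemma besselJ_sub_one (μ : ℝ) {x : ℝ} (hx : 0 < x) :
    besselJ (μ - 1) x = 2 * μ / x * besselJ μ x - besselJ (μ + 1) x := by
  rw [besselJ_eq _ hx, besselJ_eq _ hx, besselJ_eq _ hx, besselEntire_sub_one,
    rpow_add_one (by positivity), rpow_sub_one (by positivity)]
  field_simp

lemma hasDerivAt_besselJ (μ : ℝ) {x : ℝ} (hx : 0 < x) :
    HasDerivAt (besselJ μ) (besselJ (μ - 1) x - μ / x * besselJ μ x) x := by
  refine (hasDerivAt_besselJ_add_one μ hx).congr_deriv ?_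
  rw [besselJ_sub_one μ hx]; ring

lemma besselJ_neg_natCast (N : ℕ) {x : ℝ} (hx : 0 < x) :
    besselJ (-N) x = (-1) ^ N * besselJ N x := by
  -- The first `N` terms of `J_{−N}` vanish because their Gamma factors sit at poles; the remaining
  -- terms match those of `J_N` after a shift by `N`.
  rw [besselJ_eq _ hx, besselJ_eq _ hx, besselEntire, besselEntire,
    ← (summable_besselCoeff (-N) _).sum_add_tsum_nat_add N, Finset.sum_eq_zero, zero_add,
    ← tsum_mul_left, ← tsum_mul_left, ← tsum_mul_left]
  · refine tsum_congr fun j => ?_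
    rw [besselCoeff, besselCoeff, rpow_neg (by positivity), rpow_natCast, ← pow_mul, ← pow_mul,
      show ((j + N : ℕ) : ℝ) + -N + 1 = j + 1 by push_cast; ring,
      show (j : ℝ) + N + 1 = ((j + N : ℕ) : ℝ) + 1 by push_cast; ring,
      Real.Gamma_nat_eq_factorial, Real.Gamma_nat_eq_factorial]
    have : x / 2 ≠ 0 := by positivity
    field_simp
    ring
  · intro j hj
    have hj := Finset.mem_range.1 hj
    obtain ⟨i, rfl⟩ : ∃ i, N = j + 1 + i := ⟨N - (j + 1), by omega⟩
    rw [besselCoeff, show (j : ℝ) + -((j + 1 + i : ℕ) : ℝ) + 1 = -(i : ℝ) by push_cast; ring,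
      Real.Gamma_neg_nat_eq_zero]
    simp

/-- Makes the numerator of `besselYQuotient` vanish at integer orders, where the denominator
vanishes too. -/
lemma besselJ_neg_intCast (N : ℤ) {x : ℝ} (hx : 0 < x) :
    besselJ (-N) x = cos (N * π) * besselJ N x := by
  rw [Real.cos_int_mul_pi]
  obtain ⟨n, rfl | rfl⟩ := N.eq_nat_or_neg
  · simpa using besselJ_neg_natCast n hx
  · have := besselJ_neg_natCast n hx
    push_cast
    rw [neg_neg, this, ← mul_assoc]
    simp

/-! ### Differentiability in the order -/

/-- In a complex order the series consists of entire terms and converges locally uniformly, by the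
uniform bound on `1/Γ`; its sum is holomorphic, and the real function is its restriction to the real
line. -/
lemma differentiable_besselEntire_order (z : ℝ) : Differentiable ℝ fun μ => besselEntire μ z := by
  intro μ
  let f : ℂ → ℂ := fun s => ∑' j : ℕ,
    ((-1 : ℂ) ^ j / (Nat.factorial j : ℂ) * (z : ℂ) ^ j) * (Complex.Gamma (j + s + 1))⁻¹
  have hre : ∀ s : ℝ, besselEntire s z = (f s).re := by
    intro s
    have : f s = ((besselEntire s z : ℝ) : ℂ) := by
      rw [besselEntire, Complex.ofReal_tsum]
      refine tsum_congr fun j => ?_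
      rw [besselCoeff]
      push_cast
      rw [← Complex.Gamma_ofReal]
      push_cast
      rw [div_mul_eq_div_div]
      ring
    rw [this, Complex.ofReal_re]
  obtain ⟨C, hC⟩ := exists_bound_inv_Gamma (|μ| + 1)
  have hd : DifferentiableOn ℂ f (Metric.ball 0 (|μ| + 1)) := by
    refine Complex.differentiableOn_tsum_of_summable_norm
      ((Real.summable_pow_div_factorial |z|).mul_right C) (fun j => ?_) Metric.isOpen_ball ?_
    · exact ((Complex.differentiable_one_div_Gamma.comp
        (f := fun z : ℂ => (j : ℂ) + z + 1) (by fun_prop)).const_mul _).differentiableOn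
    · intro j s hs
      have h1 := hC j s (by simpa using (Metric.mem_ball.1 hs).le)
      rw [norm_mul]
      have h2 : ‖(-1 : ℂ) ^ j / (Nat.factorial j : ℂ) * (z : ℂ) ^ j‖
          = |z| ^ j / (Nat.factorial j : ℝ) := by
        simp [div_eq_mul_inv]; ring
      rw [h2]
      gcongr
  have hdμ : DifferentiableAt ℂ f (μ : ℂ) :=
    hd.differentiableAt (Metric.isOpen_ball.mem_nhds (by simp))
  have := hdμ.hasDerivAt.real_of_complex
  refine (this.congr_of_eventuallyEq ?_).differentiableAt
  exact Eventually.of_forall hre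

lemma differentiable_besselJ_order {x : ℝ} (hx : 0 < x) :
    Differentiable ℝ fun μ => besselJ μ x := by
  have h : (fun μ => besselJ μ x) = fun μ => (x / 2) ^ μ * besselEntire μ ((x / 2) ^ 2) :=
    funext fun μ => besselJ_eq μ hx
  rw [h]
  exact fun μ => ((hasDerivAt_id μ).const_rpow (by positivity)).differentiableAt.mul
    (differentiable_besselEntire_order _ μ)

/-! ### Limits of solutions of linear differential equations -/

/-- A pointwise limit of solutions of `y' = v` with `‖v‖ ≤ K ‖y‖` solves the limiting equation. -/
lemma hasDerivAt_of_tendsto_of_norm_le {ι E : Type*} [NormedAddCommGroup E] [NormedSpace ℝ E]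
    [CompleteSpace E] {l : Filter ι} [l.NeBot] [l.IsCountablyGenerated] {y v : ι → ℝ → E}
    {Y V : ℝ → E} {α β K x : ℝ} (hα : α < x) (hβ : x < β) (hK : 0 ≤ K)
    (hd : ∀ᶠ i in l, ∀ s ∈ Icc α β, HasDerivAt (y i) (v i s) s ∧ ‖v i s‖ ≤ K * ‖y i s‖)
    (hc : ∀ᶠ i in l, ContinuousOn (v i) (Icc α β))
    (hy : ∀ s ∈ Icc α β, Tendsto (fun i => y i s) l (𝓝 (Y s)))
    (hv : ∀ s ∈ Icc α β, Tendsto (fun i => v i s) l (𝓝 (V s)))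
    (hV : ContinuousOn Y (Icc α β) → ContinuousOn V (Icc α β)) : HasDerivAt Y (V x) x := by
  have hαβ : α ≤ β := by linarith
  have hbd : ∀ᶠ i in l, ‖y i α‖ ≤ ‖Y α‖ + 1 :=
    ((hy α (left_mem_Icc.2 hαβ)).norm.eventually_le_const (by linarith))
  set B : ℝ := (‖Y α‖ + 1) * exp (K * (β - α))
  have hB : 0 ≤ B := by positivity
  -- Gronwall from the left endpoint, where the approximants are eventually bounded by `‖Y α‖ + 1`,
  -- bounds all derivatives uniformly.
  have hbound : ∀ᶠ i in l, ∀ s ∈ Icc α β, ‖v i s‖ ≤ K * B := by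
    filter_upwards [hd, hbd] with i hi hiα s hs
    refine (hi s hs).2.trans (mul_le_mul_of_nonneg_left ?_ hK)
    have := norm_le_gronwallBound_of_norm_deriv_right_le (f := y i) (f' := v i) (K := K) (ε := 0)
      (fun t ht => (hi t ht).1.continuousAt.continuousWithinAt)
      (fun t ht => (hi t (Ico_subset_Icc_self ht)).1.hasDerivWithinAt) hiα
      (fun t ht => by simpa using (hi t (Ico_subset_Icc_self ht)).2) s hs
    rw [gronwallBound_ε0] at this
    refine this.trans ?_
    have := hs.2
    simp only [B]
    gcongr
  -- A pointwise limit of uniformly Lipschitz functions is Lipschitz; this is where the continuity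
  -- of `Y`, and through `hV` that of `V`, comes from.
  have hlip : ∀ s ∈ Icc α β, ∀ t ∈ Icc α β, ‖Y t - Y s‖ ≤ K * B * ‖t - s‖ := by
    intro s hs t ht
    refine le_of_tendsto ((hy t ht).sub (hy s hs)).norm ?_
    filter_upwards [hd, hbound] with i hi hib
    exact (convex_Icc α β).norm_image_sub_le_of_norm_hasDerivWithin_le
      (fun r hr => (hi r hr).1.hasDerivWithinAt) hib hs ht
  have hYc : ContinuousOn Y (Icc α β) := by
    refine (LipschitzOnWith.of_dist_le_mul (K := ⟨K * B, by positivity⟩) ?_).continuousOn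
    intro t ht s hs
    rw [dist_eq_norm, dist_eq_norm]
    exact hlip s hs t ht
  have hVc := hV hYc
  -- The integral equation passes to the limit by dominated convergence; differentiating it
  -- afterwards gives the claim.
  have hint : ∀ t ∈ Icc α β, Y t - Y α = ∫ s in α..t, V s := by
    intro t ht
    have hsub : Icc α t ⊆ Icc α β := Icc_subset_Icc_right ht.2
    have h1 : Tendsto (fun i => ∫ s in α..t, v i s) l (𝓝 (∫ s in α..t, V s)) := by
      refine intervalIntegral.tendsto_integral_filter_of_dominated_convergence (fun _ => K * B)
        ?_ ?_ (by simp) ?_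
      · filter_upwards [hc] with i hi
        rw [uIoc_of_le ht.1]
        exact (hi.mono (Ioc_subset_Icc_self.trans hsub)).aestronglyMeasurable measurableSet_Ioc
      · filter_upwards [hbound] with i hi
        refine Eventually.of_forall fun s hs => ?_
        rw [uIoc_of_le ht.1] at hs
        exact hi s (hsub (Ioc_subset_Icc_self hs))
      · refine Eventually.of_forall fun s hs => ?_
        rw [uIoc_of_le ht.1] at hs
        exact hv s (hsub (Ioc_subset_Icc_self hs))
    refine tendsto_nhds_unique ((hy t ht).sub (hy α (left_mem_Icc.2 hαβ))) (h1.congr' ?_)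
    filter_upwards [hd, hc] with i hi hic
    refine intervalIntegral.integral_eq_sub_of_hasDerivAt (fun s hs => ?_) ?_
    · rw [uIcc_of_le ht.1] at hs
      exact (hi s (hsub hs)).1
    · refine ContinuousOn.intervalIntegrable ?_
      rw [uIcc_of_le ht.1]
      exact hic.mono hsub
  have hx : Icc α β ∈ 𝓝 x := Icc_mem_nhds hα hβ
  have h2 : HasDerivAt (fun t => Y α + ∫ s in α..t, V s) (V x) x := by
    refine (intervalIntegral.integral_hasDerivAt_right ?_ ?_ (hVc.continuousAt hx)).const_add _
    · refine ContinuousOn.intervalIntegrable ?_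
      rw [uIcc_of_le hα.le]
      exact hVc.mono (Icc_subset_Icc_right hβ.le)
    · exact hVc.stronglyMeasurableAtFilter_nhdsWithin measurableSet_Icc x |>.filter_mono
        (by rw [nhdsWithin_eq_nhds.2 hx])
  refine h2.congr_of_eventuallyEq ?_
  filter_upwards [hx] with t ht
  rw [← hint t ht]; abel

/-! ### Bessel functions of the second kind -/

lemma eventually_sin_mul_pi_ne_zero (ν : ℝ) : ∀ᶠ μ in 𝓝[≠] ν, sin (μ * π) ≠ 0 := by
  have hd : HasDerivAt (fun μ => sin (μ * π)) (cos (ν * π) * (1 * π)) ν :=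
    ((hasDerivAt_id ν).mul_const π).sin
  by_cases h : sin (ν * π) = 0
  · refine hd.eventually_ne (mul_ne_zero (fun h' => ?_) (by positivity))
    have := sin_sq_add_cos_sq (ν * π)
    rw [h, h'] at this
    norm_num at this
  · exact nhdsWithin_le_nhds (hd.continuousAt.eventually_ne h)

/-- Shows that the `limUnder` in the definition of `besselY` is a genuine limit. At an integer the
numerator and the denominator both vanish, so the quotient is a ratio of slopes and converges to the
ratio of the derivatives in the order; elsewhere it is continuous. -/
lemma tendsto_besselYQuotient (ν : ℝ) {x : ℝ} (hx : 0 < x) :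
    Tendsto (fun μ => besselYQuotient μ x) (𝓝[≠] ν) (𝓝 (besselY ν x)) := by
  have hs : HasDerivAt (fun μ => sin (μ * π)) (cos (ν * π) * (1 * π)) ν :=
    ((hasDerivAt_id ν).mul_const π).sin
  have hn : DifferentiableAt ℝ
      (fun μ => besselJ μ x * cos (μ * π) - besselJ (-μ) x) ν := by
    refine ((differentiable_besselJ_order hx ν).mul (by fun_prop)).sub ?_
    exact (differentiable_besselJ_order hx (-ν)).comp (f := fun μ => -μ) ν differentiableAt_id.neg
  by_cases h : ∃ j : ℤ, ν = j
  · obtain ⟨j, rfl⟩ := h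
    have hsin : sin (j * π) = 0 := sin_int_mul_pi j
    have hc : cos (j * π) ≠ 0 := fun h' => by
      have := sin_sq_add_cos_sq (j * π)
      rw [hsin, h'] at this
      norm_num at this
    have key : Tendsto (fun μ => besselYQuotient μ x) (𝓝[≠] (j : ℝ))
        (𝓝 (deriv (fun μ => besselJ μ x * cos (μ * π) - besselJ (-μ) x) j /
          (cos (j * π) * (1 * π)))) := by
      have h1 := (hasDerivAt_iff_tendsto_slope.1 hn.hasDerivAt).div
        (hasDerivAt_iff_tendsto_slope.1 hs) (by positivity)
      refine h1.congr' ?_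
      filter_upwards [self_mem_nhdsWithin] with μ hμ
      have : μ - j ≠ 0 := sub_ne_zero.2 hμ
      simp only [slope_def_field, hsin, besselYQuotient, Pi.div_apply]
      rw [besselJ_neg_intCast j hx]
      field_simp
      ring
    have h2 : besselY j x = limUnder (𝓝[≠] (j : ℝ)) (fun μ => besselYQuotient μ x) := by
      rw [besselY, if_pos ⟨j, rfl⟩]
    rw [h2, key.limUnder_eq]
    exact key
  · have hsin : sin (ν * π) ≠ 0 := fun h' => by
      obtain ⟨n, hn⟩ := sin_eq_zero_iff.1 h'
      exact h ⟨n, (mul_right_cancel₀ pi_ne_zero hn).symm⟩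
    rw [besselY, if_neg h]
    exact (hn.continuousAt.div hs.continuousAt hsin).tendsto.mono_left nhdsWithin_le_nhds

lemma besselY_eq_quotient {ν : ℝ} (hν : sin (ν * π) ≠ 0) (x : ℝ) :
    besselY ν x = besselYQuotient ν x := by
  rw [besselY, if_neg]
  rintro ⟨j, rfl⟩
  exact hν (sin_int_mul_pi j)

lemma sin_sub_one_mul_pi (μ : ℝ) : sin ((μ - 1) * π) = -sin (μ * π) := by
  rw [sub_one_mul, sin_sub_pi]

lemma cos_sub_one_mul_pi (μ : ℝ) : cos ((μ - 1) * π) = -cos (μ * π) := by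
  rw [sub_one_mul, cos_sub_pi]

/-- Differentiate `J_μ` by the lowering formula and `J_{−μ}` by the raising one: both lead to the
order `μ − 1`, and the signs agree because sine and cosine change sign together. For `sin μπ = 0`
both quotients are 0 by convention. -/
lemma hasDerivAt_besselYQuotient (μ : ℝ) {x : ℝ} (hx : 0 < x) :
    HasDerivAt (besselYQuotient μ) (besselYQuotient (μ - 1) x - μ / x * besselYQuotient μ x) x := by
  have h := (((hasDerivAt_besselJ μ hx).mul_const (cos (μ * π))).sub
    (hasDerivAt_besselJ_add_one (-μ) hx)).div_const (sin (μ * π))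
  refine h.congr_deriv ?_
  rw [besselYQuotient, besselYQuotient, sin_sub_one_mul_pi, cos_sub_one_mul_pi,
    show -μ + 1 = -(μ - 1) by ring]
  rcases eq_or_ne (sin (μ * π)) 0 with h0 | h0
  · simp [h0]
  · field_simp
    ring

lemma hasDerivAt_besselYQuotient_sub_one (μ : ℝ) {x : ℝ} (hx : 0 < x) :
    HasDerivAt (besselYQuotient (μ - 1))
      ((μ - 1) / x * besselYQuotient (μ - 1) x - besselYQuotient μ x) x := by
  have h := (((hasDerivAt_besselJ_add_one (μ - 1) hx).mul_const (cos ((μ - 1) * π))).sub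
    (hasDerivAt_besselJ (-(μ - 1)) hx)).div_const (sin ((μ - 1) * π))
  refine h.congr_deriv ?_
  rw [besselYQuotient, besselYQuotient, sin_sub_one_mul_pi, cos_sub_one_mul_pi,
    show -(μ - 1) - 1 = -μ by ring, show μ - 1 + 1 = μ by ring]
  rcases eq_or_ne (sin (μ * π)) 0 with h0 | h0
  · simp [h0]
  · field_simp
    ring

/-- Both recurrences `Y_ν' = Y_{ν-1} - (ν/x) Y_ν` and `Y_{ν-1}' = ((ν-1)/x) Y_{ν-1} - Y_ν`. -/
lemma hasDerivAt_besselY_prod (ν : ℝ) {x : ℝ} (hx : 0 < x) :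
    HasDerivAt (fun s => (besselY ν s, besselY (ν - 1) s))
      (besselY (ν - 1) x - ν / x * besselY ν x, (ν - 1) / x * besselY (ν - 1) x - besselY ν x)
      x := by
  have hT := fun {s : ℝ} (hs : 0 < s) => tendsto_besselYQuotient ν hs
  have hT1 : ∀ {s : ℝ} (_ : 0 < s),
      Tendsto (fun μ => besselYQuotient (μ - 1) s) (𝓝[≠] ν) (𝓝 (besselY (ν - 1) s)) := by
    intro s hs
    refine (tendsto_besselYQuotient (ν - 1) hs).comp
      (tendsto_nhdsWithin_of_tendsto_nhds_of_eventually_within _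
        ((continuous_sub_right (1 : ℝ)).tendsto ν |>.mono_left nhdsWithin_le_nhds) ?_)
    filter_upwards [self_mem_nhdsWithin] with μ hμ h
    exact hμ (sub_left_injective h)
  have hμ : Tendsto (fun μ : ℝ => μ) (𝓝[≠] ν) (𝓝 ν) := nhdsWithin_le_nhds
  have hpos : ∀ s ∈ Icc (x / 2) (2 * x), 0 < s := fun s hs => by linarith [hs.1]
  -- The pair of orders `ν`, `ν − 1` forms a closed linear first order system, as the limit theorem
  -- requires. `K` bounds its coefficients for `s ≥ x/2` and `|μ| < |ν| + 1`.
  refine hasDerivAt_of_tendsto_of_norm_le (l := 𝓝[≠] ν) (α := x / 2) (β := 2 * x)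
    (K := (|ν| + 2) / (x / 2) + 1)
    (y := fun μ s => (besselYQuotient μ s, besselYQuotient (μ - 1) s))
    (v := fun μ s => (besselYQuotient (μ - 1) s - μ / s * besselYQuotient μ s,
      (μ - 1) / s * besselYQuotient (μ - 1) s - besselYQuotient μ s))
    (V := fun s => (besselY (ν - 1) s - ν / s * besselY ν s,
      (ν - 1) / s * besselY (ν - 1) s - besselY ν s))
    (by linarith) (by linarith) (by positivity) ?_ ?_ ?_ ?_ ?_
  · have hlt : ∀ᶠ μ in 𝓝[≠] ν, |μ| < |ν| + 1 :=
      hμ.abs.eventually_lt_const (by linarith)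
    filter_upwards [hlt] with μ hμ s hs
    have hs0 := hpos s hs
    refine ⟨(hasDerivAt_besselYQuotient μ hs0).prodMk
      (hasDerivAt_besselYQuotient_sub_one μ hs0), ?_⟩
    set f := besselYQuotient μ s
    set g := besselYQuotient (μ - 1) s
    have hf : |f| ≤ ‖(f, g)‖ := le_max_left _ _
    have hg : |g| ≤ ‖(f, g)‖ := le_max_right _ _
    have hx2 : 0 < x / 2 := by linarith
    have h1 : |μ / s| ≤ (|ν| + 2) / (x / 2) := by
      rw [abs_div, abs_of_pos hs0]
      exact div_le_div₀ (by positivity) (by linarith) hx2 hs.1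
    have h2 : |(μ - 1) / s| ≤ (|ν| + 2) / (x / 2) := by
      rw [abs_div, abs_of_pos hs0]
      refine div_le_div₀ (by positivity) ?_ hx2 hs.1
      have := abs_sub μ 1
      rw [abs_one] at this
      linarith
    have hC : 0 ≤ (|ν| + 2) / (x / 2) := by positivity
    refine max_le ?_ ?_
    · refine (abs_sub _ _).trans ?_
      rw [abs_mul, add_mul, one_mul, add_comm]
      gcongr
    · refine (abs_sub _ _).trans ?_
      rw [abs_mul, add_mul, one_mul]
      gcongr
  · refine Eventually.of_forall fun μ => ?_
    have c1 : ContinuousOn (besselYQuotient μ) (Icc (x / 2) (2 * x)) := fun s hs =>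
      (hasDerivAt_besselYQuotient μ (hpos s hs)).continuousAt.continuousWithinAt
    have c2 : ContinuousOn (besselYQuotient (μ - 1)) (Icc (x / 2) (2 * x)) := fun s hs =>
      (hasDerivAt_besselYQuotient (μ - 1) (hpos s hs)).continuousAt.continuousWithinAt
    have c3 : ∀ c : ℝ, ContinuousOn (fun s => c / s) (Icc (x / 2) (2 * x)) := fun c =>
      continuousOn_const.div continuousOn_id fun s hs => (hpos s hs).ne'
    exact (c2.sub ((c3 _).mul c1)).prodMk (((c3 _).mul c2).sub c1)
  · exact fun s hs => (hT (hpos s hs)).prodMk_nhds (hT1 (hpos s hs))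
  · intro s hs
    have h := hT (hpos s hs)
    have h1 := hT1 (hpos s hs)
    exact (h1.sub ((hμ.div_const s).mul h)).prodMk_nhds
      ((((hμ.sub_const 1).div_const s).mul h1).sub h)
  · intro hc
    have c1 := hc.fst
    have c2 := hc.snd
    have c3 : ∀ c : ℝ, ContinuousOn (fun s => c / s) (Icc (x / 2) (2 * x)) := fun c =>
      continuousOn_const.div continuousOn_id fun s hs => (hpos s hs).ne'
    exact (c2.sub ((c3 _).mul c1)).prodMk (((c3 _).mul c2).sub c1)

lemma hasDerivAt_besselY (ν : ℝ) {x : ℝ} (hx : 0 < x) :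
    HasDerivAt (besselY ν) (besselY (ν - 1) x - ν / x * besselY ν x) x :=
  (hasDerivAt_besselY_prod ν hx).fst

lemma hasDerivAt_besselY_sub_one (ν : ℝ) {x : ℝ} (hx : 0 < x) :
    HasDerivAt (besselY (ν - 1)) ((ν - 1) / x * besselY (ν - 1) x - besselY ν x) x :=
  (hasDerivAt_besselY_prod ν hx).snd

/-! ### Solutions of `a'' = (k / s² - 1) a` on the positive half-line -/

/-- `a` solves `a'' = (k / s² - 1) a` on `(0, ∞)`, with derivative `a'`. -/
def IsRadialSolution (k : ℝ) (a a' : ℝ → ℝ) : Prop :=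
  ∀ s, 0 < s → HasDerivAt a (a' s) s ∧ HasDerivAt a' ((k / s ^ 2 - 1) * a s) s

/-- The tail integral of `C/r²` from `s` is `C/s`, so `f` is Cauchy and approaches its limit at that
rate. -/
lemma exists_norm_sub_le_div {E : Type*} [NormedAddCommGroup E] [NormedSpace ℝ E]
    [CompleteSpace E] {f f' : ℝ → E} {C : ℝ} (hf : ∀ s, 1 ≤ s → HasDerivAt f (f' s) s)
    (hC : ∀ s, 1 ≤ s → ‖f' s‖ ≤ C / s ^ 2) : ∃ h : E, ∀ s, 1 ≤ s → ‖f s - h‖ ≤ C / s := by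
  have hC0 : 0 ≤ C := by simpa using (norm_nonneg _).trans (hC 1 le_rfl)
  have key : ∀ s t, 1 ≤ s → s ≤ t → ‖f t - f s‖ ≤ C / s := by
    intro s t hs hst
    have hpos : ∀ r ∈ Icc s t, 1 ≤ r := fun r hr => hs.trans hr.1
    have hB : ∀ r ∈ Icc s t, HasDerivAt (fun r => C / s - C / r) (C / r ^ 2) r := by
      intro r hr
      have hr0 : r ≠ 0 := by linarith [hpos r hr]
      refine (((hasDerivAt_inv hr0).const_mul C).const_sub (C / s)).congr_deriv ?_
      field_simp
    have := image_norm_le_of_norm_deriv_right_le_deriv_boundary' (f := fun r => f r - f s)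
      (f' := f') (B := fun r => C / s - C / r) (B' := fun r => C / r ^ 2) (a := s) (b := t)
      (fun r hr => ((hf r (hpos r hr)).sub_const _).continuousAt.continuousWithinAt)
      (fun r hr => ((hf r (hpos r (Ico_subset_Icc_self hr))).sub_const _).hasDerivWithinAt)
      (by simp)
      (fun r hr => (hB r hr).continuousAt.continuousWithinAt)
      (fun r hr => (hB r (Ico_subset_Icc_self hr)).hasDerivWithinAt)
      (fun r hr => hC r (hpos r (Ico_subset_Icc_self hr))) (right_mem_Icc.2 hst)
    refine this.trans ?_
    have : 0 ≤ C / t := by have := hs.trans hst; positivity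
    linarith
  have hcau : CauchySeq f := by
    refine Metric.cauchySeq_iff'.2 fun ε hε => ?_
    refine ⟨max 1 (C / ε + 1), fun t ht => ?_⟩
    rw [dist_eq_norm]
    refine (key _ t (le_max_left _ _) ht).trans_lt ?_
    have h2 : C / ε < max 1 (C / ε + 1) := (lt_add_one _).trans_le (le_max_right _ _)
    rw [div_lt_iff₀ (by positivity)]
    rwa [div_lt_iff₀ hε, mul_comm] at h2
  obtain ⟨h, hh⟩ := cauchySeq_tendsto_of_complete hcau
  refine ⟨h, fun s hs => ?_⟩
  rw [norm_sub_rev]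
  refine le_of_tendsto (hh.sub_const (f s)).norm ?_
  filter_upwards [eventually_ge_atTop s] with t ht using key s t hs ht

lemma norm_sub_le_div_of_tendsto {E : Type*} [NormedAddCommGroup E] [NormedSpace ℝ E]
    [CompleteSpace E] {f f' : ℝ → E} {C : ℝ} {h : E} (hf : ∀ s, 1 ≤ s → HasDerivAt f (f' s) s)
    (hC : ∀ s, 1 ≤ s → ‖f' s‖ ≤ C / s ^ 2) (hh : Tendsto f atTop (𝓝 h)) (s : ℝ) (hs : 1 ≤ s) :
    ‖f s - h‖ ≤ C / s := by
  obtain ⟨h', hh'⟩ := exists_norm_sub_le_div hf hC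
  have : Tendsto f atTop (𝓝 h') := by
    rw [tendsto_iff_norm_sub_tendsto_zero]
    refine squeeze_zero' (Eventually.of_forall fun _ => norm_nonneg _) ?_
      (tendsto_const_nhds (x := C).div_atTop tendsto_id)
    filter_upwards [eventually_ge_atTop 1] with s hs using hh' s hs
  rw [tendsto_nhds_unique hh this]
  exact hh' s hs

namespace IsRadialSolution

variable {k : ℝ} {a a' : ℝ → ℝ}

lemma hasDerivAt_energy (h : IsRadialSolution k a a') {s : ℝ} (hs : 0 < s) :
    HasDerivAt (fun s => a s ^ 2 + a' s ^ 2) (2 * k * (a s * a' s) / s ^ 2) s := by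
  refine (((h s hs).1.pow 2).add ((h s hs).2.pow 2)).congr_deriv ?_
  push_cast
  field_simp
  ring

/-- The logarithmic derivative of the energy is at most `|k|/s²` by `2|a a'| ≤ a² + a'²`, so the
energy times `exp(|k|/s)` decreases. -/
lemma energy_le (h : IsRadialSolution k a a') {s₀ s : ℝ} (hs₀ : 0 < s₀) (hs : s₀ ≤ s) :
    a s ^ 2 + a' s ^ 2 ≤ (a s₀ ^ 2 + a' s₀ ^ 2) * exp (|k| / s₀) := by
  have hpos : ∀ r ∈ Ici s₀, 0 < r := fun r hr => hs₀.trans_le hr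
  have hd : ∀ r ∈ Ici s₀, HasDerivAt (fun r => (a r ^ 2 + a' r ^ 2) * exp (|k| / r))
      ((2 * k * (a r * a' r) / r ^ 2 - (a r ^ 2 + a' r ^ 2) * (|k| / r ^ 2)) * exp (|k| / r)) r := by
    intro r hr
    have hr0 := hpos r hr
    have h1 : HasDerivAt (fun r => |k| / r) (-(|k| / r ^ 2)) r := by
      refine ((hasDerivAt_inv hr0.ne').const_mul |k|).congr_deriv ?_
      field_simp
    refine ((h.hasDerivAt_energy hr0).mul h1.exp).congr_deriv ?_
    ring
  have hanti : AntitoneOn (fun r => (a r ^ 2 + a' r ^ 2) * exp (|k| / r)) (Ici s₀) := by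
    refine antitoneOn_of_deriv_nonpos (convex_Ici s₀)
      (fun r hr => (hd r hr).continuousAt.continuousWithinAt)
      (fun r hr => (hd r (interior_subset hr)).differentiableAt.differentiableWithinAt) ?_
    intro r hr
    rw [(hd r (interior_subset hr)).deriv]
    refine mul_nonpos_of_nonpos_of_nonneg ?_ (exp_pos _).le
    have hr0 := hpos r (interior_subset hr)
    have : 2 * k * (a r * a' r) ≤ (a r ^ 2 + a' r ^ 2) * |k| := by
      have h1 : 2 * k * (a r * a' r) ≤ |k| * (2 * |a r * a' r|) := by
        calc 2 * k * (a r * a' r) ≤ |2 * k * (a r * a' r)| := le_abs_self _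
          _ = |k| * (2 * |a r * a' r|) := by rw [abs_mul, abs_mul, abs_two]; ring
      have h2 : 2 * |a r * a' r| ≤ a r ^ 2 + a' r ^ 2 := by
        rw [abs_mul, ← sq_abs (a r), ← sq_abs (a' r)]
        nlinarith [sq_nonneg (|a r| - |a' r|)]
      nlinarith [abs_nonneg k]
    rw [mul_div_assoc', ← sub_div]
    exact div_nonpos_of_nonpos_of_nonneg (by linarith) (by positivity)
  have h1 := hanti (mem_Ici.2 le_rfl) (mem_Ici.2 hs) hs
  refine le_trans ?_ h1
  refine le_mul_of_one_le_right (by positivity) (one_le_exp ?_)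
  have := hs₀.trans_le hs
  positivity

lemma abs_mul_le (x y : ℝ) : |x * y| ≤ x ^ 2 + y ^ 2 := by
  rw [abs_mul, ← sq_abs x, ← sq_abs y]
  nlinarith [sq_nonneg (|x| - |y|), sq_nonneg (|x|), sq_nonneg (|y|)]

lemma abs_energy_sub_le (h : IsRadialSolution k a a') {H : ℝ}
    (hH : Tendsto (fun s => a s ^ 2 + a' s ^ 2) atTop (𝓝 H)) {s : ℝ} (hs : 1 ≤ s) :
    |a s ^ 2 + a' s ^ 2 - H| ≤ 2 * |k| * ((a 1 ^ 2 + a' 1 ^ 2) * exp |k|) / s := by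
  refine norm_sub_le_div_of_tendsto (fun s hs => h.hasDerivAt_energy (by linarith)) ?_ hH s hs
  intro s hs
  have h1 := h.energy_le one_pos hs
  rw [div_one] at h1
  rw [Real.norm_eq_abs, abs_div, abs_mul, abs_mul, abs_two, abs_of_nonneg (sq_nonneg s)]
  have := (abs_mul_le (a s) (a' s)).trans h1
  gcongr

/-- The complex amplitude of a solution. -/
lemma exists_amplitude (h : IsRadialSolution k a a') : ∃ z : ℂ,
    Tendsto (fun s : ℝ => Complex.exp (-(s * Complex.I)) * (a s - Complex.I * a' s)) atTop (𝓝 z) := by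
  -- The rotation `e^{−is}` removes the free oscillation: the derivative contains only `a + a'' =
  -- (k/s²) a`, which is `O(1/s²)`.
  have hd : ∀ s : ℝ, 1 ≤ s → HasDerivAt
      (fun s : ℝ => Complex.exp (-(s * Complex.I)) * (a s - Complex.I * a' s))
      (-(Complex.exp (-(s * Complex.I)) * Complex.I * (k / s ^ 2 * a s))) s := by
    intro s hs
    have hs0 : 0 < s := by linarith
    have h1 : HasDerivAt (fun s : ℝ => Complex.exp (-((s : ℂ) * Complex.I)))
        (Complex.exp (-((s : ℂ) * Complex.I)) * (-((1 : ℝ) * Complex.I))) s :=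
      (((hasDerivAt_id s).ofReal_comp.mul_const Complex.I).neg).cexp
    have h2 := (h s hs0).1.ofReal_comp
    have h3 := (h s hs0).2.ofReal_comp.const_mul Complex.I
    refine (h1.mul (h2.sub h3)).congr_deriv ?_
    simp only [Pi.sub_apply]
    push_cast
    linear_combination (Complex.exp (-(s * Complex.I)) * a' s) * Complex.I_sq
  have hle : ∀ s : ℝ, 1 ≤ s → ‖-(Complex.exp (-(s * Complex.I)) * Complex.I * (k / s ^ 2 * a s))‖
      ≤ |k| * √((a 1 ^ 2 + a' 1 ^ 2) * exp |k|) / s ^ 2 := by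
    intro s hs
    have h1 := h.energy_le one_pos hs
    rw [div_one] at h1
    have h2 : |a s| ≤ √((a 1 ^ 2 + a' 1 ^ 2) * exp |k|) :=
      abs_le_sqrt ((le_add_of_nonneg_right (sq_nonneg _)).trans h1)
    have h3 : ‖Complex.exp (-(s * Complex.I))‖ = 1 := by
      rw [show -((s : ℂ) * Complex.I) = ((-s : ℝ) : ℂ) * Complex.I by push_cast; ring,
        Complex.norm_exp_ofReal_mul_I]
    rw [norm_neg, norm_mul, norm_mul, h3, Complex.norm_I, one_mul, one_mul, norm_mul, norm_div,
      norm_pow, Complex.norm_real, Complex.norm_real, Complex.norm_real, Real.norm_eq_abs,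
      Real.norm_eq_abs, Real.norm_eq_abs, sq_abs, div_mul_eq_mul_div]
    gcongr
  obtain ⟨z, hz⟩ := exists_norm_sub_le_div hd hle
  refine ⟨z, ?_⟩
  rw [tendsto_iff_norm_sub_tendsto_zero]
  refine squeeze_zero' (Eventually.of_forall fun _ => norm_nonneg _) ?_
    (tendsto_const_nhds (x := |k| * √((a 1 ^ 2 + a' 1 ^ 2) * exp |k|)).div_atTop tendsto_id)
  filter_upwards [eventually_ge_atTop 1] with s hs using hz s hs

lemma continuousOn (h : IsRadialSolution k a a') : ContinuousOn a (Ioi 0) :=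
  fun s hs => (h s hs).1.continuousAt.continuousWithinAt

/-- The terms `−k a²/s` and `−a a'` cancel everything except `a²` in the derivative of `s(a² +
a'²)/2`. The primitive being explicit, no oscillatory integral has to be estimated. -/
lemma hasDerivAt_primitive (h : IsRadialSolution k a a') {s : ℝ} (hs : 0 < s) :
    HasDerivAt (fun s => (s * (a s ^ 2 + a' s ^ 2) - k * (a s ^ 2 / s) - a s * a' s) / 2)
      (a s ^ 2) s := by
  have h1 := (hasDerivAt_id s).mul (h.hasDerivAt_energy hs)
  have h2 := (((h s hs).1.pow 2).div (hasDerivAt_id s) hs.ne').const_mul k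
  have h3 := (h s hs).1.mul (h s hs).2
  refine (((h1.sub h2).sub h3).div_const 2).congr_deriv ?_
  simp only [id, Pi.pow_apply]
  push_cast
  field_simp
  ring

/-- The mean square of a solution is half of its squared amplitude. -/
lemma integral_sq_isBigO (h : IsRadialSolution k a a') {H s₀ : ℝ} (hs₀ : 0 < s₀)
    (hH : Tendsto (fun s => a s ^ 2 + a' s ^ 2) atTop (𝓝 H)) :
    (fun s => (∫ σ in s₀..s, a σ ^ 2) - H / 2 * s) =O[atTop] (fun _ => (1 : ℝ)) := by
  set P : ℝ → ℝ := fun s => (s * (a s ^ 2 + a' s ^ 2) - k * (a s ^ 2 / s) - a s * a' s) / 2 with hP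
  set M := (a 1 ^ 2 + a' 1 ^ 2) * exp |k| with hM
  have hM0 : 0 ≤ M := by positivity
  refine IsBigO.of_bound ((2 * |k| * M + |k| * M + M) / 2 + |P s₀|) ?_
  filter_upwards [eventually_ge_atTop s₀, eventually_ge_atTop 1] with s hs hs1
  have hpos : ∀ r ∈ uIcc s₀ s, 0 < r := fun r hr => by
    rw [uIcc_of_le hs] at hr; exact hs₀.trans_le hr.1
  have hint : ∫ σ in s₀..s, a σ ^ 2 = P s - P s₀ :=
    intervalIntegral.integral_eq_sub_of_hasDerivAt (fun r hr => h.hasDerivAt_primitive (hpos r hr))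
      ((h.continuousOn.mono hpos).pow 2).intervalIntegrable
  have hs0 : 0 < s := by linarith
  have h1 := h.energy_le one_pos hs1
  rw [div_one, ← hM] at h1
  have h2 := h.abs_energy_sub_le hH hs1
  rw [← hM] at h2
  -- The `1/s` rate of the energy is exactly what keeps this term bounded.
  have h3 : |s * (a s ^ 2 + a' s ^ 2 - H)| ≤ 2 * |k| * M := by
    rw [abs_mul, abs_of_pos hs0]
    rw [le_div_iff₀ hs0] at h2
    linarith
  have h4 : |k * (a s ^ 2 / s)| ≤ |k| * M := by
    rw [abs_mul, abs_of_nonneg (by positivity : 0 ≤ a s ^ 2 / s)]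
    have : a s ^ 2 / s ≤ M := by
      rw [div_le_iff₀ hs0]
      nlinarith [sq_nonneg (a' s)]
    gcongr
  have h5 := (abs_mul_le (a s) (a' s)).trans h1
  rw [hint, norm_one, mul_one, Real.norm_eq_abs]
  have h6 : P s - P s₀ - H / 2 * s
      = (s * (a s ^ 2 + a' s ^ 2 - H) - k * (a s ^ 2 / s) - a s * a' s) / 2 - P s₀ := by
    rw [hP]; ring
  rw [h6]
  refine (abs_sub _ _).trans (add_le_add_left ?_ _)
  rw [abs_div, abs_two]
  gcongr
  exact ((abs_sub _ _).trans (add_le_add ((abs_sub _ _).trans (add_le_add h3 h4)) h5))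

/-- The zeros of a solution of nonzero amplitude are simple. -/
lemma ne_zero_or_ne_zero (h : IsRadialSolution k a a') {H : ℝ} (hH0 : H ≠ 0)
    (hH : Tendsto (fun s => a s ^ 2 + a' s ^ 2) atTop (𝓝 H)) {s : ℝ} (hs : 0 < s) :
    a s ≠ 0 ∨ a' s ≠ 0 := by
  by_contra! hcon
  refine hH0 (tendsto_nhds_unique hH (tendsto_const_nhds.congr' ?_))
  filter_upwards [eventually_ge_atTop s] with t ht
  -- Zero energy at `s` stays zero from there on, against the nonzero limit `H`.
  have := h.energy_le hs ht
  rw [hcon.1, hcon.2] at this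
  nlinarith [sq_nonneg (a t), sq_nonneg (a' t)]

end IsRadialSolution

/-- Cylinder functions multiplied by `√s` satisfy the transformed Bessel equation. -/
lemma isRadialSolution_of_recurrence {ν : ℝ} {f g : ℝ → ℝ}
    (hf : ∀ x, 0 < x → HasDerivAt f (g x - ν / x * f x) x)
    (hg : ∀ x, 0 < x → HasDerivAt g ((ν - 1) / x * g x - f x) x) :
    IsRadialSolution (ν ^ 2 - 1 / 4) (fun s => √s * f s)
      (fun s => √s * g s - (ν - 1 / 2) / s * (√s * f s)) := by
  have hsq : ∀ s : ℝ, 0 < s → HasDerivAt (fun s => √s) (√s / (2 * s)) s := by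
    intro s hs
    refine (hasDerivAt_sqrt hs.ne').congr_deriv ?_
    have := sq_sqrt hs.le
    have h0 : √s ≠ 0 := (sqrt_pos.2 hs).ne'
    field_simp
    linarith
  have h1 : ∀ s, 0 < s → HasDerivAt (fun s => √s * f s)
      (√s * g s - (ν - 1 / 2) / s * (√s * f s)) s := by
    intro s hs
    refine ((hsq s hs).mul (hf s hs)).congr_deriv ?_
    field_simp
    ring
  intro s hs
  refine ⟨h1 s hs, ?_⟩
  have h2 : HasDerivAt (fun s : ℝ => (ν - 1 / 2) / s) (-((ν - 1 / 2) / s ^ 2)) s := by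
    refine ((hasDerivAt_inv hs.ne').const_mul (ν - 1 / 2)).congr_deriv ?_
    field_simp
  refine (((hsq s hs).mul (hg s hs)).sub (h2.mul (h1 s hs))).congr_deriv ?_
  field_simp
  ring

lemma isRadialSolution_omegaBar (ν : ℝ) : IsRadialSolution (ν ^ 2 - 1 / 4) (omegaBar ν)
    (fun s => omegaBar (ν - 1) s - (ν - 1 / 2) / s * omegaBar ν s) :=
  isRadialSolution_of_recurrence (fun _ hx => hasDerivAt_besselY ν hx)
    (fun _ hx => hasDerivAt_besselY_sub_one ν hx)

lemma isRadialSolution_besselJ (μ : ℝ) : IsRadialSolution (μ ^ 2 - 1 / 4)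
    (fun s => √s * besselJ μ s)
    (fun s => √s * besselJ (μ - 1) s - (μ - 1 / 2) / s * (√s * besselJ μ s)) := by
  refine isRadialSolution_of_recurrence (fun _ hx => hasDerivAt_besselJ μ hx) (fun x hx => ?_)
  simpa using hasDerivAt_besselJ_add_one (μ - 1) hx

/-! ### Laplace transforms on the line `Im p = 1` -/

/-- The Laplace transform of `y` at `t + i`. -/
def rotLaplace (y : ℝ → ℝ) (t : ℝ) : ℂ :=
  ∫ x in Ioi (0 : ℝ), Complex.exp (-((t + Complex.I) * x)) * y x

lemma norm_exp_neg_add_I_mul (t x : ℝ) :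
    ‖Complex.exp (-((t + Complex.I) * x))‖ = exp (-t * x) := by
  rw [Complex.norm_exp]; congr 1; simp

lemma integrableOn_rpow_mul_exp {s b : ℝ} (hs : -1 < s) (hb : 0 < b) (C : ℝ) :
    MeasureTheory.IntegrableOn (fun x : ℝ => C * (x ^ s * exp (-b * x))) (Ioi 0) := by
  have := integrableOn_rpow_mul_exp_neg_mul_rpow (p := 1) hs one_pos hb
  simp only [rpow_one] at this
  exact this.const_mul C

section

variable {y : ℝ → ℝ} {C s : ℝ}

lemma continuousOn_rotLaplace_integrand (hy : ContinuousOn y (Ioi 0)) (t : ℝ) :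
    ContinuousOn (fun x : ℝ => Complex.exp (-((t + Complex.I) * x)) * y x) (Ioi 0) :=
  ContinuousOn.mul (by fun_prop) (Complex.continuous_ofReal.comp_continuousOn hy)

lemma integrableOn_rotLaplace (hy : ContinuousOn y (Ioi 0)) (hC : ∀ x, 0 < x → |y x| ≤ C * x ^ s)
    (hs : -1 < s) {t : ℝ} (ht : 0 < t) :
    MeasureTheory.IntegrableOn (fun x : ℝ => Complex.exp (-((t + Complex.I) * x)) * y x) (Ioi 0) := by
  refine (integrableOn_rpow_mul_exp hs ht C).mono'
    ((continuousOn_rotLaplace_integrand hy t).aestronglyMeasurable measurableSet_Ioi) ?_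
  refine (MeasureTheory.ae_restrict_iff' measurableSet_Ioi).2 (Eventually.of_forall fun x hx => ?_)
  rw [norm_mul, norm_exp_neg_add_I_mul, Complex.norm_real, Real.norm_eq_abs]
  calc exp (-t * x) * |y x| ≤ exp (-t * x) * (C * x ^ s) := by gcongr; exact hC x hx
    _ = C * (x ^ s * exp (-t * x)) := by ring

/-- Differentiation under the integral; halving `t` leaves an exponential that dominates uniformly
near `t`. -/
lemma hasDerivAt_rotLaplace (hy : ContinuousOn y (Ioi 0)) (hC : ∀ x, 0 < x → |y x| ≤ C * x ^ s)
    (hs : -1 < s) {t : ℝ} (ht : 0 < t) :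
    HasDerivAt (rotLaplace y) (-rotLaplace (fun x => x * y x) t) t := by
  have hy1 : ContinuousOn (fun x => x * y x) (Ioi 0) := continuousOn_id.mul hy
  have hC1 : ∀ x, 0 < x → |x * y x| ≤ C * x ^ (s + 1) := fun x hx => by
    rw [abs_mul, abs_of_pos hx, rpow_add_one hx.ne', ← mul_assoc, mul_comm]
    exact mul_le_mul_of_nonneg_right (hC x hx) hx.le
  have h := hasDerivAt_integral_of_dominated_loc_of_deriv_le
    (μ := MeasureTheory.volume.restrict (Ioi (0 : ℝ))) (s := Ioi (t / 2)) (x₀ := t)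
    (F := fun (t : ℝ) (x : ℝ) => Complex.exp (-((t + Complex.I) * x)) * y x)
    (F' := fun (t : ℝ) (x : ℝ) =>
      -(Complex.exp (-((t + Complex.I) * x)) * ((x * y x : ℝ) : ℂ)))
    (bound := fun x => C * (x ^ (s + 1) * exp (-(t / 2) * x)))
    (Ioi_mem_nhds (by linarith))
    (Eventually.of_forall fun t =>
      (continuousOn_rotLaplace_integrand hy t).aestronglyMeasurable measurableSet_Ioi)
    (integrableOn_rotLaplace hy hC hs ht)
    ((continuousOn_rotLaplace_integrand hy1 t).aestronglyMeasurable measurableSet_Ioi).neg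
    ?_ (integrableOn_rpow_mul_exp (by linarith) (by linarith) C) ?_
  · refine h.2.congr_deriv ?_
    rw [MeasureTheory.integral_neg, rotLaplace]
  · refine (MeasureTheory.ae_restrict_iff' measurableSet_Ioi).2
      (Eventually.of_forall fun x hx r hr => ?_)
    have hx : 0 < x := hx
    rw [norm_neg, norm_mul, norm_exp_neg_add_I_mul, Complex.norm_real, Real.norm_eq_abs]
    have hr : t / 2 < r := hr
    have h1 : exp (-r * x) ≤ exp (-(t / 2) * x) := exp_le_exp.2 (by nlinarith)
    calc exp (-r * x) * |x * y x| ≤ exp (-(t / 2) * x) * (C * x ^ (s + 1)) := by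
          gcongr; exact hC1 x hx
      _ = C * (x ^ (s + 1) * exp (-(t / 2) * x)) := by ring
  · refine (MeasureTheory.ae_restrict_iff' measurableSet_Ioi).2
      (Eventually.of_forall fun x _ r _ => ?_)
    have h1 : HasDerivAt (fun r : ℝ => -(((r : ℂ) + Complex.I) * x)) (-(((1 : ℝ) : ℂ) * x)) r :=
      (((hasDerivAt_id r).ofReal_comp.add_const Complex.I).mul_const (x : ℂ)).neg
    refine (h1.cexp.mul_const (y x : ℂ)).congr_deriv ?_
    push_cast
    ring

/-- Integration by parts. The boundary terms vanish by `y 0 = 0`, with continuity at 0 supplied by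
`s > 0`, and by exponential decay. -/
lemma rotLaplace_deriv {y' : ℝ → ℝ} (hd : ∀ x, 0 < x → HasDerivAt y (y' x) x)
    (hy0 : y 0 = 0) (hC : ∀ x, 0 < x → |y x| ≤ C * x ^ s) (hs : 0 < s)
    {t : ℝ} (ht : 0 < t) (hi' : MeasureTheory.IntegrableOn
      (fun x : ℝ => Complex.exp (-((t + Complex.I) * x)) * y' x) (Ioi 0)) :
    rotLaplace y' t = (t + Complex.I) * rotLaplace y t := by
  have hy : ContinuousOn y (Ioi 0) := fun x hx => (hd x hx).continuousAt.continuousWithinAt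
  have hi := integrableOn_rotLaplace hy hC (by linarith) ht
  have hbd : ∀ x : ℝ, 0 < x → ‖Complex.exp (-((t + Complex.I) * x)) * y x‖
      ≤ C * (x ^ s * exp (-t * x)) := fun x hx => by
    rw [norm_mul, norm_exp_neg_add_I_mul, Complex.norm_real, Real.norm_eq_abs]
    calc exp (-t * x) * |y x| ≤ exp (-t * x) * (C * x ^ s) := by gcongr; exact hC x hx
      _ = C * (x ^ s * exp (-t * x)) := by ring
  have key := MeasureTheory.integral_Ioi_of_hasDerivAt_of_tendsto (a := 0) (m := 0)
    (f := fun x : ℝ => Complex.exp (-((t + Complex.I) * x)) * y x)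
    (f' := fun x : ℝ => Complex.exp (-((t + Complex.I) * x)) * y' x
      - (t + Complex.I) * (Complex.exp (-((t + Complex.I) * x)) * y x))
    ?_ ?_ (hi'.sub (hi.const_mul _)) ?_
  · rw [MeasureTheory.integral_sub hi' (hi.const_mul _), MeasureTheory.integral_const_mul] at key
    simp only [hy0, Complex.ofReal_zero, mul_zero, sub_zero] at key
    exact sub_eq_zero.1 key
  · have h0 : Tendsto (fun x : ℝ => C * (x ^ s * exp (-t * x))) (𝓝 0) (𝓝 0) := by
      have : Continuous fun x : ℝ => C * (x ^ s * exp (-t * x)) :=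
        continuous_const.mul ((continuous_rpow_const hs.le).mul (by fun_prop))
      simpa [zero_rpow hs.ne'] using this.tendsto 0
    rw [ContinuousWithinAt, hy0]
    simp only [Complex.ofReal_zero, mul_zero]
    refine squeeze_zero_norm' ?_ (h0.mono_left nhdsWithin_le_nhds)
    filter_upwards [self_mem_nhdsWithin] with x hx
    rcases (mem_Ici.1 hx).eq_or_lt with rfl | hx
    · simp [hy0, zero_rpow hs.ne']
    · exact hbd x hx
  · intro x hx
    have h1 : HasDerivAt (fun x : ℝ => -(((t : ℂ) + Complex.I) * x))
        (-(((t : ℂ) + Complex.I) * ((1 : ℝ) : ℂ))) x :=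
      ((hasDerivAt_id x).ofReal_comp.const_mul ((t : ℂ) + Complex.I)).neg
    refine (h1.cexp.mul (hd x hx).ofReal_comp).congr_deriv ?_
    push_cast
    ring
  · have h0 : Tendsto (fun x : ℝ => C * (x ^ s * exp (-t * x))) atTop (𝓝 0) := by
      simpa using (tendsto_rpow_mul_exp_neg_mul_atTop_nhds_zero s t ht).const_mul C
    refine squeeze_zero_norm' ?_ h0
    filter_upwards [eventually_gt_atTop 0] with x hx using hbd x hx

/-- Rescaling of the Laplace integral. -/
lemma rpow_mul_rotLaplace {p : ℝ → ℝ} {a : ℝ} (hp : ∀ x, 0 < x → y x = x ^ (a - 1) * p x)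
    {t : ℝ} (ht : 0 < t) : ((t ^ a : ℝ) : ℂ) * rotLaplace y t =
      ∫ u in Ioi (0 : ℝ), ((u ^ (a - 1) * exp (-u) : ℝ) : ℂ) *
        (Complex.exp (-((u * t⁻¹ : ℝ) * Complex.I)) * p (u * t⁻¹)) := by
  have h := MeasureTheory.integral_comp_mul_right_Ioi
    (fun x : ℝ => Complex.exp (-((t + Complex.I) * x)) * y x) 0 (inv_pos.2 ht)
  rw [zero_mul, inv_inv] at h
  have h2 : ((t ^ a : ℝ) : ℂ) * rotLaplace y t = ((t ^ (a - 1) : ℝ) : ℂ) *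
      ∫ x in Ioi (0 : ℝ), Complex.exp (-((t + Complex.I) * ((x * t⁻¹ : ℝ) : ℂ))) * y (x * t⁻¹) := by
    rw [h, rotLaplace, rpow_sub_one ht.ne', Complex.real_smul, ← mul_assoc]
    congr 1
    push_cast
    have : (t : ℂ) ≠ 0 := by exact_mod_cast ht.ne'
    field_simp
  rw [h2, ← MeasureTheory.integral_const_mul]
  refine MeasureTheory.setIntegral_congr_fun measurableSet_Ioi fun u hu => ?_
  have hu : 0 < u := hu
  have hut : 0 < u * t⁻¹ := by positivity
  rw [hp _ hut, mul_rpow hu.le (inv_pos.2 ht).le, inv_rpow ht.le]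
  have h3 : Complex.exp (-((t + Complex.I) * ((u * t⁻¹ : ℝ) : ℂ)))
      = ((exp (-u) : ℝ) : ℂ) * Complex.exp (-((u * t⁻¹ : ℝ) * Complex.I)) := by
    rw [Complex.ofReal_exp, ← Complex.exp_add]
    congr 1
    push_cast
    have : (t : ℂ) ≠ 0 := by exact_mod_cast ht.ne'
    field_simp
    ring
  rw [h3]
  have h4 : ((t ^ (a - 1) : ℝ) : ℂ) ≠ 0 := by exact_mod_cast (rpow_pos_of_pos ht _).ne'
  push_cast
  field_simp

end

/-- Dominated convergence against the Gamma density. The filter is left general because the lemma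
serves both `R → 0⁺` and `R → ∞`. -/
lemma tendsto_integral_rpow_mul_exp_neg {a B : ℝ} (ha : 0 < a) {G : ℝ → ℂ} {c : ℂ}
    {l : Filter ℝ} [l.IsCountablyGenerated] (hG : ContinuousOn G (Ioi 0))
    (hB : ∀ x, 0 < x → ‖G x‖ ≤ B) (hl : ∀ᶠ R in l, 0 < R)
    (hlim : ∀ u, 0 < u → Tendsto (fun R => G (u * R)) l (𝓝 c)) :
    Tendsto (fun R => ∫ u in Ioi (0 : ℝ), ((u ^ (a - 1) * exp (-u) : ℝ) : ℂ) * G (u * R)) l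
      (𝓝 (Real.Gamma a * c)) := by
  have h1 : ((Real.Gamma a : ℝ) : ℂ) * c
      = ∫ u in Ioi (0 : ℝ), ((u ^ (a - 1) * exp (-u) : ℝ) : ℂ) * c := by
    rw [MeasureTheory.integral_mul_const, integral_complex_ofReal, Real.Gamma_eq_integral ha]
    congr 3
    ext u; ring
  rw [h1]
  have hw : ContinuousOn (fun u : ℝ => ((u ^ (a - 1) * exp (-u) : ℝ) : ℂ)) (Ioi 0) := by
    refine Complex.continuous_ofReal.comp_continuousOn (ContinuousOn.mul ?_ (by fun_prop))
    exact fun u hu => (continuousAt_rpow_const u _ (Or.inl (ne_of_gt hu))).continuousWithinAt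
  refine MeasureTheory.tendsto_integral_filter_of_dominated_convergence
    (fun u => B * (u ^ (a - 1) * exp (-1 * u))) ?_ ?_
    (integrableOn_rpow_mul_exp (by linarith) one_pos B) ?_
  · filter_upwards [hl] with R hR
    refine (hw.mul (hG.comp (by fun_prop) fun u hu => ?_)).aestronglyMeasurable measurableSet_Ioi
    exact mul_pos hu hR
  · filter_upwards [hl] with R hR
    refine (MeasureTheory.ae_restrict_iff' measurableSet_Ioi).2
      (Eventually.of_forall fun u hu => ?_)
    have hu : 0 < u := hu
    rw [norm_mul, Complex.norm_real, Real.norm_of_nonneg (by positivity), mul_comm, neg_one_mul]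
    exact mul_le_mul_of_nonneg_right (hB _ (mul_pos hu hR)) (by positivity)
  · exact (MeasureTheory.ae_restrict_iff' measurableSet_Ioi).2
      (Eventually.of_forall fun u hu => (hlim u hu).const_mul _)

/-- This is the Riemann–Lebesgue lemma; it removes the conjugate half of the oscillation near `P =
i`. -/
lemma tendsto_integral_rpow_mul_exp_neg_oscillating (a : ℝ) :
    Tendsto (fun R : ℝ => ∫ u in Ioi (0 : ℝ), ((u ^ (a - 1) * exp (-u) : ℝ) : ℂ) *
      Complex.exp (-(2 * (u * R : ℝ) * Complex.I))) atTop (𝓝 0) := by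
  have h := Real.tendsto_integral_exp_smul_cocompact
    ((Ioi (0 : ℝ)).indicator fun u : ℝ => ((u ^ (a - 1) * exp (-u) : ℝ) : ℂ))
  -- With the character normalised as `e^{−2πiuξ}`, the phase `2uR` means `ξ = R/π`.
  have h1 : Tendsto (fun R : ℝ => R / π) atTop (cocompact ℝ) :=
    (tendsto_id.atTop_div_const pi_pos).mono_right atTop_le_cocompact
  refine (h.comp h1).congr fun R => ?_
  rw [Function.comp_apply, ← MeasureTheory.integral_indicator measurableSet_Ioi]
  congr 1
  ext u
  by_cases hu : u ∈ Ioi (0 : ℝ)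
  · rw [indicator_of_mem hu, indicator_of_mem hu, Circle.smul_def, Real.fourierChar_apply,
      smul_eq_mul, mul_comm]
    congr 2
    push_cast
    have : (π : ℂ) ≠ 0 := by exact_mod_cast pi_ne_zero
    field_simp
  · rw [indicator_of_notMem hu, indicator_of_notMem hu, smul_zero]

/-! ### The amplitude of `J_μ` for `μ > -1/2` -/

/-- The entire function `x^(-μ) J_μ(x)`. -/
def besselReduced (μ x : ℝ) : ℝ := 2 ^ (-μ) * besselEntire μ ((x / 2) ^ 2)

lemma besselJ_eq_rpow_mul (μ : ℝ) {x : ℝ} (hx : 0 < x) :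
    besselJ μ x = x ^ μ * besselReduced μ x := by
  rw [besselJ_eq μ hx, besselReduced, div_rpow hx.le two_pos.le, rpow_neg two_pos.le]
  ring

lemma hasDerivAt_besselReduced (μ x : ℝ) :
    HasDerivAt (besselReduced μ) (-(x * besselReduced (μ + 1) x)) x := by
  have ha : HasDerivAt (fun x : ℝ => x / 2) (1 / 2) x := (hasDerivAt_id x).div_const 2
  have h := ((hasDerivAt_besselEntire μ ((x / 2) ^ 2)).comp x (ha.pow 2)).const_mul ((2 : ℝ) ^ (-μ))
  refine h.congr_deriv ?_
  rw [besselReduced, show -(μ + 1) = -μ - 1 by ring, rpow_sub_one two_ne_zero]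
  push_cast
  ring

lemma besselReduced_eq_add_one (μ x : ℝ) : besselReduced μ x =
    2 * (μ + 1) * besselReduced (μ + 1) x - x ^ 2 * besselReduced (μ + 1 + 1) x := by
  have h := besselEntire_sub_one (μ + 1) ((x / 2) ^ 2)
  rw [add_sub_cancel_right] at h
  rw [besselReduced, besselReduced, besselReduced, h, show -(μ + 1 + 1) = -μ - 1 - 1 by ring,
    show -(μ + 1) = -μ - 1 by ring, rpow_sub_one two_ne_zero (-μ - 1),
    rpow_sub_one two_ne_zero (-μ)]
  ring

lemma continuous_besselReduced (μ : ℝ) : Continuous (besselReduced μ) :=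
  continuous_iff_continuousAt.2 fun x => (hasDerivAt_besselReduced μ x).continuousAt

/-- On `(0, 1]` the entire factor is bounded and `x^(μ+1/2) ≤ 1`; beyond 1 the energy bound controls
`√x J_μ`, and `x^(μ+1/2) ≥ 1` transfers it to the entire factor. -/
lemma exists_bound_sqrt_mul_besselJ {μ : ℝ} (hμ : -1 / 2 < μ) :
    ∃ B, ∀ x, 0 < x → |√x * besselJ μ x| ≤ B ∧ |besselReduced μ x| ≤ B := by
  obtain ⟨C, hC⟩ := (isCompact_Icc (a := (0 : ℝ)) (b := 1)).exists_bound_of_continuousOn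
    (continuous_besselReduced μ).continuousOn
  have hsol := isRadialSolution_besselJ μ
  set M := ((√1 * besselJ μ 1) ^ 2 + (√1 * besselJ (μ - 1) 1 - (μ - 1 / 2) / 1 *
    (√1 * besselJ μ 1)) ^ 2) * exp (|μ ^ 2 - 1 / 4| / 1)
  have hrel : ∀ x, 0 < x → √x * besselJ μ x = x ^ (μ + 1 / 2) * besselReduced μ x := fun x hx => by
    rw [besselJ_eq_rpow_mul μ hx, sqrt_eq_rpow, rpow_add hx]; ring
  have hC0 : 0 ≤ C := (norm_nonneg _).trans (hC 0 (by simp))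
  refine ⟨C + √M, fun x hx => ?_⟩
  rcases le_total x 1 with h1 | h1
  · have h2 : |besselReduced μ x| ≤ C := hC x ⟨hx.le, h1⟩
    refine ⟨?_, h2.trans (le_add_of_nonneg_right (sqrt_nonneg _))⟩
    rw [hrel x hx, abs_mul, abs_of_pos (rpow_pos_of_pos hx _)]
    have h3 : x ^ (μ + 1 / 2) ≤ 1 := rpow_le_one hx.le h1 (by linarith)
    calc x ^ (μ + 1 / 2) * |besselReduced μ x| ≤ 1 * C := by gcongr
      _ ≤ C + √M := by rw [one_mul]; exact le_add_of_nonneg_right (sqrt_nonneg _)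
  · have h2 := hsol.energy_le one_pos h1
    have h3 : |√x * besselJ μ x| ≤ √M :=
      abs_le_sqrt ((le_add_of_nonneg_right (sq_nonneg _)).trans h2)
    refine ⟨h3.trans (le_add_of_nonneg_left hC0), ?_⟩
    refine le_trans ?_ (h3.trans (le_add_of_nonneg_left hC0))
    rw [hrel x hx, abs_mul, abs_of_pos (rpow_pos_of_pos hx _)]
    exact le_mul_of_one_le_left (abs_nonneg _) (one_le_rpow h1 (by linarith))

/-- Closed form, up to a constant, of the Laplace transform of `x^μ J_μ(x)`. -/
lemma rotLaplace_besselJ_eq {μ : ℝ} (hμ : -1 / 2 < μ) {s t : ℝ} (hs : 0 < s) (ht : 0 < t) :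
    Complex.exp ((μ + 1 / 2 : ℝ) * (Real.log s + Complex.log (s + 2 * Complex.I))) *
      rotLaplace (fun x => x ^ (2 * μ) * besselReduced μ x) s =
    Complex.exp ((μ + 1 / 2 : ℝ) * (Real.log t + Complex.log (t + 2 * Complex.I))) *
      rotLaplace (fun x => x ^ (2 * μ) * besselReduced μ x) t := by
  obtain ⟨B, hB⟩ := exists_bound_sqrt_mul_besselJ hμ
  obtain ⟨B', hB'⟩ := exists_bound_sqrt_mul_besselJ (μ := μ + 1) (by linarith)
  set y : ℝ → ℝ := fun x => x ^ (2 * μ) * besselReduced μ x with hy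
  -- Here `y = x^μ J_μ` and `u = x^(μ+1) J_{μ+1}`, linked by `(x y)' = (2μ + 1) y − u` and `u' = x
  -- y`. The factor `x` is kept apart so that `u 0 = 0` is immediate.
  set u : ℝ → ℝ := fun x => x * (x ^ (2 * μ + 1) * besselReduced (μ + 1) x) with hu
  have hrp : ∀ p : ℝ, ContinuousOn (fun x : ℝ => x ^ p) (Ioi 0) := fun p x hx =>
    (continuousAt_rpow_const x _ (Or.inl (ne_of_gt hx))).continuousWithinAt
  have hyc : ContinuousOn y (Ioi 0) := (hrp _).mul (continuous_besselReduced μ).continuousOn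
  have huc : ContinuousOn u (Ioi 0) :=
    continuousOn_id.mul ((hrp _).mul (continuous_besselReduced _).continuousOn)
  have hyb : ∀ x, 0 < x → |y x| ≤ B * x ^ (2 * μ) := fun x hx => by
    rw [hy, abs_mul, abs_of_pos (rpow_pos_of_pos hx _), mul_comm]
    exact mul_le_mul_of_nonneg_right (hB x hx).2 (rpow_nonneg hx.le _)
  have hxyb : ∀ x, 0 < x → |x * y x| ≤ B * x ^ (2 * μ + 1) := fun x hx => by
    rw [abs_mul, abs_of_pos hx, rpow_add_one hx.ne', ← mul_assoc, mul_comm]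
    exact mul_le_mul_of_nonneg_right (hyb x hx) hx.le
  have hub : ∀ x, 0 < x → |u x| ≤ B' * x ^ (2 * μ + 2) := fun x hx => by
    rw [hu, abs_mul, abs_mul, abs_of_pos hx, abs_of_pos (rpow_pos_of_pos hx _),
      show 2 * μ + 2 = 2 * μ + 1 + 1 by ring, rpow_add_one hx.ne' (2 * μ + 1)]
    have := (hB' x hx).2
    have h0 : 0 ≤ x ^ (2 * μ + 1) := rpow_nonneg hx.le _
    nlinarith [mul_nonneg hx.le h0]
  have hdxy : ∀ x, 0 < x → HasDerivAt (fun x => x * y x) ((2 * μ + 1) * y x - u x) x := by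
    intro x hx
    have h := (hasDerivAt_id x).mul
      ((hasDerivAt_rpow_const (p := 2 * μ) (Or.inl hx.ne')).mul (hasDerivAt_besselReduced μ x))
    refine h.congr_deriv ?_
    simp only [id, hy, hu, Pi.mul_apply]
    rw [rpow_add_one hx.ne', rpow_sub_one hx.ne']
    field_simp
    ring
  have hdu : ∀ x, 0 < x → HasDerivAt u (x * y x) x := by
    intro x hx
    have h := (hasDerivAt_id x).mul ((hasDerivAt_rpow_const (p := 2 * μ + 1)
      (Or.inl hx.ne')).mul (hasDerivAt_besselReduced (μ + 1) x))
    refine h.congr_deriv ?_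
    simp only [id, hy, Pi.mul_apply]
    rw [besselReduced_eq_add_one μ x, rpow_add_one hx.ne', add_sub_cancel_right]
    field_simp
    ring
  -- With `P = t + i`, the two relations transform into `P L[xy] = (2μ+1) L[y] − L[u]` and `P L[u] =
  -- L[xy] = −L[y]'`. Eliminating `L[u]` and using `P² + 1 = t (t + 2i)` gives this equation.
  have hFd : ∀ t, 0 < t → HasDerivAt (rotLaplace y)
      (-((2 * μ + 1) * (t + Complex.I) / (t * (t + 2 * Complex.I)) * rotLaplace y t)) t := by
    intro t ht
    refine (hasDerivAt_rotLaplace hyc hyb (by linarith) ht).congr_deriv ?_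
    have i1 := integrableOn_rotLaplace hyc hyb (by linarith) ht
    have i2 := integrableOn_rotLaplace huc hub (by linarith) ht
    have hfun : (fun x : ℝ => Complex.exp (-((t + Complex.I) * x)) *
        (((2 * μ + 1) * y x - u x : ℝ) : ℂ)) = fun x : ℝ =>
        (2 * μ + 1) * (Complex.exp (-((t + Complex.I) * x)) * y x)
          - Complex.exp (-((t + Complex.I) * x)) * u x := by
      ext x
      push_cast
      ring
    have e1 := rotLaplace_deriv hdu (by simp [hu]) hub (by linarith) ht
      (integrableOn_rotLaplace (continuousOn_id.mul hyc) hxyb (by linarith) ht)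
    have e2 := rotLaplace_deriv hdxy (by simp) hxyb (by linarith) ht
      (by rw [hfun]; exact (i1.const_mul _).sub i2)
    have e3 : rotLaplace (fun x => (2 * μ + 1) * y x - u x) t
        = (2 * μ + 1) * rotLaplace y t - rotLaplace u t := by
      rw [rotLaplace, hfun, MeasureTheory.integral_sub (i1.const_mul _) i2,
        MeasureTheory.integral_const_mul, rotLaplace, rotLaplace]
    rw [e3] at e2
    have h1 : (t : ℂ) ≠ 0 := by exact_mod_cast ht.ne'
    have h2 : (t : ℂ) + 2 * Complex.I ≠ 0 := fun h => by
      have := congrArg Complex.re h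
      simp at this
      exact ht.ne' this
    rw [neg_inj, eq_comm, div_mul_eq_mul_div, div_eq_iff (mul_ne_zero h1 h2)]
    linear_combination (t + Complex.I) * e2 - e1 + rotLaplace (fun x => x * y x) t * Complex.I_sq
  -- A branch of `(P² + 1)^(μ+1/2)` along the line, hence an integrating factor.
  set W : ℝ → ℂ := fun s =>
    Complex.exp ((μ + 1 / 2 : ℝ) * (Real.log s + Complex.log (s + 2 * Complex.I))) with hW
  have hWd : ∀ t, 0 < t → HasDerivAt W
      (W t * ((2 * μ + 1) * (t + Complex.I) / (t * (t + 2 * Complex.I)))) t := by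
    intro t ht
    have h1 : (t : ℂ) ≠ 0 := by exact_mod_cast ht.ne'
    have hsl : (t : ℂ) + 2 * Complex.I ∈ Complex.slitPlane := by
      left; simpa using ht
    have h2 := Complex.slitPlane_ne_zero hsl
    have ha : HasDerivAt (fun s : ℝ => (s : ℂ) + 2 * Complex.I) ((1 : ℝ) : ℂ) t :=
      (hasDerivAt_id t).ofReal_comp.add_const _
    have hb := (((hasDerivAt_log ht.ne').ofReal_comp.add (ha.clog_real hsl)).const_mul
      ((μ + 1 / 2 : ℝ) : ℂ)).cexp
    refine hb.congr_deriv ?_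
    simp only [hW, Pi.add_apply]
    congr 1
    push_cast
    field_simp
    ring
  have hG : ∀ t ∈ Ioi (0 : ℝ), HasDerivAt (fun t => W t * rotLaplace y t) 0 t := by
    intro t ht
    refine ((hWd t ht).mul (hFd t ht)).congr_deriv ?_
    ring
  exact isOpen_Ioi.is_const_of_deriv_eq_zero isPreconnected_Ioi
    (fun t ht => (hG t ht).differentiableAt.differentiableWithinAt)
    (fun t ht => (hG t ht).deriv) (mem_Ioi.2 hs) (mem_Ioi.2 ht)

/-- Large `t` sees only `x = 0`: the weight behaves like `t^(2μ+1)`, and after rescaling by `R = 1/t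
→ 0⁺` the integrand tends to the Gamma density times the value of the entire factor at 0. -/
lemma tendsto_rotLaplace_besselJ_atTop {μ : ℝ} (hμ : -1 / 2 < μ) :
    Tendsto (fun t : ℝ =>
      Complex.exp ((μ + 1 / 2 : ℝ) * (Real.log t + Complex.log (t + 2 * Complex.I))) *
        rotLaplace (fun x => x ^ (2 * μ) * besselReduced μ x) t) atTop
      (𝓝 (Real.Gamma (2 * μ + 1) * besselReduced μ 0)) := by
  obtain ⟨B, hB⟩ := exists_bound_sqrt_mul_besselJ hμ
  have hGc : Continuous fun s : ℝ => Complex.exp (-((s : ℝ) * Complex.I)) * besselReduced μ s :=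
    Continuous.mul (by fun_prop) (Complex.continuous_ofReal.comp (continuous_besselReduced μ))
  have hnorm : ∀ s : ℝ, ‖Complex.exp (-((s : ℝ) * Complex.I))‖ = 1 := fun s => by
    rw [← neg_mul, ← Complex.ofReal_neg, Complex.norm_exp_ofReal_mul_I]
  have h1 := tendsto_integral_rpow_mul_exp_neg (a := 2 * μ + 1) (B := B) (by linarith)
    (G := fun s : ℝ => Complex.exp (-((s : ℝ) * Complex.I)) * besselReduced μ s)
    (c := (besselReduced μ 0 : ℂ)) (l := 𝓝[>] 0) hGc.continuousOn
    (fun x hx => by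
      rw [norm_mul, hnorm, one_mul, Complex.norm_real]
      exact (hB x hx).2) self_mem_nhdsWithin
    (fun u _ => by
      have := (hGc.comp (continuous_const_mul u)).tendsto 0
      simpa [Function.comp_def] using this.mono_left (nhdsWithin_le_nhds (s := Ioi 0)))
  have h2 := h1.comp tendsto_inv_atTop_nhdsGT_zero
  have h3 : Tendsto (fun t : ℝ => Complex.exp ((μ + 1 / 2 : ℝ) *
      Complex.log (1 + ((t⁻¹ : ℝ) : ℂ) * (2 * Complex.I)))) atTop (𝓝 1) := by
    have hc : ContinuousAt (fun r : ℝ => Complex.exp ((μ + 1 / 2 : ℝ) *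
      Complex.log (1 + (r : ℂ) * (2 * Complex.I)))) 0 := by
      refine (ContinuousAt.const_mul (ContinuousAt.clog (by fun_prop) ?_) _).cexp
      simp [Complex.one_mem_slitPlane]
    have := hc.tendsto.comp tendsto_inv_atTop_zero
    simpa [Function.comp_def] using this
  have h4 := h3.mul h2
  rw [one_mul] at h4
  refine h4.congr' ?_
  filter_upwards [eventually_gt_atTop 0] with t ht
  have h5 := rpow_mul_rotLaplace (y := fun x => x ^ (2 * μ) * besselReduced μ x)
    (p := besselReduced μ) (a := 2 * μ + 1) (fun x _ => by rw [add_sub_cancel_right]) ht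
  simp only [Function.comp_apply]
  rw [← h5, ← mul_assoc]
  congr 1
  have ht0 : (t : ℂ) ≠ 0 := by exact_mod_cast ht.ne'
  have hz : (1 : ℂ) + ((t⁻¹ : ℝ) : ℂ) * (2 * Complex.I) ≠ 0 := fun h => by
    have := congrArg Complex.re h
    simp at this
  have h6 : (t : ℂ) + 2 * Complex.I = t * (1 + ((t⁻¹ : ℝ) : ℂ) * (2 * Complex.I)) := by
    push_cast; field_simp
  rw [h6, Complex.log_ofReal_mul ht hz, rpow_def_of_pos ht, Complex.ofReal_exp, ← Complex.exp_add]
  congr 1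
  push_cast
  ring

/-- Small `t` sees only `x = ∞`: up to `o(1)`, `e^{−is} √s J_μ(s)` is `z/2` plus a multiple of
`e^{−2is}`. The constant survives averaging against the Gamma density, the oscillation does not. -/
lemma tendsto_rotLaplace_besselJ_zero {μ : ℝ} (hμ : -1 / 2 < μ) {z : ℂ}
    (hz : Tendsto (fun s : ℝ => Complex.exp (-(s * Complex.I)) *
      ((√s * besselJ μ s : ℝ) - Complex.I *
        (√s * besselJ (μ - 1) s - (μ - 1 / 2) / s * (√s * besselJ μ s) : ℝ))) atTop (𝓝 z)) :
    Tendsto (fun t : ℝ =>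
      Complex.exp ((μ + 1 / 2 : ℝ) * (Real.log t + Complex.log (t + 2 * Complex.I))) *
        rotLaplace (fun x => x ^ (2 * μ) * besselReduced μ x) t) (𝓝[>] 0)
      (𝓝 (Complex.exp ((μ + 1 / 2 : ℝ) * Complex.log (2 * Complex.I)) *
        (Real.Gamma (μ + 1 / 2) * (z / 2)))) := by
  obtain ⟨B, hB⟩ := exists_bound_sqrt_mul_besselJ hμ
  have hsol := isRadialSolution_besselJ μ
  set a : ℝ → ℝ := fun s => √s * besselJ μ s with ha
  set a' : ℝ → ℝ := fun s => √s * besselJ (μ - 1) s - (μ - 1 / 2) / s * (√s * besselJ μ s) with ha'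
  have hnorm : ∀ s : ℝ, ‖Complex.exp (-((s : ℝ) * Complex.I))‖ = 1 := fun s => by
    rw [← neg_mul, ← Complex.ofReal_neg, Complex.norm_exp_ofReal_mul_I]
  have hnorm2 : ∀ s : ℝ, ‖Complex.exp (-(2 * (s : ℝ) * Complex.I))‖ = 1 := fun s => by
    have := hnorm (2 * s)
    push_cast at this
    exact this
  -- The remainder after the constant and the conjugate oscillation, from `a = Re(e^{is} Z)` with `Z
  -- → z`.
  set r : ℝ → ℂ := fun s => Complex.exp (-(s * Complex.I)) * a s - z / 2
    - (starRingEnd ℂ) z / 2 * Complex.exp (-(2 * s * Complex.I)) with hr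
  have hac : ContinuousOn (fun s : ℝ => Complex.exp (-(s * Complex.I)) * a s) (Ioi 0) :=
    ContinuousOn.mul (by fun_prop) (Complex.continuous_ofReal.comp_continuousOn hsol.continuousOn)
  have hrc : ContinuousOn r (Ioi 0) :=
    (hac.sub continuousOn_const).sub (by fun_prop)
  have hab : ∀ s, 0 < s → ‖Complex.exp (-((s : ℝ) * Complex.I)) * a s‖ ≤ B := fun s hs => by
    rw [norm_mul, hnorm, one_mul, Complex.norm_real]
    exact (hB s hs).1
  have hrb : ∀ s, 0 < s → ‖r s‖ ≤ B + ‖z‖ / 2 + ‖z‖ / 2 := fun s hs => by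
    refine (norm_sub_le _ _).trans (add_le_add ((norm_sub_le _ _).trans
      (add_le_add (hab s hs) (by simp))) ?_)
    rw [norm_mul, hnorm2, mul_one]
    simp
  have hr0 : Tendsto r atTop (𝓝 0) := by
    rw [tendsto_zero_iff_norm_tendsto_zero]
    refine squeeze_zero (fun _ => norm_nonneg _) (fun s => ?_)
      (tendsto_iff_norm_sub_tendsto_zero.1 hz)
    set Z := Complex.exp (-(s * Complex.I)) * ((a s : ℂ) - Complex.I * a' s) with hZ
    have hconj : (starRingEnd ℂ) Z = Complex.exp (s * Complex.I) * (a s + Complex.I * a' s) := by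
      rw [hZ, map_mul, ← Complex.exp_conj]
      simp
    have he : Complex.exp (-(2 * s * Complex.I)) * Complex.exp (s * Complex.I)
        = Complex.exp (-(s * Complex.I)) := by
      rw [← Complex.exp_add]; congr 1; ring
    have hrs : r s = (Z - z) / 2
        + (starRingEnd ℂ) (Z - z) / 2 * Complex.exp (-(2 * s * Complex.I)) := by
      rw [map_sub, hconj, hZ, hr]
      linear_combination (-(a s + Complex.I * a' s) / 2) * he
    rw [hrs]
    refine (norm_add_le _ _).trans ?_
    rw [norm_mul, hnorm2, norm_div, norm_div, RCLike.norm_conj]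
    simp
  have h1 := tendsto_integral_rpow_mul_exp_neg (a := μ + 1 / 2) (by linarith) hrc hrb
    (eventually_gt_atTop 0) (fun u hu => hr0.comp (tendsto_id.const_mul_atTop hu))
  have h2 := (tendsto_integral_rpow_mul_exp_neg_oscillating (μ + 1 / 2)).const_mul
    ((starRingEnd ℂ) z / 2)
  have h3 : Tendsto (fun R : ℝ => ∫ u in Ioi (0 : ℝ),
      ((u ^ (μ + 1 / 2 - 1) * exp (-u) : ℝ) : ℂ) *
        (Complex.exp (-((u * R : ℝ) * Complex.I)) * a (u * R))) atTop
      (𝓝 (Real.Gamma (μ + 1 / 2) * (z / 2))) := by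
    have h4 := (h1.add h2).const_add (Real.Gamma (μ + 1 / 2) * (z / 2))
    simp only [mul_zero, add_zero] at h4
    refine h4.congr' ?_
    filter_upwards [eventually_gt_atTop 0] with R hR
    have hw : ContinuousOn (fun u : ℝ => ((u ^ (μ + 1 / 2 - 1) * exp (-u) : ℝ) : ℂ)) (Ioi 0) := by
      refine Complex.continuous_ofReal.comp_continuousOn (ContinuousOn.mul ?_ (by fun_prop))
      exact fun u hu => (continuousAt_rpow_const u _ (Or.inl (ne_of_gt hu))).continuousWithinAt
    have hint : ∀ (g : ℝ → ℂ) (C : ℝ), ContinuousOn g (Ioi 0) → (∀ x, 0 < x → ‖g x‖ ≤ C) →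
        MeasureTheory.IntegrableOn
          (fun u : ℝ => ((u ^ (μ + 1 / 2 - 1) * exp (-u) : ℝ) : ℂ) * g (u * R)) (Ioi 0) := by
      intro g C hg hC
      refine (integrableOn_rpow_mul_exp (s := μ + 1 / 2 - 1) (b := 1) (by linarith) one_pos C).mono'
        ((hw.mul (hg.comp (by fun_prop) fun u hu => mul_pos hu hR)).aestronglyMeasurable
          measurableSet_Ioi) ?_
      refine (MeasureTheory.ae_restrict_iff' measurableSet_Ioi).2
        (Eventually.of_forall fun u hu => ?_)
      have hu : 0 < u := hu
      rw [norm_mul, Complex.norm_real, Real.norm_of_nonneg (by positivity), mul_comm, neg_one_mul]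
      exact mul_le_mul_of_nonneg_right (hC _ (mul_pos hu hR)) (by positivity)
    have i1 := hint (fun _ => z / 2) ‖z / 2‖ continuousOn_const (fun _ _ => le_rfl)
    have i2 := hint r _ hrc hrb
    have i3 := hint (fun s => Complex.exp (-(2 * s * Complex.I))) 1 (by fun_prop)
      (fun s _ => (hnorm2 s).le)
    have hΓ : ((Real.Gamma (μ + 1 / 2) : ℝ) : ℂ) * (z / 2)
        = ∫ u in Ioi (0 : ℝ), ((u ^ (μ + 1 / 2 - 1) * exp (-u) : ℝ) : ℂ) * (z / 2) := by
      rw [MeasureTheory.integral_mul_const, integral_complex_ofReal,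
        Real.Gamma_eq_integral (by linarith)]
      congr 3
      ext u; ring
    have i4 : MeasureTheory.IntegrableOn (fun u : ℝ =>
        ((u ^ (μ + 1 / 2 - 1) * exp (-u) : ℝ) : ℂ) * r (u * R) + (starRingEnd ℂ) z / 2 *
          (((u ^ (μ + 1 / 2 - 1) * exp (-u) : ℝ) : ℂ) *
            Complex.exp (-(2 * (u * R : ℝ) * Complex.I)))) (Ioi 0) := i2.add (i3.const_mul _)
    rw [hΓ, ← MeasureTheory.integral_const_mul, ← MeasureTheory.integral_add i2 (i3.const_mul _),
      ← MeasureTheory.integral_add i1 i4]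
    congr 1
    ext u
    simp only [hr]
    ring
  have h5 := h3.comp tendsto_inv_nhdsGT_zero
  have h6 : Tendsto (fun t : ℝ => Complex.exp ((μ + 1 / 2 : ℝ) * Complex.log (t + 2 * Complex.I)))
      (𝓝[>] 0) (𝓝 (Complex.exp ((μ + 1 / 2 : ℝ) * Complex.log (2 * Complex.I)))) := by
    have hc : ContinuousAt (fun t : ℝ => Complex.exp ((μ + 1 / 2 : ℝ) *
        Complex.log ((t : ℂ) + 2 * Complex.I))) 0 := by
      refine (ContinuousAt.const_mul (ContinuousAt.clog (by fun_prop) ?_) _).cexp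
      right; simp
    simpa using hc.tendsto.mono_left (nhdsWithin_le_nhds (s := Ioi 0))
  refine (h6.mul h5).congr' ?_
  filter_upwards [self_mem_nhdsWithin] with t ht
  have ht : 0 < t := ht
  have h7 := rpow_mul_rotLaplace (y := fun x => x ^ (2 * μ) * besselReduced μ x)
    (p := a) (a := μ + 1 / 2) (fun x hx => by
      rw [ha]
      simp only
      rw [besselJ_eq_rpow_mul μ hx, sqrt_eq_rpow, ← mul_assoc, ← mul_assoc, ← rpow_add hx,
        ← rpow_add hx]
      congr 2
      ring) ht
  simp only [Function.comp_apply]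
  rw [← h7, ← mul_assoc]
  congr 1
  rw [rpow_def_of_pos ht, Complex.ofReal_exp, ← Complex.exp_add]
  congr 1
  push_cast
  ring

/-- `√s J_μ(s) ~ √(2/π) cos(s - (μ + 1/2) π / 2)` as `s → ∞`, in terms of the amplitude. -/
lemma tendsto_amplitude_besselJ {μ : ℝ} (hμ : -1 / 2 < μ) :
    Tendsto (fun s : ℝ => Complex.exp (-(s * Complex.I)) *
      ((√s * besselJ μ s : ℝ) - Complex.I *
        (√s * besselJ (μ - 1) s - (μ - 1 / 2) / s * (√s * besselJ μ s) : ℝ))) atTop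
      (𝓝 (√(2 / π) * Complex.exp (-((μ + 1 / 2 : ℝ) * (π / 2 : ℝ) * Complex.I)))) := by
  obtain ⟨z, hz⟩ := (isRadialSolution_besselJ μ).exists_amplitude
  convert! hz using 2
  have h1 := tendsto_rotLaplace_besselJ_zero hμ hz
  have h2 := tendsto_rotLaplace_besselJ_atTop hμ
  have h3 : Tendsto (fun t : ℝ =>
      Complex.exp ((μ + 1 / 2 : ℝ) * (Real.log t + Complex.log (t + 2 * Complex.I))) *
        rotLaplace (fun x => x ^ (2 * μ) * besselReduced μ x) t) (𝓝[>] 0)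
      (𝓝 (Complex.exp ((μ + 1 / 2 : ℝ) * (Real.log 1 + Complex.log ((1 : ℝ) + 2 * Complex.I))) *
        rotLaplace (fun x => x ^ (2 * μ) * besselReduced μ x) 1)) := by
    refine tendsto_const_nhds.congr' ?_
    filter_upwards [self_mem_nhdsWithin] with t ht using rotLaplace_besselJ_eq hμ one_pos ht
  have h4 : Tendsto (fun t : ℝ =>
      Complex.exp ((μ + 1 / 2 : ℝ) * (Real.log t + Complex.log (t + 2 * Complex.I))) *
        rotLaplace (fun x => x ^ (2 * μ) * besselReduced μ x) t) atTop
      (𝓝 (Complex.exp ((μ + 1 / 2 : ℝ) * (Real.log 1 + Complex.log ((1 : ℝ) + 2 * Complex.I))) *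
        rotLaplace (fun x => x ^ (2 * μ) * besselReduced μ x) 1)) := by
    refine tendsto_const_nhds.congr' ?_
    filter_upwards [eventually_gt_atTop 0] with t ht using rotLaplace_besselJ_eq hμ one_pos ht
  -- The weighted transform is constant in `t`, so its limits at `0⁺` and at infinity agree; this is
  -- a linear equation for `z`.
  have key := (tendsto_nhds_unique h1 h3).trans (tendsto_nhds_unique h4 h2)
  have hq : besselReduced μ 0 = 2 ^ (-μ) * (Real.Gamma (μ + 1))⁻¹ := by
    rw [besselReduced]
    simp [besselEntire_zero_right]
  -- Legendre's duplication formula at `μ + 1/2`.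
  have hΓ : Real.Gamma (2 * μ + 1) * (2 ^ (-μ) * (Real.Gamma (μ + 1))⁻¹)
      = 2 ^ μ / √π * Real.Gamma (μ + 1 / 2) := by
    have h := Real.Gamma_mul_Gamma_add_half (μ + 1 / 2)
    rw [show μ + 1 / 2 + 1 / 2 = μ + 1 by ring, show 2 * (μ + 1 / 2) = 2 * μ + 1 by ring,
      show 1 - (2 * μ + 1) = -μ + -μ by ring, rpow_add two_pos, rpow_neg two_pos.le] at h
    have h0 : Real.Gamma (μ + 1) ≠ 0 := (Real.Gamma_pos_of_pos (by linarith)).ne'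
    have h2 : (2 : ℝ) ^ μ ≠ 0 := (rpow_pos_of_pos two_pos μ).ne'
    have h5 : √π ≠ 0 := (sqrt_pos.2 pi_pos).ne'
    rw [rpow_neg two_pos.le]
    field_simp at h ⊢
    linear_combination -h
  have hlog : Complex.exp ((μ + 1 / 2 : ℝ) * Complex.log (2 * Complex.I))
      = ((2 : ℝ) ^ μ * √2 : ℝ) * Complex.exp ((μ + 1 / 2 : ℝ) * (π / 2 : ℝ) * Complex.I) := by
    have h := Complex.log_ofReal_mul two_pos Complex.I_ne_zero
    rw [Complex.log_I] at h
    push_cast at h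
    rw [h, sqrt_eq_rpow, ← rpow_add two_pos, rpow_def_of_pos two_pos, Complex.ofReal_exp,
      ← Complex.exp_add]
    congr 1
    push_cast
    ring
  rw [hq, ← Complex.ofReal_mul, hΓ, hlog] at key
  have hg0 : ((Real.Gamma (μ + 1 / 2) : ℝ) : ℂ) ≠ 0 := by
    exact_mod_cast (Real.Gamma_pos_of_pos (by linarith)).ne'
  have h20 : (((2 : ℝ) ^ μ : ℝ) : ℂ) ≠ 0 := by exact_mod_cast (rpow_pos_of_pos two_pos μ).ne'
  have hs2 : ((√2 : ℝ) : ℂ) ^ 2 = 2 := by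
    exact_mod_cast sq_sqrt two_pos.le
  have hs20 : ((√2 : ℝ) : ℂ) ≠ 0 := by exact_mod_cast (sqrt_pos.2 two_pos).ne'
  have hπ0 : ((√π : ℝ) : ℂ) ≠ 0 := by exact_mod_cast (sqrt_pos.2 pi_pos).ne'
  rw [sqrt_div two_pos.le, Complex.exp_neg]
  have he := Complex.exp_ne_zero ((μ + 1 / 2 : ℝ) * (π / 2 : ℝ) * Complex.I)
  set e := Complex.exp ((μ + 1 / 2 : ℝ) * (π / 2 : ℝ) * Complex.I)
  simp only [Complex.ofReal_mul, Complex.ofReal_div] at key ⊢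
  generalize ((Real.Gamma (μ + 1 / 2) : ℝ) : ℂ) = g at key hg0
  field_simp at key ⊢
  apply mul_left_cancel₀ hs20
  linear_combination hs2 - key

/-! ### The amplitude of `Y_ν` -/

/-- The derivative of `omegaBar ν`. -/
def omegaBarDeriv (ν s : ℝ) : ℝ := omegaBar (ν - 1) s - (ν - 1 / 2) / s * omegaBar ν s

lemma isRadialSolution_omegaBar' (ν : ℝ) :
    IsRadialSolution (ν ^ 2 - 1 / 4) (omegaBar ν) (omegaBarDeriv ν) :=
  isRadialSolution_omegaBar ν

/-- With `θ = νπ`, the identity `e^{−iθ} cos θ − 1 = −i sin θ e^{−iθ}` shows that the combination is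
`−i` times the amplitude of `J_ν`: a quarter-period shift of unchanged modulus. -/
lemma norm_amplitude_combination (ν : ℝ) (hν : sin (ν * π) ≠ 0) :
    ‖(√(2 / π) * Complex.exp (-((ν + 1 / 2 : ℝ) * (π / 2 : ℝ) * Complex.I)) * (cos (ν * π) : ℝ)
      - √(2 / π) * Complex.exp (-((-ν + 1 / 2 : ℝ) * (π / 2 : ℝ) * Complex.I)))
      / (sin (ν * π) : ℝ)‖ ^ 2 = 2 / π := by
  have h1 : Complex.exp (-((ν + 1 / 2 : ℝ) * (π / 2 : ℝ) * Complex.I))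
      = Complex.exp (-((-ν + 1 / 2 : ℝ) * (π / 2 : ℝ) * Complex.I))
        * Complex.exp (-((ν * π : ℝ) * Complex.I)) := by
    rw [← Complex.exp_add]; congr 1; push_cast; ring
  have h2 : Complex.exp (-((ν * π : ℝ) * Complex.I))
      = (cos (ν * π) : ℝ) - (sin (ν * π) : ℝ) * Complex.I := by
    rw [← neg_mul, ← Complex.ofReal_neg, Complex.exp_mul_I, ← Complex.ofReal_cos,
      ← Complex.ofReal_sin, cos_neg, sin_neg]
    push_cast; ring
  have hn : ∀ x : ℝ, ‖Complex.exp (-((x : ℝ) * Complex.I))‖ = 1 := fun x => by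
    rw [← neg_mul, ← Complex.ofReal_neg, Complex.norm_exp_ofReal_mul_I]
  have hs : ((sin (ν * π) : ℝ) : ℂ) ≠ 0 := by exact_mod_cast hν
  have hsc : ((sin (ν * π) : ℝ) : ℂ) ^ 2 + ((cos (ν * π) : ℝ) : ℂ) ^ 2 = 1 := by
    exact_mod_cast sin_sq_add_cos_sq (ν * π)
  have h3 : (√(2 / π) * Complex.exp (-((ν + 1 / 2 : ℝ) * (π / 2 : ℝ) * Complex.I))
        * (cos (ν * π) : ℝ)
      - √(2 / π) * Complex.exp (-((-ν + 1 / 2 : ℝ) * (π / 2 : ℝ) * Complex.I)))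
      / (sin (ν * π) : ℝ) = -Complex.I * (√(2 / π) *
        Complex.exp (-((((-ν + 1 / 2) * (π / 2) : ℝ) : ℂ) * Complex.I)) *
        Complex.exp (-((ν * π : ℝ) * Complex.I))) := by
    rw [h1, div_eq_iff hs, h2]
    push_cast
    set e := Complex.exp (-((-(ν : ℂ) + 1 / 2) * (π / 2) * Complex.I))
    push_cast at hsc
    linear_combination (√(2 / π) * e) * hsc - √(2 / π) * e * Complex.sin (ν * π) ^ 2 * Complex.I_sq
  rw [h3, norm_mul, norm_mul, norm_mul, hn, hn, norm_neg, Complex.norm_I, one_mul, mul_one, mul_one,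
    Complex.norm_real, norm_of_nonneg (sqrt_nonneg _), sq_sqrt (by positivity)]

/-- `√s Y_ν(s)` has squared amplitude `2 / π`. -/
def HasBesselAmplitude (ν : ℝ) : Prop :=
  Tendsto (fun s => omegaBar ν s ^ 2 + omegaBarDeriv ν s ^ 2) atTop (𝓝 (2 / π))

lemma hasBesselAmplitude_of_abs_lt {ν : ℝ} (hν : |ν| < 1 / 2) (hs : sin (ν * π) ≠ 0) :
    HasBesselAmplitude ν := by
  have ⟨hν1, hν2⟩ := abs_lt.1 hν
  have h1 := tendsto_amplitude_besselJ (μ := ν) (by linarith)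
  have h2 := tendsto_amplitude_besselJ (μ := -ν) (by linarith)
  have h := (((h1.mul_const ((cos (ν * π) : ℝ) : ℂ)).sub h2).div_const
    ((sin (ν * π) : ℝ) : ℂ)).norm.pow 2
  rw [norm_amplitude_combination ν hs] at h
  refine h.congr' ?_
  filter_upwards [eventually_gt_atTop 0] with s hs0
  set a := fun μ : ℝ => √s * besselJ μ s
  set a' := fun μ : ℝ => √s * besselJ (μ - 1) s - (μ - 1 / 2) / s * (√s * besselJ μ s) with ha'
  have e1 : omegaBar ν s = (a ν * cos (ν * π) - a (-ν)) / sin (ν * π) := by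
    rw [omegaBar, besselY_eq_quotient hs, besselYQuotient]
    simp only [a]
    ring
  -- Uniqueness of the derivative avoids a second computation with the recurrences.
  have e2 : omegaBarDeriv ν s = (a' ν * cos (ν * π) - a' (-ν)) / sin (ν * π) := by
    refine (isRadialSolution_omegaBar' ν s hs0).1.unique ?_
    have h3 := (((isRadialSolution_besselJ ν s hs0).1.mul_const (cos (ν * π))).sub
      (isRadialSolution_besselJ (-ν) s hs0).1).div_const (sin (ν * π))
    refine h3.congr_of_eventuallyEq (Eventually.of_forall fun x => ?_)
    simp only [omegaBar]
    rw [besselY_eq_quotient hs, besselYQuotient]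
    simp only [Pi.sub_apply]
    ring
  have e3 : (Complex.exp (-(s * Complex.I)) * ((a ν : ℝ) - Complex.I * (a' ν : ℝ))
        * (cos (ν * π) : ℝ)
      - Complex.exp (-(s * Complex.I)) * ((a (-ν) : ℝ) - Complex.I * (a' (-ν) : ℝ)))
      / (sin (ν * π) : ℝ) = Complex.exp (-(s * Complex.I)) *
        (omegaBar ν s - Complex.I * omegaBarDeriv ν s) := by
    rw [e1, e2]
    push_cast
    ring
  have hn : ‖Complex.exp (-((s : ℝ) * Complex.I))‖ = 1 := by
    rw [← neg_mul, ← Complex.ofReal_neg, Complex.norm_exp_ofReal_mul_I]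
  have e4 : ‖Complex.exp (-(s * Complex.I)) *
        (omegaBar ν s - Complex.I * omegaBarDeriv ν s)‖ ^ 2
      = omegaBar ν s ^ 2 + omegaBarDeriv ν s ^ 2 := by
    rw [norm_mul, hn, one_mul, ← Complex.normSq_eq_norm_sq, Complex.normSq_apply]
    simp
    ring
  rw [← e4, ← e3]

/-! ### Integer shifts of the order, and the limit to exceptional orders -/

lemma besselY_sub_two (ν : ℝ) {x : ℝ} (hx : 0 < x) :
    besselY (ν - 1 - 1) x = 2 * (ν - 1) / x * besselY (ν - 1) x - besselY ν x := by
  have := (hasDerivAt_besselY (ν - 1) hx).unique (hasDerivAt_besselY_sub_one ν hx)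
  linear_combination this

lemma omegaBarDeriv_sub_one (ν : ℝ) {s : ℝ} (hs : 0 < s) :
    omegaBarDeriv (ν - 1) s = (ν - 1 / 2) / s * omegaBar (ν - 1) s - omegaBar ν s := by
  rw [omegaBarDeriv, omegaBar, omegaBar, omegaBar, besselY_sub_two ν hs]
  ring

lemma exists_bound_omegaBar (ν : ℝ) : ∃ B, ∀ s, 1 ≤ s → omegaBar ν s ^ 2 ≤ B :=
  ⟨_, fun s hs => (le_add_of_nonneg_right (sq_nonneg (omegaBarDeriv ν s))).trans
    ((isRadialSolution_omegaBar' ν).energy_le one_pos hs)⟩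

/-- The cross terms cancel, so the energies at orders `ν − 1` and `ν` differ by exactly `(ν −
1/2)²/s²` times a bounded quantity. -/
lemma hasBesselAmplitude_sub_one_iff (ν : ℝ) :
    HasBesselAmplitude (ν - 1) ↔ HasBesselAmplitude ν := by
  obtain ⟨B, hB⟩ := exists_bound_omegaBar ν
  obtain ⟨B', hB'⟩ := exists_bound_omegaBar (ν - 1)
  have hdiff : Tendsto (fun s => (omegaBar (ν - 1) s ^ 2 + omegaBarDeriv (ν - 1) s ^ 2)
      - (omegaBar ν s ^ 2 + omegaBarDeriv ν s ^ 2)) atTop (𝓝 0) := by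
    have h0 : Tendsto (fun s : ℝ => (ν - 1 / 2) ^ 2 * (B' + B) / s) atTop (𝓝 0) :=
      tendsto_const_nhds.div_atTop tendsto_id
    refine squeeze_zero_norm' ?_ h0
    filter_upwards [eventually_ge_atTop 1] with s hs
    have hs0 : 0 < s := by linarith
    have e : (omegaBar (ν - 1) s ^ 2 + omegaBarDeriv (ν - 1) s ^ 2)
        - (omegaBar ν s ^ 2 + omegaBarDeriv ν s ^ 2)
        = (ν - 1 / 2) ^ 2 * (omegaBar (ν - 1) s ^ 2 - omegaBar ν s ^ 2) / s ^ 2 := by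
      rw [omegaBarDeriv_sub_one ν hs0, omegaBarDeriv]
      field_simp
      ring
    rw [e, Real.norm_eq_abs, abs_div, abs_mul, abs_of_nonneg (sq_nonneg (ν - 1 / 2)),
      abs_of_nonneg (sq_nonneg s)]
    have h1 : |omegaBar (ν - 1) s ^ 2 - omegaBar ν s ^ 2| ≤ B' + B := by
      refine (abs_sub _ _).trans ?_
      rw [abs_of_nonneg (sq_nonneg _), abs_of_nonneg (sq_nonneg _)]
      exact add_le_add (hB' s hs) (hB s hs)
    have h2 : s ≤ s ^ 2 := by nlinarith
    gcongr
    exact mul_nonneg (sq_nonneg _) ((abs_nonneg _).trans h1)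
  constructor
  · intro h
    have := h.sub hdiff
    simp only [sub_sub_cancel, sub_zero] at this
    exact this
  · intro h
    have := h.add hdiff
    simp only [add_sub_cancel, add_zero] at this
    exact this

lemma hasBesselAmplitude_of_sin_ne_zero {ν : ℝ} (hs : sin (ν * π) ≠ 0) (hc : cos (ν * π) ≠ 0) :
    HasBesselAmplitude ν := by
  have hshift : ∀ n : ℤ, ∀ ν : ℝ, HasBesselAmplitude ν → HasBesselAmplitude (ν + n) := by
    intro n
    induction n with
    | zero => intro ν h; simpa using h
    | succ i ih =>
      intro ν h
      rw [← hasBesselAmplitude_sub_one_iff]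
      convert ih ν h using 1
      push_cast; ring
    | pred i ih =>
      intro ν h
      have := (hasBesselAmplitude_sub_one_iff _).2 (ih ν h)
      convert! this using 1
      push_cast; ring
  set n := round ν
  have hν : ν = (ν - n) + n := by ring
  rw [hν]
  have hmul : (ν - n) * π = ν * π - n * π := by ring
  have hn0 : cos (n * π) ≠ 0 := fun h => by
    have := sin_sq_add_cos_sq (n * π)
    rw [sin_int_mul_pi, h] at this
    norm_num at this
  -- Rounding gives `|ν − n| ≤ 1/2`; equality would make `ν` a half-integer and `cos νπ = 0`.
  refine hshift n _ (hasBesselAmplitude_of_abs_lt ((abs_sub_round ν).lt_of_ne fun h => hc ?_) ?_)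
  · have h2 : ν * π = n * π + π / 2 ∨ ν * π = n * π - π / 2 := by
      rcases abs_eq (by norm_num) |>.1 h with h | h
      · left; rw [hν, h]; ring
      · right; rw [hν, h]; ring
    rcases h2 with h2 | h2
    · rw [h2, cos_add_pi_div_two, sin_int_mul_pi, neg_zero]
    · rw [h2, cos_sub_pi_div_two, sin_int_mul_pi]
  · rw [hmul, sin_sub, sin_int_mul_pi, mul_zero, sub_zero]
    exact mul_ne_zero hs hn0

lemma tendsto_besselY_order (ν : ℝ) {x : ℝ} (hx : 0 < x) :
    Tendsto (fun μ => besselY μ x) (𝓝[≠] ν) (𝓝 (besselY ν x)) := by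
  refine (tendsto_besselYQuotient ν hx).congr' ?_
  filter_upwards [eventually_sin_mul_pi_ne_zero ν] with μ hμ using (besselY_eq_quotient hμ x).symm

lemma tendsto_add_const_nhdsNE (ν c : ℝ) :
    Tendsto (fun μ : ℝ => μ + c) (𝓝[≠] ν) (𝓝[≠] (ν + c)) := by
  refine tendsto_nhdsWithin_of_tendsto_nhds_of_eventually_within _
    ((continuous_add_const c).tendsto ν |>.mono_left nhdsWithin_le_nhds) ?_
  filter_upwards [self_mem_nhdsWithin] with μ hμ h
  exact hμ (add_left_injective c h)

/-- Orders near but different from `ν` are neither integers nor half-integers. Their energy estimate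
`|E − 2/π| ≤ M_μ/s` has a constant continuous in the order, so it passes to the limit at each fixed
`s`, which interchanges the limits in `μ` and `s`. -/
theorem hasBesselAmplitude (ν : ℝ) : HasBesselAmplitude ν := by
  have hev : ∀ᶠ μ in 𝓝[≠] ν, HasBesselAmplitude μ := by
    filter_upwards [eventually_sin_mul_pi_ne_zero ν, (tendsto_add_const_nhdsNE ν (1 / 2)).eventually
      (eventually_sin_mul_pi_ne_zero (ν + 1 / 2))] with μ h1 h2
    refine hasBesselAmplitude_of_sin_ne_zero h1 ?_
    rwa [← sin_add_pi_div_two, show μ * π + π / 2 = (μ + 1 / 2) * π by ring]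
  have hμ : Tendsto (fun μ : ℝ => μ) (𝓝[≠] ν) (𝓝 ν) := nhdsWithin_le_nhds
  have hΩ : ∀ s, 0 < s → Tendsto (fun μ => omegaBar μ s) (𝓝[≠] ν) (𝓝 (omegaBar ν s)) :=
    fun s hs => (tendsto_besselY_order ν hs).const_mul _
  have hΩ1 : ∀ s, 0 < s →
      Tendsto (fun μ => omegaBar (μ - 1) s) (𝓝[≠] ν) (𝓝 (omegaBar (ν - 1) s)) := by
    intro s hs
    exact ((tendsto_besselY_order (ν + -1) hs).comp (tendsto_add_const_nhdsNE ν (-1))).const_mul _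
  have hΩ' : ∀ s, 0 < s → Tendsto (fun μ => omegaBarDeriv μ s) (𝓝[≠] ν) (𝓝 (omegaBarDeriv ν s)) :=
    fun s hs => (hΩ1 s hs).sub (((hμ.sub_const _).div_const s).mul (hΩ s hs))
  have hF : ∀ s, 0 < s → Tendsto (fun μ => omegaBar μ s ^ 2 + omegaBarDeriv μ s ^ 2) (𝓝[≠] ν)
      (𝓝 (omegaBar ν s ^ 2 + omegaBarDeriv ν s ^ 2)) :=
    fun s hs => ((hΩ s hs).pow 2).add ((hΩ' s hs).pow 2)
  have hk : Tendsto (fun μ : ℝ => |μ ^ 2 - 1 / 4|) (𝓝[≠] ν) (𝓝 |ν ^ 2 - 1 / 4|) :=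
    ((hμ.pow 2).sub_const _).abs
  set M := 2 * |ν ^ 2 - 1 / 4| *
    ((omegaBar ν 1 ^ 2 + omegaBarDeriv ν 1 ^ 2) * exp |ν ^ 2 - 1 / 4|)
  have key : ∀ s, 1 ≤ s → |omegaBar ν s ^ 2 + omegaBarDeriv ν s ^ 2 - 2 / π| ≤ M / s := by
    intro s hs
    refine le_of_tendsto_of_tendsto ((hF s (by linarith)).sub_const (2 / π)).abs
      (((hk.const_mul 2).mul ((hF 1 one_pos).mul (continuous_exp.tendsto _ |>.comp hk))).div_const s)
      ?_
    filter_upwards [hev] with μ hμ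
    exact (isRadialSolution_omegaBar' μ).abs_energy_sub_le hμ hs
  rw [HasBesselAmplitude, tendsto_iff_norm_sub_tendsto_zero]
  refine squeeze_zero' (Eventually.of_forall fun _ => norm_nonneg _) ?_
    (tendsto_const_nhds (x := M).div_atTop tendsto_id)
  filter_upwards [eventually_ge_atTop 1] with s hs using key s hs

/-! ### The function `1 / w` and the canonical variable -/

section

variable {ν q₀ r₀ : ℝ}

/-- The derivative of `omegaOf`. -/
def omegaOfDeriv (ν q₀ r₀ τ : ℝ) : ℝ :=
  √(|q₀| / |r₀|) * omegaBarDeriv ν (√(|q₀| / |r₀|) * τ)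

lemma scale_pos (hq : 0 < q₀) (hr : 0 < r₀) : 0 < √(|q₀| / |r₀|) :=
  sqrt_pos.2 (div_pos (abs_pos.2 hq.ne') (abs_pos.2 hr.ne'))

lemma sq_scale (hq : 0 < q₀) (hr : 0 < r₀) : √(|q₀| / |r₀|) ^ 2 = q₀ / r₀ := by
  rw [abs_of_pos hq, abs_of_pos hr, sq_sqrt (by positivity)]

lemma hasDerivAt_omegaOf (ν : ℝ) (hq : 0 < q₀) (hr : 0 < r₀) {τ : ℝ} (hτ : 0 < τ) :
    HasDerivAt (omegaOf ν q₀ r₀) (omegaOfDeriv ν q₀ r₀ τ) τ := by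
  have hc := scale_pos hq hr
  have h := ((isRadialSolution_omegaBar' ν _ (mul_pos hc hτ)).1).comp τ
    ((hasDerivAt_id τ).const_mul √(|q₀| / |r₀|))
  refine h.congr_deriv ?_
  rw [omegaOfDeriv]; ring

lemma hasDerivAt_omegaOfDeriv (ν : ℝ) (hq : 0 < q₀) (hr : 0 < r₀) {τ : ℝ} (hτ : 0 < τ) :
    HasDerivAt (omegaOfDeriv ν q₀ r₀)
      (((ν ^ 2 - 1 / 4) / τ ^ 2 - q₀ / r₀) * omegaOf ν q₀ r₀ τ) τ := by
  have hc := scale_pos hq hr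
  have h := (((isRadialSolution_omegaBar' ν _ (mul_pos hc hτ)).2).comp τ
    ((hasDerivAt_id τ).const_mul √(|q₀| / |r₀|))).const_mul √(|q₀| / |r₀|)
  refine h.congr_deriv ?_
  rw [omegaOf, ← sq_scale hq hr]
  field_simp

/-- Simplicity of zeros. It gives strict monotonicity of `x(τ)` and isolates the singular points of
the canonical form. -/
lemma omegaOf_ne_zero_or (ν : ℝ) (hq : 0 < q₀) (hr : 0 < r₀) {τ : ℝ} (hτ : 0 < τ) :
    omegaOf ν q₀ r₀ τ ≠ 0 ∨ omegaOfDeriv ν q₀ r₀ τ ≠ 0 := by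
  have hc := scale_pos hq hr
  refine ((isRadialSolution_omegaBar' ν).ne_zero_or_ne_zero (by positivity)
    (hasBesselAmplitude ν) (mul_pos hc hτ)).imp id fun h => mul_ne_zero hc.ne' h

lemma continuousOn_omegaOf (ν : ℝ) (hq : 0 < q₀) (hr : 0 < r₀) :
    ContinuousOn (omegaOf ν q₀ r₀) (Ioi 0) := fun _ hτ =>
  (hasDerivAt_omegaOf ν hq hr hτ).continuousAt.continuousWithinAt

lemma sqrt_pOfTau_div (ν q₀ τ : ℝ) (hr : 0 < r₀) :
    √(pOfTau ν q₀ r₀ τ / r₀) = omegaOf ν q₀ r₀ τ ^ 2 / r₀ := by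
  rw [pOfTau, show omegaOf ν q₀ r₀ τ ^ 4 / r₀ / r₀ = (omegaOf ν q₀ r₀ τ ^ 2 / r₀) ^ 2 by
    field_simp, sqrt_sq (by positivity)]

variable {τ₀ : ℝ}

lemma canonicalVar_eq (ν q₀ x₁ τ₀ τ : ℝ) (hr : 0 < r₀) : canonicalVar ν q₀ r₀ x₁ τ₀ τ
    = -x₁ + ∫ s in τ₀..τ, omegaOf ν q₀ r₀ s ^ 2 / r₀ := by
  simp_rw [canonicalVar, sqrt_pOfTau_div ν q₀ _ hr]

lemma hasDerivAt_canonicalVar (ν x₁ : ℝ) (hq : 0 < q₀) (hr : 0 < r₀) (hτ₀ : 0 < τ₀) {τ : ℝ}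
    (hτ : 0 < τ) :
    HasDerivAt (canonicalVar ν q₀ r₀ x₁ τ₀) (omegaOf ν q₀ r₀ τ ^ 2 / r₀) τ := by
  have hc : ContinuousOn (fun s => omegaOf ν q₀ r₀ s ^ 2 / r₀) (Ioi 0) :=
    ((continuousOn_omegaOf ν hq hr).pow 2).div_const r₀
  have hsub : uIcc τ₀ τ ⊆ Ioi 0 := fun s hs => (lt_min hτ₀ hτ).trans_le hs.1
  have h := (intervalIntegral.integral_hasDerivAt_right (hc.mono hsub).intervalIntegrable
    (hc.stronglyMeasurableAtFilter isOpen_Ioi τ hτ)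
    (hc.continuousAt (Ioi_mem_nhds hτ))).const_add (-x₁)
  exact h.congr_of_eventuallyEq (Eventually.of_forall fun τ => canonicalVar_eq ν q₀ x₁ τ₀ τ hr)

lemma continuousOn_canonicalVar (ν x₁ : ℝ) (hq : 0 < q₀) (hr : 0 < r₀) (hτ₀ : 0 < τ₀) :
    ContinuousOn (canonicalVar ν q₀ r₀ x₁ τ₀) (Ioi 0) := fun _ hτ =>
  (hasDerivAt_canonicalVar ν x₁ hq hr hτ₀ hτ).continuousAt.continuousWithinAt

/-- The derivative is nonnegative but may vanish. If two values agreed, `x` would be constant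
between them, forcing `ω` and hence `ω'` to vanish on an interval. -/
lemma strictMonoOn_canonicalVar (ν x₁ : ℝ) (hq : 0 < q₀) (hr : 0 < r₀) (hτ₀ : 0 < τ₀) :
    StrictMonoOn (canonicalVar ν q₀ r₀ x₁ τ₀) (Ioi 0) := by
  have hmono : MonotoneOn (canonicalVar ν q₀ r₀ x₁ τ₀) (Ioi 0) := by
    refine monotoneOn_of_deriv_nonneg (convex_Ioi 0) (continuousOn_canonicalVar ν x₁ hq hr hτ₀)
      ?_ ?_
    · exact fun τ hτ => (hasDerivAt_canonicalVar ν x₁ hq hr hτ₀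
        (interior_subset hτ)).differentiableAt.differentiableWithinAt
    · intro τ hτ
      rw [(hasDerivAt_canonicalVar ν x₁ hq hr hτ₀ (interior_subset hτ)).deriv]
      positivity
  intro τ₁ h₁ τ₂ h₂ hlt
  refine (hmono h₁ h₂ hlt.le).lt_of_ne fun heq => ?_
  have hpos : ∀ τ ∈ Ioo τ₁ τ₂, 0 < τ := fun τ hτ => (mem_Ioi.1 h₁).trans hτ.1
  have hconst : ∀ τ ∈ Ioo τ₁ τ₂, canonicalVar ν q₀ r₀ x₁ τ₀ τ = canonicalVar ν q₀ r₀ x₁ τ₀ τ₁ :=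
    fun τ hτ => le_antisymm (heq ▸ hmono (hpos τ hτ) h₂ hτ.2.le) (hmono h₁ (hpos τ hτ) hτ.1.le)
  have hzero : ∀ τ ∈ Ioo τ₁ τ₂, omegaOf ν q₀ r₀ τ = 0 := by
    intro τ hτ
    have h1 : HasDerivAt (canonicalVar ν q₀ r₀ x₁ τ₀) 0 τ := by
      refine (hasDerivAt_const τ (canonicalVar ν q₀ r₀ x₁ τ₀ τ₁)).congr_of_eventuallyEq ?_
      filter_upwards [isOpen_Ioo.mem_nhds hτ] with σ hσ using hconst σ hσ
    have h2 := h1.unique (hasDerivAt_canonicalVar ν x₁ hq hr hτ₀ (hpos τ hτ))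
    rw [eq_comm, div_eq_zero_iff] at h2
    exact pow_eq_zero_iff two_ne_zero |>.1 (h2.resolve_right hr.ne')
  obtain ⟨τ, hτ⟩ := nonempty_Ioo.2 hlt
  rcases omegaOf_ne_zero_or ν hq hr (hpos τ hτ) with h | h
  · exact h (hzero τ hτ)
  · refine h ((hasDerivAt_omegaOf ν hq hr (hpos τ hτ)).unique ?_)
    refine (hasDerivAt_const τ (0 : ℝ)).congr_of_eventuallyEq ?_
    filter_upwards [isOpen_Ioo.mem_nhds hτ] with σ hσ using hzero σ hσ

/-! ### The inverse function `τ(x)` -/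

lemma schrodingerVar_canonicalVar (ν x₁ : ℝ) (hq : 0 < q₀) (hr : 0 < r₀) (hτ₀ : 0 < τ₀) {τ : ℝ}
    (hτ : 0 < τ) :
    schrodingerVar ν q₀ r₀ x₁ τ₀ (canonicalVar ν q₀ r₀ x₁ τ₀ τ) = τ :=
  (strictMonoOn_canonicalVar ν x₁ hq hr hτ₀).injOn.leftInvOn_invFunOn hτ

lemma exists_canonicalVar_eq (ν x₁ : ℝ) (hq : 0 < q₀) (hr : 0 < r₀) (hτ₀ : 0 < τ₀) {σ τ x : ℝ}
    (hσ : 0 < σ) (hστ : σ ≤ τ)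
    (hx : x ∈ Icc (canonicalVar ν q₀ r₀ x₁ τ₀ σ) (canonicalVar ν q₀ r₀ x₁ τ₀ τ)) :
    ∃ ρ ∈ Icc σ τ, canonicalVar ν q₀ r₀ x₁ τ₀ ρ = x :=
  intermediate_value_Icc hστ ((continuousOn_canonicalVar ν x₁ hq hr hτ₀).mono
    fun _ hs => hσ.trans_le hs.1) hx

lemma eventually_nhds_canonicalVar (ν x₁ : ℝ) (hq : 0 < q₀) (hr : 0 < r₀) (hτ₀ : 0 < τ₀) {τ : ℝ}
    (hτ : 0 < τ) : canonicalVar ν q₀ r₀ x₁ τ₀ '' Ioi 0 ∈ 𝓝 (canonicalVar ν q₀ r₀ x₁ τ₀ τ) := by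
  have hmono := strictMonoOn_canonicalVar ν x₁ hq hr hτ₀
  have h1 : canonicalVar ν q₀ r₀ x₁ τ₀ (τ / 2) < canonicalVar ν q₀ r₀ x₁ τ₀ τ :=
    hmono (mem_Ioi.2 (by linarith)) hτ (by linarith)
  have h2 : canonicalVar ν q₀ r₀ x₁ τ₀ τ < canonicalVar ν q₀ r₀ x₁ τ₀ (2 * τ) :=
    hmono hτ (mem_Ioi.2 (by linarith)) (by linarith)
  refine mem_of_superset (Icc_mem_nhds h1 h2) fun x hx => ?_
  obtain ⟨ρ, hρ, hρx⟩ := exists_canonicalVar_eq ν x₁ hq hr hτ₀ (by linarith) (by linarith) hx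
  exact ⟨ρ, (by linarith : 0 < τ / 2).trans_le hρ.1, hρx⟩

lemma strictMonoOn_schrodingerVar (ν x₁ : ℝ) (hq : 0 < q₀) (hr : 0 < r₀) (hτ₀ : 0 < τ₀) :
    StrictMonoOn (schrodingerVar ν q₀ r₀ x₁ τ₀) (canonicalVar ν q₀ r₀ x₁ τ₀ '' Ioi 0) := by
  rintro _ ⟨σ, hσ, rfl⟩ _ ⟨τ, hτ, rfl⟩ h
  rw [schrodingerVar_canonicalVar ν x₁ hq hr hτ₀ hσ, schrodingerVar_canonicalVar ν x₁ hq hr hτ₀ hτ]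
  exact ((strictMonoOn_canonicalVar ν x₁ hq hr hτ₀).lt_iff_lt hσ hτ).1 h

lemma continuousAt_schrodingerVar (ν x₁ : ℝ) (hq : 0 < q₀) (hr : 0 < r₀) (hτ₀ : 0 < τ₀) {τ : ℝ}
    (hτ : 0 < τ) :
    ContinuousAt (schrodingerVar ν q₀ r₀ x₁ τ₀) (canonicalVar ν q₀ r₀ x₁ τ₀ τ) := by
  refine (strictMonoOn_schrodingerVar ν x₁ hq hr hτ₀).continuousAt_of_image_mem_nhds
    (eventually_nhds_canonicalVar ν x₁ hq hr hτ₀ hτ) ?_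
  rw [schrodingerVar_canonicalVar ν x₁ hq hr hτ₀ hτ]
  refine mem_of_superset (Ioi_mem_nhds hτ) fun σ hσ => ?_
  exact ⟨_, ⟨σ, hσ, rfl⟩, schrodingerVar_canonicalVar ν x₁ hq hr hτ₀ hσ⟩

lemma hasDerivAt_schrodingerVar (ν x₁ : ℝ) (hq : 0 < q₀) (hr : 0 < r₀) (hτ₀ : 0 < τ₀) {τ : ℝ}
    (hτ : 0 < τ) (hw : omegaOf ν q₀ r₀ τ ≠ 0) :
    HasDerivAt (schrodingerVar ν q₀ r₀ x₁ τ₀) (omegaOf ν q₀ r₀ τ ^ 2 / r₀)⁻¹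
      (canonicalVar ν q₀ r₀ x₁ τ₀ τ) := by
  refine HasDerivAt.of_local_left_inverse (f := canonicalVar ν q₀ r₀ x₁ τ₀)
    (continuousAt_schrodingerVar ν x₁ hq hr hτ₀ hτ) ?_ (by positivity) ?_
  · rw [schrodingerVar_canonicalVar ν x₁ hq hr hτ₀ hτ]
    exact hasDerivAt_canonicalVar ν x₁ hq hr hτ₀ hτ
  · filter_upwards [eventually_nhds_canonicalVar ν x₁ hq hr hτ₀ hτ] with y hy
    obtain ⟨σ, hσ, rfl⟩ := hy
    rw [schrodingerVar_canonicalVar ν x₁ hq hr hτ₀ hσ]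

/-! ### Asymptotics of the canonical variable -/

lemma integral_mul_besselY_sq_isBigO (ν : ℝ) (hτ₀ : 0 < τ₀) :
    (fun s : ℝ => (∫ σ in τ₀..s, σ * besselY ν σ ^ 2) - s / π) =O[atTop] (fun _ => (1 : ℝ)) := by
  refine ((isRadialSolution_omegaBar' ν).integral_sq_isBigO hτ₀ (hasBesselAmplitude ν)).congr' ?_
    EventuallyEq.rfl
  filter_upwards [eventually_ge_atTop τ₀] with s hs
  congr 1
  · refine intervalIntegral.integral_congr fun σ hσ => ?_
    rw [uIcc_of_le hs] at hσ
    simp only [omegaBar, mul_pow]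
    rw [sq_sqrt (hτ₀.le.trans hσ.1)]
  · ring

/-- Substituting `σ = c s` in the mean-square estimate produces `c⁻¹ · cτ/π`, so the scale `c` drops
out of the leading term. -/
lemma canonicalVar_isBigO (ν x₁ : ℝ) (hq : 0 < q₀) (hr : 0 < r₀) (hτ₀ : 0 < τ₀) :
    (fun τ : ℝ => canonicalVar ν q₀ r₀ x₁ τ₀ τ - (-x₁ + τ / (π * r₀)))
      =O[atTop] (fun _ => (1 : ℝ)) := by
  have hc := scale_pos hq hr
  set c := √(|q₀| / |r₀|) with hcdef
  have h := ((isRadialSolution_omegaBar' ν).integral_sq_isBigO (mul_pos hc hτ₀)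
    (hasBesselAmplitude ν)).comp_tendsto (tendsto_id.const_mul_atTop hc)
  refine (h.const_mul_left (c⁻¹ / r₀)).congr' (Eventually.of_forall fun τ => ?_) EventuallyEq.rfl
  have h1 := intervalIntegral.integral_comp_mul_left (a := τ₀) (b := τ)
    (fun s => omegaBar ν s ^ 2) hc.ne'
  simp only [Function.comp, id]
  rw [canonicalVar_eq ν q₀ x₁ τ₀ τ hr, intervalIntegral.integral_div]
  have h2 : ∫ s in τ₀..τ, omegaOf ν q₀ r₀ s ^ 2 = c⁻¹ * ∫ s in (c * τ₀)..(c * τ), omegaBar ν s ^ 2 := by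
    rw [← smul_eq_mul, ← h1]
    rfl
  rw [h2]
  field_simp
  ring

lemma tendsto_canonicalVar_atTop (ν x₁ : ℝ) (hq : 0 < q₀) (hr : 0 < r₀) (hτ₀ : 0 < τ₀) :
    Tendsto (canonicalVar ν q₀ r₀ x₁ τ₀) atTop atTop := by
  obtain ⟨C, hC⟩ := (canonicalVar_isBigO ν x₁ hq hr hτ₀).bound
  have h1 : Tendsto (fun τ : ℝ => -x₁ + τ / (π * r₀) - C) atTop atTop :=
    tendsto_atTop_add_const_right _ _ (tendsto_atTop_add_const_left _ _
      (tendsto_id.atTop_div_const (by positivity)))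
  refine tendsto_atTop_mono' _ ?_ h1
  filter_upwards [hC] with τ hτ
  rw [norm_one, mul_one] at hτ
  have := (abs_le.1 hτ).1
  linarith

lemma eventually_canonicalVar_schrodingerVar (ν x₁ : ℝ) (hq : 0 < q₀) (hr : 0 < r₀)
    (hτ₀ : 0 < τ₀) {T : ℝ} (hT : 0 < T) : ∀ᶠ x in atTop,
    T ≤ schrodingerVar ν q₀ r₀ x₁ τ₀ x ∧
      canonicalVar ν q₀ r₀ x₁ τ₀ (schrodingerVar ν q₀ r₀ x₁ τ₀ x) = x := by
  filter_upwards [eventually_ge_atTop (canonicalVar ν q₀ r₀ x₁ τ₀ T)] with x hx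
  obtain ⟨τ, hτT, hτ⟩ := ((eventually_ge_atTop T).and
    ((tendsto_canonicalVar_atTop ν x₁ hq hr hτ₀).eventually_ge_atTop x)).exists
  obtain ⟨ρ, hρ, rfl⟩ := exists_canonicalVar_eq ν x₁ hq hr hτ₀ hT hτT ⟨hx, hτ⟩
  rw [schrodingerVar_canonicalVar ν x₁ hq hr hτ₀ (hT.trans_le hρ.1)]
  exact ⟨hρ.1, rfl⟩

lemma schrodingerVar_isBigO (ν x₁ : ℝ) (hq : 0 < q₀) (hr : 0 < r₀) (hτ₀ : 0 < τ₀) :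
    (fun x : ℝ => schrodingerVar ν q₀ r₀ x₁ τ₀ x - π * r₀ * (x + x₁))
      =O[atTop] (fun _ => (1 : ℝ)) := by
  have hlim : Tendsto (schrodingerVar ν q₀ r₀ x₁ τ₀) atTop atTop := by
    refine tendsto_atTop.2 fun T => ?_
    filter_upwards [eventually_canonicalVar_schrodingerVar ν x₁ hq hr hτ₀
      (T := max T 1) (by positivity)] with x hx using (le_max_left _ _).trans hx.1
  -- Insert `τ = τ(x)` in the expansion of `x(τ)` and multiply by `−π r₀`; the error stays `O(1)`
  -- because the leading term is linear.
  refine (((canonicalVar_isBigO ν x₁ hq hr hτ₀).comp_tendsto hlim).const_mul_left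
    (-(π * r₀))).congr' ?_ EventuallyEq.rfl
  filter_upwards [eventually_canonicalVar_schrodingerVar ν x₁ hq hr hτ₀ one_pos] with x hx
  simp only [Function.comp]
  rw [hx.2]
  have := pi_pos
  field_simp
  ring

lemma schrodingerVar_isEquivalent (ν x₁ : ℝ) (hq : 0 < q₀) (hr : 0 < r₀) (hτ₀ : 0 < τ₀) :
    schrodingerVar ν q₀ r₀ x₁ τ₀ ~[atTop] (fun x : ℝ => π * r₀ * (x + x₁)) := by
  refine (schrodingerVar_isBigO ν x₁ hq hr hτ₀).trans_isLittleO ?_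
  rw [isLittleO_const_left]
  right
  exact tendsto_norm_atTop_atTop.comp (Tendsto.const_mul_atTop (by positivity)
    (tendsto_atTop_add_const_right _ x₁ tendsto_id))

end

/-! ### The Liouville transformation -/

lemma paineProblem_equationAt_iff (k m lam : ℝ) (v : ℝ → ℝ) (t : ℝ) :
    (paineProblem k m).EquationAt lam v t ↔ DifferentiableAt ℝ v t ∧
      DifferentiableAt ℝ (deriv v) t ∧ deriv (deriv v) t = (k / (t + m) ^ 2 - lam) * v t := by
  simp only [SturmLiouville.EquationAt, paineProblem, one_mul]
  refine and_congr_right fun _ => and_congr_right fun _ => ⟨fun h => ?_, fun h => ?_⟩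
  · linear_combination -h
  · linear_combination -h

section

variable {ν q₀ r₀ x₁ τ₀ m t lam : ℝ} {u v : ℝ → ℝ}

/-- Transports local statements from `t` to `x`; continuity of the inverse is enough, so zeros of
`ω` need no exclusion here. -/
lemma eventually_nhds_canonicalVar_add {P : ℝ → Prop} (hq : 0 < q₀) (hr : 0 < r₀)
    (hτ₀ : 0 < τ₀) (ht : 0 < t + m)
    (h : ∀ᶠ s in 𝓝 t, P (canonicalVar ν q₀ r₀ x₁ τ₀ (s + m))) :
    ∀ᶠ y in 𝓝 (canonicalVar ν q₀ r₀ x₁ τ₀ (t + m)), P y := by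
  have hS := Tendsto.sub_const (continuousAt_schrodingerVar ν x₁ hq hr hτ₀ ht) m
  have hS' : Tendsto (fun y => schrodingerVar ν q₀ r₀ x₁ τ₀ y - m)
      (𝓝 (canonicalVar ν q₀ r₀ x₁ τ₀ (t + m))) (𝓝 t) := by
    rwa [schrodingerVar_canonicalVar ν x₁ hq hr hτ₀ ht, add_sub_cancel_right] at hS
  filter_upwards [hS'.eventually h, eventually_nhds_canonicalVar ν x₁ hq hr hτ₀ ht] with y hy hy'
  obtain ⟨σ, hσ, rfl⟩ := hy'
  rwa [schrodingerVar_canonicalVar ν x₁ hq hr hτ₀ hσ, sub_add_cancel] at hy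

lemma hasDerivAt_canonicalVar_add (ν x₁ : ℝ) (hq : 0 < q₀) (hr : 0 < r₀) (hτ₀ : 0 < τ₀)
    (ht : 0 < t + m) : HasDerivAt (fun s => canonicalVar ν q₀ r₀ x₁ τ₀ (s + m))
      (omegaOf ν q₀ r₀ (t + m) ^ 2 / r₀) t := by
  have := (hasDerivAt_canonicalVar ν x₁ hq hr hτ₀ ht).comp_add_const t m
  exact this

lemma hasDerivAt_omegaOf_add (ν : ℝ) (hq : 0 < q₀) (hr : 0 < r₀) (ht : 0 < t + m) :
    HasDerivAt (fun s => omegaOf ν q₀ r₀ (s + m)) (omegaOfDeriv ν q₀ r₀ (t + m)) t :=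
  (hasDerivAt_omegaOf ν hq hr ht).comp_add_const t m

lemma hasDerivAt_omegaOfDeriv_add (ν : ℝ) (hq : 0 < q₀) (hr : 0 < r₀) (ht : 0 < t + m) :
    HasDerivAt (fun s => omegaOfDeriv ν q₀ r₀ (s + m))
      (((ν ^ 2 - 1 / 4) / (t + m) ^ 2 - q₀ / r₀) * omegaOf ν q₀ r₀ (t + m)) t :=
  (hasDerivAt_omegaOfDeriv ν hq hr ht).comp_add_const t m

lemma eventually_omegaOf_add_ne_zero (hq : 0 < q₀) (hr : 0 < r₀) (ht : 0 < t + m)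
    (hw : omegaOf ν q₀ r₀ (t + m) ≠ 0) : ∀ᶠ s in 𝓝 t, 0 < s + m ∧ omegaOf ν q₀ r₀ (s + m) ≠ 0 :=
  ((continuous_add_const m).continuousAt.eventually (lt_mem_nhds ht)).and
    ((hasDerivAt_omegaOf_add ν hq hr ht).continuousAt.eventually_ne hw)

lemma hasDerivAt_schrodingerVar_sub (hq : 0 < q₀) (hr : 0 < r₀) (hτ₀ : 0 < τ₀)
    (ht : 0 < t + m) (hw : omegaOf ν q₀ r₀ (t + m) ≠ 0) {g : ℝ → ℝ} {g' : ℝ}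
    (hg : HasDerivAt g g' t) :
    HasDerivAt (fun y => g (schrodingerVar ν q₀ r₀ x₁ τ₀ y - m))
      (g' * (omegaOf ν q₀ r₀ (t + m) ^ 2 / r₀)⁻¹) (canonicalVar ν q₀ r₀ x₁ τ₀ (t + m)) := by
  have hS := (hasDerivAt_schrodingerVar ν x₁ hq hr hτ₀ ht hw).sub_const m
  have he : t = schrodingerVar ν q₀ r₀ x₁ τ₀ (canonicalVar ν q₀ r₀ x₁ τ₀ (t + m)) - m := by
    rw [schrodingerVar_canonicalVar ν x₁ hq hr hτ₀ ht, add_sub_cancel_right]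
  exact hg.comp_of_eq _ hS he

/-- The transformed function is differentiable, and `p u' = v' / w - v (1 / w)'`. -/
lemma hasDerivAt_transformed (hq : 0 < q₀) (hr : 0 < r₀) (hτ₀ : 0 < τ₀)
    (ht : 0 < t + m) (hw : omegaOf ν q₀ r₀ (t + m) ≠ 0)
    (huv : ∀ᶠ s in 𝓝 t, u (canonicalVar ν q₀ r₀ x₁ τ₀ (s + m)) = (omegaOf ν q₀ r₀ (s + m))⁻¹ * v s)
    (hv : DifferentiableAt ℝ v t) :
    DifferentiableAt ℝ u (canonicalVar ν q₀ r₀ x₁ τ₀ (t + m)) ∧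
    (exactCanonicalForm ν q₀ r₀ x₁ τ₀ m).p (canonicalVar ν q₀ r₀ x₁ τ₀ (t + m)) *
      deriv u (canonicalVar ν q₀ r₀ x₁ τ₀ (t + m)) =
      deriv v t * omegaOf ν q₀ r₀ (t + m) - v t * omegaOfDeriv ν q₀ r₀ (t + m) := by
  have h1 : ∀ᶠ y in 𝓝 (canonicalVar ν q₀ r₀ x₁ τ₀ (t + m)),
      u y = (fun s => (omegaOf ν q₀ r₀ (s + m))⁻¹ * v s) (schrodingerVar ν q₀ r₀ x₁ τ₀ y - m) := by
    refine eventually_nhds_canonicalVar_add hq hr hτ₀ ht ?_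
    filter_upwards [huv, eventually_omegaOf_add_ne_zero hq hr ht hw] with s hs hs'
    rw [hs, schrodingerVar_canonicalVar ν x₁ hq hr hτ₀ hs'.1, add_sub_cancel_right]
  have h2 := ((hasDerivAt_omegaOf_add ν hq hr ht).inv hw).mul hv.hasDerivAt
  have h3 := (hasDerivAt_schrodingerVar_sub (x₁ := x₁) hq hr hτ₀ ht hw h2).congr_of_eventuallyEq h1
  refine ⟨h3.differentiableAt, ?_⟩
  rw [h3.deriv]
  simp only [exactCanonicalForm, pOfTau, schrodingerVar_canonicalVar ν x₁ hq hr hτ₀ ht,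
    Pi.inv_apply]
  field_simp
  ring

/-- In the Wronskian `v'ω − vω'` the potential `k/τ²` cancels on differentiation, leaving the
constants `q₀` and `r₀` only. -/
lemma exactCanonicalForm_equationAt (hq : 0 < q₀) (hr : 0 < r₀) (hτ₀ : 0 < τ₀)
    (ht : 0 < t + m) (hw : omegaOf ν q₀ r₀ (t + m) ≠ 0)
    (huv : ∀ᶠ s in 𝓝 t, u (canonicalVar ν q₀ r₀ x₁ τ₀ (s + m)) = (omegaOf ν q₀ r₀ (s + m))⁻¹ * v s)
    (hv : ∀ᶠ s in 𝓝 t, (paineProblem (ν ^ 2 - 1 / 4) m).EquationAt lam v s) :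
    (exactCanonicalForm ν q₀ r₀ x₁ τ₀ m).EquationAt lam u
      (canonicalVar ν q₀ r₀ x₁ τ₀ (t + m)) := by
  simp only [paineProblem_equationAt_iff] at hv
  obtain ⟨hv1, hv2, hv3⟩ := hv.self_of_nhds
  have h1 : ∀ᶠ y in 𝓝 (canonicalVar ν q₀ r₀ x₁ τ₀ (t + m)),
      (exactCanonicalForm ν q₀ r₀ x₁ τ₀ m).p y * deriv u y =
        (fun s => deriv v s * omegaOf ν q₀ r₀ (s + m) - v s * omegaOfDeriv ν q₀ r₀ (s + m))
          (schrodingerVar ν q₀ r₀ x₁ τ₀ y - m) := by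
    refine eventually_nhds_canonicalVar_add hq hr hτ₀ ht ?_
    filter_upwards [huv.eventually_nhds, hv, eventually_omegaOf_add_ne_zero hq hr ht hw]
      with s hs hs' hs''
    rw [(hasDerivAt_transformed hq hr hτ₀ hs''.1 hs''.2 hs hs'.1).2,
      schrodingerVar_canonicalVar ν x₁ hq hr hτ₀ hs''.1, add_sub_cancel_right]
  have h2 := (hv2.hasDerivAt.mul (hasDerivAt_omegaOf_add ν hq hr ht)).sub
    (hv1.hasDerivAt.mul (hasDerivAt_omegaOfDeriv_add ν hq hr ht))
  have h3 := (hasDerivAt_schrodingerVar_sub (x₁ := x₁) hq hr hτ₀ ht hw h2).congr_of_eventuallyEq h1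
  refine ⟨(hasDerivAt_transformed hq hr hτ₀ ht hw huv hv1).1, h3.differentiableAt, ?_⟩
  rw [h3.deriv, hv3, huv.self_of_nhds]
  simp only [exactCanonicalForm]
  have : t + m ≠ 0 := ht.ne'
  field_simp
  ring

/-- Converse of the transformation: `v' = (1 / w)' u + w p u'`. -/
lemma hasDerivAt_of_transformed (hq : 0 < q₀) (hr : 0 < r₀) (hτ₀ : 0 < τ₀)
    (ht : 0 < t + m) (hw : omegaOf ν q₀ r₀ (t + m) ≠ 0)
    (huv : ∀ᶠ s in 𝓝 t, u (canonicalVar ν q₀ r₀ x₁ τ₀ (s + m)) = (omegaOf ν q₀ r₀ (s + m))⁻¹ * v s)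
    (hu : DifferentiableAt ℝ u (canonicalVar ν q₀ r₀ x₁ τ₀ (t + m))) :
    HasDerivAt v (omegaOfDeriv ν q₀ r₀ (t + m) * u (canonicalVar ν q₀ r₀ x₁ τ₀ (t + m))
      + (omegaOf ν q₀ r₀ (t + m))⁻¹ * ((exactCanonicalForm ν q₀ r₀ x₁ τ₀ m).p
        (canonicalVar ν q₀ r₀ x₁ τ₀ (t + m)) * deriv u (canonicalVar ν q₀ r₀ x₁ τ₀ (t + m)))) t := by
  have h1 := (hasDerivAt_omegaOf_add ν hq hr ht).mul
    (hu.hasDerivAt.comp t (hasDerivAt_canonicalVar_add ν x₁ hq hr hτ₀ ht))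
  have h2 : v =ᶠ[𝓝 t] fun s => omegaOf ν q₀ r₀ (s + m) * u (canonicalVar ν q₀ r₀ x₁ τ₀ (s + m)) := by
    filter_upwards [huv, eventually_omegaOf_add_ne_zero hq hr ht hw] with s hs hs'
    rw [hs, mul_inv_cancel_left₀ hs'.2]
  refine (h1.congr_of_eventuallyEq h2).congr_deriv ?_
  simp only [exactCanonicalForm, pOfTau, schrodingerVar_canonicalVar ν x₁ hq hr hτ₀ ht,
    Function.comp]
  field_simp

/-- Differentiate `v' = ω'u + ω⁻¹ (p u')`: the two terms containing `u'` cancel because `p = ω⁴/r₀`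
and `dx/dt = ω²/r₀`. -/
lemma paineProblem_equationAt (hq : 0 < q₀) (hr : 0 < r₀) (hτ₀ : 0 < τ₀)
    (ht : 0 < t + m) (hw : omegaOf ν q₀ r₀ (t + m) ≠ 0)
    (huv : ∀ᶠ s in 𝓝 t, u (canonicalVar ν q₀ r₀ x₁ τ₀ (s + m)) = (omegaOf ν q₀ r₀ (s + m))⁻¹ * v s)
    (hu : ∀ᶠ s in 𝓝 t, (exactCanonicalForm ν q₀ r₀ x₁ τ₀ m).EquationAt lam u
      (canonicalVar ν q₀ r₀ x₁ τ₀ (s + m))) :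
    (paineProblem (ν ^ 2 - 1 / 4) m).EquationAt lam v t := by
  obtain ⟨hu1, hu2, hu3⟩ := hu.self_of_nhds
  rw [paineProblem_equationAt_iff]
  have h1 : deriv v =ᶠ[𝓝 t] fun s =>
      omegaOfDeriv ν q₀ r₀ (s + m) * u (canonicalVar ν q₀ r₀ x₁ τ₀ (s + m))
      + (omegaOf ν q₀ r₀ (s + m))⁻¹ * ((exactCanonicalForm ν q₀ r₀ x₁ τ₀ m).p
        (canonicalVar ν q₀ r₀ x₁ τ₀ (s + m)) * deriv u (canonicalVar ν q₀ r₀ x₁ τ₀ (s + m))) := by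
    filter_upwards [huv.eventually_nhds, hu, eventually_omegaOf_add_ne_zero hq hr ht hw]
      with s hs hs' hs''
    exact (hasDerivAt_of_transformed hq hr hτ₀ hs''.1 hs''.2 hs hs'.1).deriv
  have hX := hasDerivAt_canonicalVar_add ν x₁ hq hr hτ₀ ht
  have h2 := ((hasDerivAt_omegaOfDeriv_add ν hq hr ht).mul (hu1.hasDerivAt.comp t hX)).add
    (((hasDerivAt_omegaOf_add ν hq hr ht).inv hw).mul (hu2.hasDerivAt.comp t hX))
  have h3 := h2.congr_of_eventuallyEq h1
  refine ⟨(hasDerivAt_of_transformed hq hr hτ₀ ht hw huv hu1).differentiableAt,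
    h3.differentiableAt, ?_⟩
  have hvt : v t = omegaOf ν q₀ r₀ (t + m) * u (canonicalVar ν q₀ r₀ x₁ τ₀ (t + m)) := by
    rw [huv.self_of_nhds, mul_inv_cancel_left₀ hw]
  have hu4 : deriv (fun y => (exactCanonicalForm ν q₀ r₀ x₁ τ₀ m).p y * deriv u y)
      (canonicalVar ν q₀ r₀ x₁ τ₀ (t + m))
      = (q₀ - lam * r₀) * u (canonicalVar ν q₀ r₀ x₁ τ₀ (t + m)) := by
    have : (exactCanonicalForm ν q₀ r₀ x₁ τ₀ m).q (canonicalVar ν q₀ r₀ x₁ τ₀ (t + m)) = q₀ := rfl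
    have : (exactCanonicalForm ν q₀ r₀ x₁ τ₀ m).r (canonicalVar ν q₀ r₀ x₁ τ₀ (t + m)) = r₀ := rfl
    simp_all only
    linear_combination -hu3
  rw [h3.deriv, hu4, hvt]
  simp only [exactCanonicalForm, pOfTau, schrodingerVar_canonicalVar ν x₁ hq hr hτ₀ ht,
    Function.comp, Pi.inv_apply]
  have : t + m ≠ 0 := ht.ne'
  field_simp
  ring

/-- At a zero of `1 / w` the equation follows by continuity. -/
lemma paineProblem_equationAt_of_zero (hq : 0 < q₀) (hr : 0 < r₀)
    (ht : 0 < t + m) (hw : omegaOf ν q₀ r₀ (t + m) = 0) {k : ℝ}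
    (hv : DifferentiableAt ℝ v t) (hv' : DifferentiableAt ℝ (deriv v) t)
    (h : ∀ᶠ s in 𝓝 t, omegaOf ν q₀ r₀ (s + m) ≠ 0 → (paineProblem k m).EquationAt lam v s) :
    (paineProblem k m).EquationAt lam v t := by
  rw [paineProblem_equationAt_iff]
  refine ⟨hv, hv', ?_⟩
  -- The zero is simple, hence isolated.
  have hne : ∀ᶠ s in 𝓝[≠] t, omegaOf ν q₀ r₀ (s + m) ≠ 0 :=
    (hasDerivAt_omegaOf_add ν hq hr ht).eventually_ne
      ((omegaOf_ne_zero_or ν hq hr ht).resolve_left (not_not.2 hw))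
  have heq : ∀ᶠ s in 𝓝[>] t, (paineProblem k m).EquationAt lam v s := by
    filter_upwards [nhdsWithin_mono t (fun s (hs : t < s) => hs.ne') hne,
      nhdsWithin_le_nhds h] with s hs hs' using hs' hs
  simp only [paineProblem_equationAt_iff] at heq
  obtain ⟨b, hb, hb'⟩ := (mem_nhdsGT_iff_exists_Ioo_subset).1 heq
  have hlim : Tendsto (deriv (deriv v)) (𝓝[>] t) (𝓝 ((k / (t + m) ^ 2 - lam) * v t)) := by
    have hc : ContinuousAt (fun s => (k / (s + m) ^ 2 - lam) * v s) t := by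
      refine ContinuousAt.mul (ContinuousAt.sub (ContinuousAt.div continuousAt_const (by fun_prop)
        (by positivity)) continuousAt_const) hv.continuousAt
    refine (hc.tendsto.mono_left nhdsWithin_le_nhds).congr' ?_
    filter_upwards [heq] with s hs using hs.2.2.symm
  -- The right limit of `v''` is a right derivative of `v'`; since `v'` is differentiable at `t` by
  -- hypothesis, it is the derivative.
  have h1 : HasDerivWithinAt (deriv v) ((k / (t + m) ^ 2 - lam) * v t) (Ici t) t :=
    hasDerivWithinAt_Ici_of_tendsto_deriv (s := Ioo t b)
      (fun s hs => (hb' hs).2.1.differentiableWithinAt) hv'.continuousAt.continuousWithinAt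
      (Ioo_mem_nhdsGT hb) hlim
  exact (uniqueDiffWithinAt_Ici t).eq_deriv _ hv'.hasDerivAt.hasDerivWithinAt h1

lemma schrodingerVar_sub_mem_Icc (hq : 0 < q₀) (hr : 0 < r₀) (hτ₀ : 0 < τ₀) (hm : 0 < m) {x : ℝ}
    (hx : x ∈ Icc (canonicalVar ν q₀ r₀ x₁ τ₀ m) (canonicalVar ν q₀ r₀ x₁ τ₀ (π + m))) :
    ∃ s ∈ Icc 0 π, canonicalVar ν q₀ r₀ x₁ τ₀ (s + m) = x := by
  have := pi_pos
  obtain ⟨ρ, hρ, rfl⟩ := exists_canonicalVar_eq ν x₁ hq hr hτ₀ hm (by linarith) hx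
  exact ⟨ρ - m, ⟨by linarith [hρ.1], by linarith [hρ.2]⟩, by rw [sub_add_cancel]⟩

lemma canonicalVar_add_mem_Icc (hq : 0 < q₀) (hr : 0 < r₀) (hτ₀ : 0 < τ₀) (hm : 0 < m) {s : ℝ}
    (hs : s ∈ Icc 0 π) : canonicalVar ν q₀ r₀ x₁ τ₀ (s + m) ∈
      Icc (canonicalVar ν q₀ r₀ x₁ τ₀ m) (canonicalVar ν q₀ r₀ x₁ τ₀ (π + m)) := by
  have := pi_pos
  have hmono := (strictMonoOn_canonicalVar ν x₁ hq hr hτ₀).monotoneOn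
  have hs0 : 0 < s + m := by linarith [hs.1]
  exact ⟨hmono hm hs0 (by linarith [hs.1]),
    hmono hs0 (mem_Ioi.2 (by linarith)) (by linarith [hs.2])⟩

/-- Needed at the endpoints, where no equation supplies continuity; `ω`, its reciprocal and the
change of variable are continuous there in both directions. -/
lemma continuousWithinAt_transformed_iff (hq : 0 < q₀) (hr : 0 < r₀) (hτ₀ : 0 < τ₀) (hm : 0 < m)
    (huv : ∀ s ∈ Icc 0 π, omegaOf ν q₀ r₀ (s + m) ≠ 0 →
      u (canonicalVar ν q₀ r₀ x₁ τ₀ (s + m)) = (omegaOf ν q₀ r₀ (s + m))⁻¹ * v s)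
    (ht : t ∈ Icc 0 π) (hw : omegaOf ν q₀ r₀ (t + m) ≠ 0) :
    ContinuousWithinAt v (Icc 0 π) t ↔ ContinuousWithinAt u
      (Icc (canonicalVar ν q₀ r₀ x₁ τ₀ m) (canonicalVar ν q₀ r₀ x₁ τ₀ (π + m)))
      (canonicalVar ν q₀ r₀ x₁ τ₀ (t + m)) := by
  have ht0 : 0 < t + m := by linarith [ht.1]
  have hS0 := schrodingerVar_canonicalVar ν x₁ hq hr hτ₀ ht0
  have hev := eventually_omegaOf_add_ne_zero hq hr ht0 hw
  have hwc := (hasDerivAt_omegaOf_add ν hq hr ht0).continuousAt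
  constructor
  · intro hv
    have h1 : ContinuousWithinAt (fun s => (omegaOf ν q₀ r₀ (s + m))⁻¹ * v s) (Icc 0 π) t :=
      (hwc.inv₀ hw).continuousWithinAt.mul hv
    have he : t = schrodingerVar ν q₀ r₀ x₁ τ₀ (canonicalVar ν q₀ r₀ x₁ τ₀ (t + m)) - m := by
      rw [hS0, add_sub_cancel_right]
    rw [he] at h1
    have h2 := h1.comp (f := fun y => schrodingerVar ν q₀ r₀ x₁ τ₀ y - m)
      (s := Icc (canonicalVar ν q₀ r₀ x₁ τ₀ m) (canonicalVar ν q₀ r₀ x₁ τ₀ (π + m)))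
      (ContinuousAt.sub (continuousAt_schrodingerVar ν x₁ hq hr hτ₀ ht0)
        continuousAt_const).continuousWithinAt ?_
    · refine h2.congr_of_eventuallyEq ?_ ?_
      · have h3 := eventually_nhds_canonicalVar_add (x₁ := x₁)
          (P := fun y => omegaOf ν q₀ r₀ (schrodingerVar ν q₀ r₀ x₁ τ₀ y) ≠ 0) hq hr hτ₀ ht0
          (hev.mono fun s hs => by
            rw [schrodingerVar_canonicalVar ν x₁ hq hr hτ₀ hs.1]; exact hs.2)
        filter_upwards [nhdsWithin_le_nhds h3, self_mem_nhdsWithin] with y hy hyI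
        obtain ⟨s, hs, rfl⟩ := schrodingerVar_sub_mem_Icc hq hr hτ₀ hm hyI
        have hs0 : 0 < s + m := by linarith [hs.1]
        rw [schrodingerVar_canonicalVar ν x₁ hq hr hτ₀ hs0] at hy
        rw [huv s hs hy, Function.comp, schrodingerVar_canonicalVar ν x₁ hq hr hτ₀ hs0,
          add_sub_cancel_right]
      · rw [huv t ht hw, Function.comp, hS0, add_sub_cancel_right]
    · intro y hyI
      obtain ⟨s, hs, rfl⟩ := schrodingerVar_sub_mem_Icc hq hr hτ₀ hm hyI
      have hs0 : 0 < s + m := by linarith [hs.1]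
      simp only
      rwa [schrodingerVar_canonicalVar ν x₁ hq hr hτ₀ hs0, add_sub_cancel_right]
  · intro hu
    have h1 := hu.comp (f := fun s => canonicalVar ν q₀ r₀ x₁ τ₀ (s + m)) (s := Icc 0 π)
      (hasDerivAt_canonicalVar_add ν x₁ hq hr hτ₀ ht0).continuousAt.continuousWithinAt
      (fun s hs => canonicalVar_add_mem_Icc hq hr hτ₀ hm hs)
    refine (hwc.continuousWithinAt.mul h1).congr_of_eventuallyEq ?_ ?_
    · filter_upwards [nhdsWithin_le_nhds hev, self_mem_nhdsWithin] with s hs hsI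
      simp only [Function.comp, Pi.mul_apply]
      rw [huv s hsI hs.2, mul_inv_cancel_left₀ hs.2]
    · simp only [Function.comp, Pi.mul_apply]
      rw [huv t ht hw, mul_inv_cancel_left₀ hw]

/-- The Paine problem and its exact canonical form have the same solutions. -/
theorem paineProblem_isSolution_iff (hq : 0 < q₀) (hr : 0 < r₀) (hτ₀ : 0 < τ₀) (hm : 0 < m)
    (hw0 : omegaOf ν q₀ r₀ m ≠ 0) (hwπ : omegaOf ν q₀ r₀ (π + m) ≠ 0)
    (huv : ∀ s ∈ Icc 0 π, omegaOf ν q₀ r₀ (s + m) ≠ 0 →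
      u (canonicalVar ν q₀ r₀ x₁ τ₀ (s + m)) = (omegaOf ν q₀ r₀ (s + m))⁻¹ * v s)
    (hvz : ∀ s ∈ Ioo 0 π, omegaOf ν q₀ r₀ (s + m) = 0 →
      DifferentiableAt ℝ v s ∧ DifferentiableAt ℝ (deriv v) s) :
    (paineProblem (ν ^ 2 - 1 / 4) m).IsSolution lam v ↔
      (exactCanonicalForm ν q₀ r₀ x₁ τ₀ m).IsSolution lam u := by
  have hπ := pi_pos
  have h0I : (0 : ℝ) ∈ Icc 0 π := ⟨le_rfl, hπ.le⟩
  have hπI : π ∈ Icc 0 π := ⟨hπ.le, le_rfl⟩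
  have hnear : ∀ t ∈ Ioo 0 π, omegaOf ν q₀ r₀ (t + m) ≠ 0 → ∀ᶠ s in 𝓝 t,
      u (canonicalVar ν q₀ r₀ x₁ τ₀ (s + m)) = (omegaOf ν q₀ r₀ (s + m))⁻¹ * v s := by
    intro t ht hw
    filter_upwards [isOpen_Ioo.mem_nhds ht,
      eventually_omegaOf_add_ne_zero hq hr (by linarith [ht.1]) hw] with s hs hs'
      using huv s (Ioo_subset_Icc_self hs) hs'.2
  -- The points where the canonical equation is waived are exactly the zeros of `ω`.
  have hp : ∀ t, 0 < t + m →
      ((exactCanonicalForm ν q₀ r₀ x₁ τ₀ m).p (canonicalVar ν q₀ r₀ x₁ τ₀ (t + m)) ≠ 0 ↔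
        omegaOf ν q₀ r₀ (t + m) ≠ 0) := by
    intro t ht
    simp only [exactCanonicalForm, pOfTau, schrodingerVar_canonicalVar ν x₁ hq hr hτ₀ ht]
    simp [hr.ne']
  have heq : (∀ t ∈ Ioo 0 π, (paineProblem (ν ^ 2 - 1 / 4) m).EquationAt lam v t) ↔
      ∀ x ∈ Ioo (canonicalVar ν q₀ r₀ x₁ τ₀ m) (canonicalVar ν q₀ r₀ x₁ τ₀ (π + m)),
        (exactCanonicalForm ν q₀ r₀ x₁ τ₀ m).p x ≠ 0 →
          (exactCanonicalForm ν q₀ r₀ x₁ τ₀ m).EquationAt lam u x := by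
    have hmono := strictMonoOn_canonicalVar ν x₁ hq hr hτ₀
    constructor
    · intro h x hx hpx
      obtain ⟨s, hs, rfl⟩ := schrodingerVar_sub_mem_Icc hq hr hτ₀ hm (Ioo_subset_Icc_self hx)
      have hs0 : 0 < s + m := by linarith [hs.1]
      have h1 := (hmono.lt_iff_lt hm hs0).1 hx.1
      have h2 := (hmono.lt_iff_lt hs0 (mem_Ioi.2 (by linarith))).1 hx.2
      have hsI : s ∈ Ioo 0 π := ⟨by linarith, by linarith⟩
      have hw := (hp s hs0).1 hpx
      refine exactCanonicalForm_equationAt hq hr hτ₀ hs0 hw (hnear s hsI hw) ?_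
      filter_upwards [isOpen_Ioo.mem_nhds hsI] with r hr using h r hr
    · intro h
      have hreg : ∀ t ∈ Ioo 0 π, omegaOf ν q₀ r₀ (t + m) ≠ 0 →
          (paineProblem (ν ^ 2 - 1 / 4) m).EquationAt lam v t := by
        intro t ht hw
        have ht0 : 0 < t + m := by linarith [ht.1]
        refine paineProblem_equationAt hq hr hτ₀ ht0 hw (hnear t ht hw) ?_
        filter_upwards [isOpen_Ioo.mem_nhds ht, eventually_omegaOf_add_ne_zero hq hr ht0 hw]
          with s hs hs'
        exact h _ ⟨hmono hm hs'.1 (by linarith [hs.1]),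
          hmono hs'.1 (mem_Ioi.2 (by linarith)) (by linarith [hs.2])⟩ ((hp s hs'.1).2 hs'.2)
      intro t ht
      -- The Paine equation is required at the zeros of `ω` as well; this is the only use of the
      -- regularity assumed of `v` there.
      by_cases hw : omegaOf ν q₀ r₀ (t + m) = 0
      · obtain ⟨hv, hv'⟩ := hvz t ht hw
        refine paineProblem_equationAt_of_zero hq hr (by linarith [ht.1]) hw hv hv' ?_
        filter_upwards [isOpen_Ioo.mem_nhds ht] with s hs using hreg s hs
      · exact hreg t ht hw
  have hc0 := continuousWithinAt_transformed_iff hq hr hτ₀ hm huv h0I (by rwa [zero_add])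
  have hcπ := continuousWithinAt_transformed_iff hq hr hτ₀ hm huv hπI hwπ
  have hu0 := huv 0 h0I (by rwa [zero_add])
  rw [zero_add] at hc0 hu0
  have huπ := huv π hπI hwπ
  have hbc : (paineProblem (ν ^ 2 - 1 / 4) m).BoundaryConditions v ↔
      (exactCanonicalForm ν q₀ r₀ x₁ τ₀ m).BoundaryConditions u := by
    simp only [SturmLiouville.BoundaryConditions, paineProblem, exactCanonicalForm, zero_mul,
      sub_zero, one_mul, hu0, huπ]
    refine and_congr ?_ ?_ <;> simp [hw0, hwπ]
  rw [SturmLiouville.IsSolution, SturmLiouville.IsSolution]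
  refine and_congr ?_ (and_congr hc0 (and_congr hcπ hbc))
  refine Iff.trans ?_ heq
  exact ⟨fun h t ht => h t ht one_ne_zero, fun h t ht _ => h t ht⟩

end

/-! ### The asymptotic canonical form -/

section

variable {n q₀ r₀ x₁ τ₀ m : ℝ}

/-- The identity `√(q₀/r₀) · π r₀ = π √(q₀ r₀)` matches the arguments of `Y`. The sign of `x + x₁`
matters because `√s ^ 4 = s²` needs `s ≥ 0`. -/
lemma besselYCanonicalForm_p_eq (hq : 0 < q₀) (hr : 0 < r₀) {x : ℝ} (hx : 0 < x + x₁) :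
    (besselYCanonicalForm n q₀ r₀ x₁ m).p x = pOfTau (n / 2) q₀ r₀ (π * r₀ * (x + x₁)) := by
  have hscale : √(|q₀| / |r₀|) * (π * r₀ * (x + x₁)) = π * √|q₀ * r₀| * (x + x₁) := by
    rw [abs_of_pos hq, abs_of_pos hr, abs_of_pos (mul_pos hq hr), sqrt_div hq.le, sqrt_mul hq.le]
    have h : √r₀ * √r₀ = r₀ := mul_self_sqrt hr.le
    have h0 : √r₀ ≠ 0 := (sqrt_pos.2 hr).ne'
    field_simp
    linear_combination -h
  have hnn : 0 ≤ π * √|q₀ * r₀| * (x + x₁) := by have := pi_pos; positivity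
  have hsq : √|q₀ * r₀| ^ 2 = q₀ * r₀ := by
    rw [abs_of_pos (mul_pos hq hr), sq_sqrt (mul_pos hq hr).le]
  rw [pOfTau, omegaOf, hscale, omegaBar, mul_pow,
    show √(π * √|q₀ * r₀| * (x + x₁)) ^ 4 = (√(π * √|q₀ * r₀| * (x + x₁)) ^ 2) ^ 2 by ring,
    sq_sqrt hnn, mul_pow, mul_pow, hsq]
  simp only [besselYCanonicalForm]
  field_simp

lemma omegaOf_sq (ν : ℝ) {τ : ℝ} (hτ : 0 < τ) :
    omegaOf ν q₀ r₀ τ ^ 2 = √|q₀ / r₀| * τ * besselY ν (√|q₀ / r₀| * τ) ^ 2 := by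
  rw [omegaOf, omegaBar, ← abs_div, mul_pow, sq_sqrt (by positivity)]

lemma omegaOf_ne_zero (hq : 0 < q₀) (hr : 0 < r₀) {ν τ : ℝ} (hτ : 0 < τ)
    (h : besselY ν (√|q₀ / r₀| * τ) ≠ 0) : omegaOf ν q₀ r₀ τ ≠ 0 := by
  have hc := scale_pos hq hr
  rw [omegaOf, omegaBar]
  rw [abs_div] at h
  exact mul_ne_zero (sqrt_pos.2 (by positivity)).ne' h

/-- Writing each point as `x(τ)` turns `φ` into `τ ↦ −x₁ + τ/(π r₀)`, so `π r₀ (φ + x₁) = τ` and all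
the matching is exact. -/
lemma exactCanonicalForm_isReplacementOf (hq : 0 < q₀) (hr : 0 < r₀) (hτ₀ : 0 < τ₀)
    (hm : 0 < m) : (exactCanonicalForm (n / 2) q₀ r₀ x₁ τ₀ m).IsReplacementOf
      (besselYCanonicalForm n q₀ r₀ x₁ m)
      (fun x => -x₁ + schrodingerVar (n / 2) q₀ r₀ x₁ τ₀ x / (π * r₀)) := by
  have hπ := pi_pos
  have hS : ∀ {s : ℝ}, 0 < s →
      schrodingerVar (n / 2) q₀ r₀ x₁ τ₀ (canonicalVar (n / 2) q₀ r₀ x₁ τ₀ s) = s :=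
    fun hs => schrodingerVar_canonicalVar (n / 2) x₁ hq hr hτ₀ hs
  have hmem : ∀ x ∈ Icc (canonicalVar (n / 2) q₀ r₀ x₁ τ₀ m)
      (canonicalVar (n / 2) q₀ r₀ x₁ τ₀ (π + m)),
      ∃ s, 0 < s ∧ canonicalVar (n / 2) q₀ r₀ x₁ τ₀ s = x := fun x hx => by
    obtain ⟨ρ, hρ, h⟩ := exists_canonicalVar_eq (n / 2) x₁ hq hr hτ₀ hm (by linarith) hx
    exact ⟨ρ, hm.trans_le hρ.1, h⟩
  refine ⟨?_, ?_, ?_, ?_, ?_, omegaOf_sq _ hm, rfl, omegaOf_sq _ (by positivity), rfl⟩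
  · intro x hx
    obtain ⟨s, hs, rfl⟩ := hmem x hx
    exact (ContinuousAt.add continuousAt_const ((continuousAt_schrodingerVar (n / 2) x₁ hq hr hτ₀
      hs).div_const _)).continuousWithinAt
  · intro x hx y hy hxy
    obtain ⟨s, hs, rfl⟩ := hmem x hx
    obtain ⟨t, ht, rfl⟩ := hmem y hy
    have := strictMonoOn_schrodingerVar (n / 2) x₁ hq hr hτ₀ ⟨s, hs, rfl⟩ ⟨t, ht, rfl⟩ hxy
    simp only
    gcongr
  · simp only [exactCanonicalForm, besselYCanonicalForm]
    rw [hS hm]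
  · simp only [exactCanonicalForm, besselYCanonicalForm]
    rw [hS (by positivity)]
  · intro x hx
    obtain ⟨s, hs, rfl⟩ := hmem x hx
    refine ⟨?_, rfl, rfl⟩
    beta_reduce
    rw [hS hs, besselYCanonicalForm_p_eq hq hr (by rw [neg_add_cancel_comm]; positivity)]
    simp only [exactCanonicalForm]
    rw [hS hs]
    congr 1
    field_simp
    ring

end

/-! ### Derivatives in `deriv` form, and assembly of the theorem -/

lemma deriv_omegaBar (ν : ℝ) {s : ℝ} (hs : 0 < s) :
    deriv (omegaBar ν) =ᶠ[𝓝 s] omegaBarDeriv ν := by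
  filter_upwards [lt_mem_nhds hs] with r hr using (isRadialSolution_omegaBar' ν r hr).1.deriv

lemma deriv_omegaOf (ν : ℝ) {q₀ r₀ : ℝ} (hq : 0 < q₀) (hr : 0 < r₀) {τ : ℝ} (hτ : 0 < τ) :
    deriv (omegaOf ν q₀ r₀) =ᶠ[𝓝 τ] omegaOfDeriv ν q₀ r₀ := by
  filter_upwards [lt_mem_nhds hτ] with r hr' using (hasDerivAt_omegaOf ν hq hr hr').deriv

end

theorem mainTheorem9 (k n q₀ r₀ x₁ τ₀ : ℝ) (hk : -1 / 4 ≤ k) (hn : n = √(4 * k + 1))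
    (hq : 0 < q₀) (hr : 0 < r₀) (hτ₀ : 0 < τ₀) :
    -- `ω̄` solves the transformed Bessel equation
    (∀ s : ℝ, 0 < s →
      DifferentiableAt ℝ (omegaBar (n / 2)) s ∧
      DifferentiableAt ℝ (deriv (omegaBar (n / 2))) s ∧
      s ^ 2 * deriv (deriv (omegaBar (n / 2))) s + (s ^ 2 - k) * omegaBar (n / 2) s = 0) ∧
    -- hence `q₀ / r₀ + w (1 / w)''` is the invariant function `k / τ²`
    (∀ τ : ℝ, 0 < τ → omegaOf (n / 2) q₀ r₀ τ ≠ 0 →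
      q₀ / r₀ + (omegaOf (n / 2) q₀ r₀ τ)⁻¹ * deriv (deriv (omegaOf (n / 2) q₀ r₀)) τ
        = k / τ ^ 2) ∧
    -- the canonical variable is a strictly increasing function of `τ` with `dx/dτ = √(p/r)`
    (∀ τ : ℝ, 0 < τ → HasDerivAt (canonicalVar (n / 2) q₀ r₀ x₁ τ₀)
      (√(pOfTau (n / 2) q₀ r₀ τ / r₀)) τ) ∧
    StrictMonoOn (canonicalVar (n / 2) q₀ r₀ x₁ τ₀) (Ioi 0) ∧
    -- large-argument expansion, linear to leading order, of `∫ s Y² ds`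
    ((fun s : ℝ => (∫ σ in τ₀..s, σ * besselY (n / 2) σ ^ 2) - s / π)
      =O[atTop] (fun _ => (1 : ℝ))) ∧
    -- of the canonical variable, and of the inverse relation
    ((fun τ : ℝ => canonicalVar (n / 2) q₀ r₀ x₁ τ₀ τ - (-x₁ + τ / (π * r₀)))
      =O[atTop] (fun _ => (1 : ℝ))) ∧
    ((fun x : ℝ => schrodingerVar (n / 2) q₀ r₀ x₁ τ₀ x - π * r₀ * (x + x₁))
      =O[atTop] (fun _ => (1 : ℝ))) ∧
    (schrodingerVar (n / 2) q₀ r₀ x₁ τ₀ ~[atTop] (fun x : ℝ => π * r₀ * (x + x₁))) ∧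
    -- the leading-order substitution `τ = π r₀ (x + x₁)` in `p` gives the asserted coefficient
    (∀ x m : ℝ, 0 < x + x₁ →
      (besselYCanonicalForm n q₀ r₀ x₁ m).p x
        = pOfTau (n / 2) q₀ r₀ (π * r₀ * (x + x₁))) ∧
    ∀ m : ℝ, 0 < m →
      besselY (n / 2) (√|q₀ / r₀| * m) ≠ 0 →
      besselY (n / 2) (√|q₀ / r₀| * (π + m)) ≠ 0 →
      -- the Paine problem is, via `u = w v`, exactly the exact canonical form
      (∀ lam : ℝ, ∀ v u : ℝ → ℝ,
        (∀ t ∈ Icc 0 π, omegaOf (n / 2) q₀ r₀ (t + m) ≠ 0 →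
          u (canonicalVar (n / 2) q₀ r₀ x₁ τ₀ (t + m))
            = (omegaOf (n / 2) q₀ r₀ (t + m))⁻¹ * v t) →
        (∀ t ∈ Ioo 0 π, omegaOf (n / 2) q₀ r₀ (t + m) = 0 →
          DifferentiableAt ℝ v t ∧ DifferentiableAt ℝ (deriv v) t) →
        ((paineProblem k m).IsSolution lam v ↔
          (exactCanonicalForm (n / 2) q₀ r₀ x₁ τ₀ m).IsSolution lam u)) ∧
      -- which is the asserted form with `x` replaced by `φ x = -x₁ + τ(x) / (π r₀) = x + O(1)`
      (exactCanonicalForm (n / 2) q₀ r₀ x₁ τ₀ m).IsReplacementOf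
        (besselYCanonicalForm n q₀ r₀ x₁ m)
        (fun x => -x₁ + schrodingerVar (n / 2) q₀ r₀ x₁ τ₀ x / (π * r₀)) ∧
      -- and the boundary conditions of the asserted form are Dirichlet conditions
      (besselYCanonicalForm n q₀ r₀ x₁ m).δ₀ ≠ 0 ∧
      (besselYCanonicalForm n q₀ r₀ x₁ m).γ₀ ≠ 0 ∧
      (∀ u : ℝ → ℝ, (besselYCanonicalForm n q₀ r₀ x₁ m).BoundaryConditions u ↔
        u (-x₁ + m / (π * r₀)) = 0 ∧ u (-x₁ + (π + m) / (π * r₀)) = 0) := by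
  -- The bound `k ≥ −1/4` makes the square root in `n` genuine.
  have hk' : (n / 2) ^ 2 - 1 / 4 = k := by
    rw [hn, div_pow, sq_sqrt (by linarith)]; ring
  have hπ := pi_pos
  refine ⟨fun s hs => ?_, fun τ hτ hw => ?_, fun τ hτ => ?_,
    strictMonoOn_canonicalVar _ _ hq hr hτ₀, integral_mul_besselY_sq_isBigO _ hτ₀,
    canonicalVar_isBigO _ _ hq hr hτ₀, schrodingerVar_isBigO _ _ hq hr hτ₀,
    schrodingerVar_isEquivalent _ _ hq hr hτ₀,
    fun x m hx => besselYCanonicalForm_p_eq hq hr hx, fun m hm h0 h1 => ?_⟩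
  · have h1 := isRadialSolution_omegaBar' (n / 2) s hs
    have h2 := h1.2.congr_of_eventuallyEq (deriv_omegaBar (n / 2) hs)
    refine ⟨h1.1.differentiableAt, h2.differentiableAt, ?_⟩
    rw [h2.deriv, hk']
    field_simp
    ring
  · have h2 := (hasDerivAt_omegaOfDeriv (n / 2) hq hr hτ).congr_of_eventuallyEq
      (deriv_omegaOf (n / 2) hq hr hτ)
    rw [h2.deriv, hk']
    field_simp
    ring
  · rw [sqrt_pOfTau_div _ _ _ hr]
    exact hasDerivAt_canonicalVar _ _ hq hr hτ₀ hτ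
  · have hw0 := omegaOf_ne_zero hq hr hm h0
    have hwπ := omegaOf_ne_zero hq hr (by positivity) h1
    have hδ : (besselYCanonicalForm n q₀ r₀ x₁ m).δ₀ ≠ 0 := by
      -- The boundary constants of the two forms coincide, and the exact one is `ω²` at the
      -- endpoint.
      rw [← (exactCanonicalForm_isReplacementOf (x₁ := x₁) hq hr hτ₀ hm).2.2.2.2.2.1]
      exact pow_ne_zero 2 hw0
    have hγ : (besselYCanonicalForm n q₀ r₀ x₁ m).γ₀ ≠ 0 := by
      rw [← (exactCanonicalForm_isReplacementOf (x₁ := x₁) hq hr hτ₀ hm).2.2.2.2.2.2.2.1]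
      exact pow_ne_zero 2 hwπ
    refine ⟨fun lam v u huv hvz => ?_, exactCanonicalForm_isReplacementOf hq hr hτ₀ hm, hδ, hγ,
      fun u => ?_⟩
    · rw [← hk']
      exact paineProblem_isSolution_iff hq hr hτ₀ hm hw0 hwπ huv hvz
    · have e1 : (besselYCanonicalForm n q₀ r₀ x₁ m).δ₁ = 0 := rfl
      have e2 : (besselYCanonicalForm n q₀ r₀ x₁ m).γ₁ = 0 := rfl
      rw [SturmLiouville.BoundaryConditions, e1, e2, zero_mul, zero_mul, sub_zero, sub_zero,
        mul_eq_zero_iff_left hδ, mul_eq_zero_iff_left hγ]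
      rfl
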